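/- Let $G$ be a second countable locally compact abelian group, written additively, and let $\sigma\colon G\times G\to\mathbb T$ be a Borel 2-cocycle, i.e. $\sigma(x,y)\sigma(x+y,z)=\sigma(x,y+z)\sigma(y,z)$ and $\sigma(x,0)=\sigma(0,y)=1$ for all $x,y,z\in G$. Assume that $\sigma$ is a Heisenberg multiplier: the formula $\Phi(x)(y)=\sigma(x,y)\overline{\sigma(y,x)}$ defines an isomorphism of topological groups $\Phi\colon G\to\widehat G$ onto the Pontryagin dual. Let $W\colon G\to\mathcal U(\mathcal H)$ be an irreducible unitary $\sigma$-representation on a (nonzero) separable complex Hilbert space $\mathcal H$, that is, $W(x)W(y)=\sigma(x,y)W(x+y)$ for all $x,y\in G$, the map $x\mapsto W(x)h$ is Borel for every $h\in\mathcal H$, and the only closed $W$-invariant subspaces of $\mathcal H$ are $0$ and $\mathcal H$. Let $Sp(G,\sigma)$ be the group of topological automorphisms $S$ of $G$ with $\sigma(Sx,Sy)=\sigma(x,y)$ for all $x,y\in G$, with the coarsest topology for which $S\mapsto S$ and $S\mapsto S^{-1}$ are continuous into $C(G,G)$ with the compact-open topology. For $S\in Sp(G,\sigma)$ write $U_S$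 for a unitary on $\mathcal H$ with $U_SW(x)U_S^*=W(Sx)$ for all $x\in G$. A Clifford operation on $(G,\sigma)$ is a unitary of the form $W(y)U_S$ with $y\in G$ and $S\in Sp(G,\sigma)$. Clifford operations form a group containing the scalars in $\mathbb T$, and the Clifford group $\mathcal C(G,\sigma)$ is the quotient of this group, with the strong operator topology, by $\mathbb T$. Let $G\rtimes Sp(G,\sigma)$ be the semidirect product, with the product topology and the group law $$(y_1,S_1)(y_2,S_2)=(y_1+S_1y_2,\;S_1S_2).$$ Then $\mathcal C(G,\sigma)$ and $G\rtimes Sp(G,\sigma)$ are topological groups, and there is an isomorphism of topological groups $\mathcal C(G,\sigma)\cong G\rtimes Sp(G,\sigma)$ which sends the class of every Clifford operation $W(y)U_S$ to $(y,S)$. -/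

import Mathlib

universe u v

noncomputable section

section Topologies

/-- The strong operator topology on the group `H ≃ₗᵢ[ℂ] H` of unitary operators of a Hilbert space
`H`: the topology of pointwise convergence on `H`.  (Multiplication in this group is composition.) -/
instance strongOperatorTopology (H : Type v) [NormedAddCommGroup H] [InnerProductSpace ℂ H] :
    TopologicalSpace (H ≃ₗᵢ[ℂ] H) :=
  TopologicalSpace.induced (fun (U : H ≃ₗᵢ[ℂ] H) (h : H) => U h) inferInstance

/-- The product topology on a semidirect product of two groups carrying topologies. -/
instance semidirectProductTopology {N : Type u} {K : Type v} [Group N] [Group K]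
    [TopologicalSpace N] [TopologicalSpace K] (φ : K →* MulAut N) :
    TopologicalSpace (N ⋊[φ] K) :=
  TopologicalSpace.induced (fun p : N ⋊[φ] K => (p.left, p.right)) inferInstance

end Topologies

section Cocycles

/-- `σ` is a (Borel, `𝕋`-valued) 2-cocycle on the abelian group `G`. -/
structure IsTwoCocycle {G : Type u} [AddCommGroup G] [MeasurableSpace G]
    (σ : G → G → Circle) : Prop where
  borel : Measurable (fun p : G × G => (σ p.1 p.2 : ℂ))
  cocycle : ∀ x y z, σ x y * σ (x + y) z = σ x (y + z) * σ y z
  right_zero : ∀ x, σ x 0 = 1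
  left_zero : ∀ y, σ 0 y = 1

/-- `σ` is a Heisenberg multiplier: a 2-cocycle for which `Φ(x)(y) = σ(x,y) * conj σ(y,x)` defines
an isomorphism of topological groups from `G` onto its Pontryagin dual.  (On the circle,
conjugation is inversion.) -/
structure IsHeisenbergMultiplier {G : Type u} [AddCommGroup G] [TopologicalSpace G]
    [MeasurableSpace G] (σ : G → G → Circle) : Prop extends IsTwoCocycle σ where
  selfDual : ∃ Φ : Multiplicative G ≃ₜ* PontryaginDual (Multiplicative G),
    ∀ x y : G, Φ (Multiplicative.ofAdd x) (Multiplicative.ofAdd y) = σ x y * (σ y x)⁻¹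

/-- The group of topological automorphisms of `G`, under composition. -/
instance topologicalAutGroup (G : Type u) [AddCommGroup G] [TopologicalSpace G] :
    Group (G ≃ₜ+ G) where
  one := ContinuousAddEquiv.refl G
  mul S T := T.trans S
  inv S := S.symm
  mul_assoc _ _ _ := rfl
  one_mul _ := rfl
  mul_one _ := rfl
  inv_mul_cancel S := ContinuousAddEquiv.ext S.symm_apply_apply

/-- The usual topology of the group of topological automorphisms of `G`: the coarsest one for which
`S ↦ S` and `S ↦ S⁻¹` are continuous into `C(G, G)` with the compact-open topology. -/
instance topologicalAutTopology (G : Type u) [AddCommGroup G] [TopologicalSpace G] :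
    TopologicalSpace (G ≃ₜ+ G) :=
  TopologicalSpace.induced
    (fun S => ((⟨S, S.continuous⟩, ⟨S.symm, S.symm.continuous⟩) : C(G, G) × C(G, G)))
    inferInstance

/-- The symplectic group `Sp(G,σ)`: the `σ`-preserving topological automorphisms of `G`, with the
subspace topology. -/
def symplecticGroup {G : Type u} [AddCommGroup G] [TopologicalSpace G] (σ : G → G → Circle) :
    Subgroup (G ≃ₜ+ G) where
  carrier := {S | ∀ x y, σ (S x) (S y) = σ x y}
  one_mem' := fun _ _ => rfl
  mul_mem' := fun {S T} hS hT x y => (hS (T x) (T y)).trans (hT x y)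
  inv_mem' := by
    intro S hS x y
    have h := hS (S.symm x) (S.symm y)
    rw [S.apply_symm_apply, S.apply_symm_apply] at h
    exact h.symm

/-- The action of `Sp(G,σ)` on `G` (written multiplicatively) by group automorphisms. -/
def symplecticAction {G : Type u} [AddCommGroup G] [TopologicalSpace G] (σ : G → G → Circle) :
    symplecticGroup σ →* MulAut (Multiplicative G) where
  toFun S := AddEquiv.toMultiplicative (S.1 : G ≃+ G)
  map_one' := rfl
  map_mul' _ _ := rfl

theorem symplecticAction_apply {G : Type u} [AddCommGroup G] [TopologicalSpace G]
    (σ : G → G → Circle) (S : symplecticGroup σ) (y : G) :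
    symplecticAction σ S (Multiplicative.ofAdd y) = Multiplicative.ofAdd (S.1 y) := rfl

/-- The semidirect product `G ⋊ Sp(G,σ)`. -/
abbrev SymplecticSemidirect {G : Type u} [AddCommGroup G] [TopologicalSpace G]
    (σ : G → G → Circle) : Type u :=
  Multiplicative G ⋊[symplecticAction σ] symplecticGroup σ

/-- The element `(y, S)` of `G ⋊ Sp(G,σ)`. -/
abbrev symplecticPair {G : Type u} [AddCommGroup G] [TopologicalSpace G] {σ : G → G → Circle}
    (y : G) (S : symplecticGroup σ) : SymplecticSemidirect σ :=
  ⟨Multiplicative.ofAdd y, S⟩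

end Cocycles

section Phases

variable (H : Type v) [NormedAddCommGroup H] [InnerProductSpace ℂ H]

/-- A phase `c ∈ 𝕋` as the scalar unitary operator `c • 1`. -/
def phase : Circle →* (H ≃ₗᵢ[ℂ] H) where
  toFun c :=
    { LinearEquiv.smulOfNeZero ℂ H (c : ℂ) c.coe_ne_zero with
      norm_map' := fun h => by
        change ‖(c : ℂ) • h‖ = ‖h‖
        rw [norm_smul, Circle.norm_coe, one_mul] }
  map_one' := by
    ext h
    change ((1 : Circle) : ℂ) • h = h
    rw [Circle.coe_one, one_smul]
  map_mul' c d := by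
    ext h
    change ((c * d : Circle) : ℂ) • h = (c : ℂ) • (d : ℂ) • h
    rw [Circle.coe_mul, mul_smul]

theorem phase_apply (c : Circle) (h : H) : phase H c h = (c : ℂ) • h := rfl

theorem phase_mul_comm (c : Circle) (U : H ≃ₗᵢ[ℂ] H) : phase H c * U = U * phase H c := by
  ext h
  change (c : ℂ) • U h = U ((c : ℂ) • h)
  rw [map_smul]

/-- The group `𝕋` of phases inside the unitary group. -/
def phases : Subgroup (H ≃ₗᵢ[ℂ] H) := (phase H).range

instance phases_normal : (phases H).Normal := by
  refine ⟨?_⟩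
  rintro _ ⟨c, rfl⟩ U
  exact ⟨c, by rw [← phase_mul_comm, mul_inv_cancel_right]⟩

end Phases

section Clifford

set_option linter.unusedSectionVars false

variable {G : Type u} [AddCommGroup G] {H : Type v} [NormedAddCommGroup H] [InnerProductSpace ℂ H]

/-- `W` is a unitary projective representation of `G` with multiplier `σ`. -/
structure IsSigmaRepresentation [MeasurableSpace G] [MeasurableSpace H]
    (σ : G → G → Circle) (W : G → (H ≃ₗᵢ[ℂ] H)) : Prop where
  borel : ∀ h : H, Measurable (fun x => W x h)
  mul : ∀ x y, W x * W y = phase H (σ x y) * W (x + y)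

/-- `W` is irreducible: `H ≠ 0`, and the only closed subspaces of `H` invariant under all `W x` are
`0` and `H`. -/
def IsIrreducibleFamily (W : G → (H ≃ₗᵢ[ℂ] H)) : Prop :=
  Nontrivial H ∧ ∀ K : Submodule ℂ H, IsClosed (K : Set H) →
    (∀ x, ∀ h ∈ K, W x h ∈ K) → K = ⊥ ∨ K = ⊤

/-- `U` is a gaussian unitary associated with the map `S`, that is, one of the `U_S`. -/
def IsGaussianUnitary (W : G → (H ≃ₗᵢ[ℂ] H)) (S : G → G) (U : H ≃ₗᵢ[ℂ] H) : Prop :=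
  ∀ x, U * W x * U⁻¹ = W (S x)

/-- `U` is a Clifford operation: `U = W(y) U_S` with `y ∈ G` and `S ∈ Sp(G,σ)`. -/
def IsCliffordOperation [TopologicalSpace G] (σ : G → G → Circle) (W : G → (H ≃ₗᵢ[ℂ] H))
    (U : H ≃ₗᵢ[ℂ] H) : Prop :=
  ∃ (y : G) (S : symplecticGroup σ) (V : H ≃ₗᵢ[ℂ] H), IsGaussianUnitary W S.1 V ∧ U = W y * V

theorem IsGaussianUnitary.phase_mul {W : G → (H ≃ₗᵢ[ℂ] H)} {S : G → G} {U : H ≃ₗᵢ[ℂ] H}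
    (hU : IsGaussianUnitary W S U) (c : Circle) : IsGaussianUnitary W S (phase H c * U) := by
  intro x
  rw [← hU x, mul_inv_rev]
  calc phase H c * U * W x * (U⁻¹ * (phase H c)⁻¹)
      = phase H c * (U * W x * U⁻¹) * (phase H c)⁻¹ := by group
    _ = U * W x * U⁻¹ := by rw [phase_mul_comm, mul_inv_cancel_right]

theorem IsGaussianUnitary.mul {W : G → (H ≃ₗᵢ[ℂ] H)} {S T : G → G} {U V : H ≃ₗᵢ[ℂ] H}
    (hU : IsGaussianUnitary W S U) (hV : IsGaussianUnitary W T V) :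
    IsGaussianUnitary W (S ∘ T) (U * V) := by
  intro x
  change _ = W (S (T x))
  rw [← hU (T x), ← hV x]
  group

theorem IsGaussianUnitary.inv [TopologicalSpace G] {W : G → (H ≃ₗᵢ[ℂ] H)} {S : G ≃ₜ+ G} {U : H ≃ₗᵢ[ℂ] H}
    (hU : IsGaussianUnitary W S U) : IsGaussianUnitary W S.symm U⁻¹ := by
  intro x
  have h := hU (S.symm x)
  rw [S.apply_symm_apply] at h
  rw [← h]
  group

variable [TopologicalSpace G] [MeasurableSpace G] [MeasurableSpace H] {σ : G → G → Circle}
  {W : G → (H ≃ₗᵢ[ℂ] H)}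

theorem IsSigmaRepresentation.map_zero (hσ : IsTwoCocycle σ) (hW : IsSigmaRepresentation σ W) :
    W 0 = 1 := by
  have h := hW.mul 0 0
  rw [hσ.right_zero, _root_.map_one, one_mul, add_zero] at h
  exact mul_eq_left.mp h

/-- The Clifford operations on `(G,σ)`; they form a subgroup of the unitary group, which contains
all phases. -/
def cliffordOperations (hσ : IsTwoCocycle σ) (hW : IsSigmaRepresentation σ W) :
    Subgroup (H ≃ₗᵢ[ℂ] H) where
  carrier := {U | IsCliffordOperation σ W U}
  one_mem' := ⟨0, 1, 1, fun x => by rw [one_mul, inv_one, mul_one]; rfl, by rw [hW.map_zero hσ, one_mul]⟩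
  mul_mem' := by
    rintro _ _ ⟨y, S, U, hU, rfl⟩ ⟨z, T, V, hV, rfl⟩
    refine ⟨y + S.1 z, S * T, phase H (σ y (S.1 z)) * (U * V), (hU.mul hV).phase_mul _, ?_⟩
    calc W y * U * (W z * V) = W y * (U * W z * U⁻¹) * (U * V) := by group
      _ = phase H (σ y (S.1 z)) * W (y + S.1 z) * (U * V) := by rw [hU z, hW.mul]
      _ = _ := by rw [phase_mul_comm, mul_assoc]
  inv_mem' := by
    rintro _ ⟨y, S, U, hU, rfl⟩
    refine ⟨S.1.symm (-y), S⁻¹, phase H (σ y (-y))⁻¹ * U⁻¹, hU.inv.phase_mul _, ?_⟩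
    have h1 : W y * W (-y) = phase H (σ y (-y)) := by
      rw [hW.mul, add_neg_cancel, hW.map_zero hσ, mul_one]
    have h2 : (W y)⁻¹ = W (-y) * phase H (σ y (-y))⁻¹ := by
      rw [_root_.map_inv, ← h1]
      group
    rw [mul_inv_rev, h2, ← hU.inv (-y)]
    rw [← phase_mul_comm, ← mul_assoc, ← phase_mul_comm, ← mul_assoc, ← phase_mul_comm]
    group

/-- The Clifford group `𝒞(G,σ)`: Clifford operations modulo phases, with the quotient of the strong
operator topology. -/
abbrev CliffordGroup (hσ : IsTwoCocycle σ) (hW : IsSigmaRepresentation σ W) : Type v :=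
  cliffordOperations hσ hW ⧸ (phases H).subgroupOf (cliffordOperations hσ hW)

/-- The class in the Clifford group of the Clifford operation `W(y) V`, where `V` is a gaussian
unitary associated with `S ∈ Sp(G,σ)`. -/
def cliffordClass (hσ : IsTwoCocycle σ) (hW : IsSigmaRepresentation σ W) (y : G)
    (S : symplecticGroup σ) (V : H ≃ₗᵢ[ℂ] H) (hV : IsGaussianUnitary W S.1 V) :
    CliffordGroup hσ hW :=
  QuotientGroup.mk ⟨W y * V, y, S, V, hV, rfl⟩

end Clifford

end

open MeasureTheory Filter Topology
open scoped ENNReal NNReal InnerProductSpace ComplexConjugate CompactlySupported Pointwise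

set_option linter.unusedSectionVars false

noncomputable section

/-! Write b(x,y) = σ(x,y)σ(y,x)⁻¹, so that W(x)W(y) = b(x,y)W(y)W(x). Conjugation by W(y)U_S sends
W(x) to b(y,Sx)W(Sx). Since b is non-degenerate, this action determines (y,S); by Schur's lemma it
determines the operation up to a phase. Hence (y,S) ↦ [W(y)U_S] is an injective homomorphism. It is
defined everywhere because U_S exists: W∘S is again an irreducible σ-representation, and the
Stone–von Neumann theorem (`IsIrreducibleFamily.exists_unitary`) makes it equivalent to W.

Stone–von Neumann rests on square integrability of matrix coefficients. Bochner's theorem, obtained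
from Gelfand theory, attaches a spectral measure ν_v to each v in L²(G) under translation. Since v*w
= w*v, one has |ŵ|²ν_v = |v̂|²ν_w for v, w in L¹∩L², and averaging over modulations of w gives a
Bessel inequality ∫|ŵ|² ≤ C∫|w|². This produces one vector with square integrable coefficients;
Schur's lemma and density then give the orthogonality relations
(`IsIrreducibleFamily.exists_coeffPairing_eq`) with a constant κ ≠ 0. Averages of two irreducible
σ-representations are intertwiners, and they cannot all vanish, because translating the vectors by
W(y) turns them into the Fourier transform of a nonzero function.

For continuity of (y,S) ↦ [W(y)U_S] it suffices to look at the identity. By the orthogonality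
relations a rank one operator A is a norm limit of operators W(f) = ∫ f(x)W(x)dx with f in C_c(G).
Conjugating W(f) by an implementer U of (y,S) replaces f by a function that is L¹-close to f when
(y,S) is near (0,1). So U⁻¹AU tends to A in norm, which forces U to tend strongly to 1 up to a
phase.

For the inverse, commutators do not see phases, so the class of W(y) yields b(y,z) jointly
continuously with z, and self-duality recovers y. The automorphism S is recovered from u[W(x)]u⁻¹ =
[W(Sx)]. -/

/-- A symplectic self-duality of `G`: an alternating bicharacter whose associated map is an
isomorphism of `G` onto its Pontryagin dual. -/
structure IsSelfDualPairing {G : Type u} [AddCommGroup G] [TopologicalSpace G]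
    (b : G → G → Circle) : Prop where
  selfDual : ∃ Φ : Multiplicative G ≃ₜ* PontryaginDual (Multiplicative G),
    ∀ x y : G, Φ (Multiplicative.ofAdd x) (Multiplicative.ofAdd y) = b x y
  symm : ∀ x y, b y x = (b x y)⁻¹

/-! ### Self-dual pairings and uniqueness of Fourier transforms -/

namespace IsSelfDualPairing

variable {G : Type u} [AddCommGroup G] [TopologicalSpace G] {b : G → G → Circle}

theorem add_left (hb : IsSelfDualPairing b) (x x' y : G) : b (x + x') y = b x y * b x' y := by
  obtain ⟨Φ, hΦ⟩ := hb.selfDual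
  rw [← hΦ, ← hΦ, ← hΦ, ofAdd_add, map_mul]
  rfl

theorem add_right (hb : IsSelfDualPairing b) (x y y' : G) : b x (y + y') = b x y * b x y' := by
  obtain ⟨Φ, hΦ⟩ := hb.selfDual
  rw [← hΦ, ← hΦ, ← hΦ, ofAdd_add, map_mul]

theorem zero_left (hb : IsSelfDualPairing b) (y : G) : b 0 y = 1 := by
  simpa using hb.add_left 0 0 y

theorem zero_right (hb : IsSelfDualPairing b) (x : G) : b x 0 = 1 := by
  simpa using hb.add_right x 0 0

theorem neg_left (hb : IsSelfDualPairing b) (x y : G) : b (-x) y = (b x y)⁻¹ := by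
  have h := hb.add_left (-x) x y
  rw [neg_add_cancel, hb.zero_left] at h
  exact eq_inv_of_mul_eq_one_left h.symm

theorem neg_right (hb : IsSelfDualPairing b) (x y : G) : b x (-y) = (b x y)⁻¹ := by
  have h := hb.add_right x (-y) y
  rw [neg_add_cancel, hb.zero_right] at h
  exact eq_inv_of_mul_eq_one_left h.symm

theorem sub_left (hb : IsSelfDualPairing b) (x x' y : G) : b (x - x') y = b x y * (b x' y)⁻¹ := by
  rw [sub_eq_add_neg, hb.add_left, hb.neg_left]

theorem sub_right (hb : IsSelfDualPairing b) (x y y' : G) : b x (y - y') = b x y * (b x y')⁻¹ := by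
  rw [sub_eq_add_neg, hb.add_right, hb.neg_right]

theorem eq_zero_of_forall (hb : IsSelfDualPairing b) {x : G} (h : ∀ y, b x y = 1) : x = 0 := by
  obtain ⟨Φ, hΦ⟩ := hb.selfDual
  have : Φ (Multiplicative.ofAdd x) = 1 := by
    ext y
    rw [← ofAdd_toAdd y, hΦ, h]
    rfl
  rw [map_eq_one_iff _ Φ.injective] at this
  exact this

theorem t2Space (hb : IsSelfDualPairing b) : T2Space G := by
  obtain ⟨Φ, -⟩ := hb.selfDual
  exact (Φ.toHomeomorph.isEmbedding.t2Space : T2Space (Multiplicative G))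

theorem exists_eq (hb : IsSelfDualPairing b) {ψ : G → Circle} (hψ : Continuous ψ)
    (hadd : ∀ x y, ψ (x + y) = ψ x * ψ y) : ∃ x, ∀ y, b x y = ψ y := by
  obtain ⟨Φ, hΦ⟩ := hb.selfDual
  have h0 : ψ 0 = 1 := by simpa using hadd 0 0
  let ψ' : PontryaginDual (Multiplicative G) :=
    (⟨⟨⟨fun y => ψ y.toAdd, h0⟩, fun x y => hadd _ _⟩, hψ⟩ : Multiplicative G →ₜ* Circle)
  refine ⟨(Φ.symm ψ').toAdd, fun y => ?_⟩
  rw [← hΦ, ofAdd_toAdd, Φ.apply_symm_apply]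
  rfl

/-- The dual carries the compact-open topology, so joint continuity of the pairing curries to
continuity of Φ∘f, and Φ is a homeomorphism. All continuity statements about points recovered from
their characters go through this. -/
theorem continuous_of_continuous_pairing (hb : IsSelfDualPairing b) {X : Type*}
    [TopologicalSpace X] {f : X → G} (hf : Continuous fun p : X × G => b (f p.1) p.2) :
    Continuous f := by
  obtain ⟨Φ, hΦ⟩ := hb.selfDual
  have h1 : Continuous fun p : X => Φ (Multiplicative.ofAdd (f p)) := by
    refine (ContinuousMonoidHom.isInducing_toContinuousMap
      (Multiplicative G) Circle).continuous_iff.2 ?_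
    refine ContinuousMap.continuous_of_continuous_uncurry _ ?_
    have : Continuous fun p : X × Multiplicative G => b (f p.1) p.2.toAdd := hf
    convert this using 2 with p
    exact hΦ (f p.1) p.2.toAdd
  have h2 := Φ.symm.continuous_toFun.comp h1
  have h3 : (⇑Φ.symm ∘ fun p : X => Φ (Multiplicative.ofAdd (f p))) =
      fun p => Multiplicative.ofAdd (f p) := by
    ext p; exact Φ.symm_apply_apply _
  exact (congrArg Continuous h3).mp h2

theorem continuous_uncurry [LocallyCompactSpace G] (hb : IsSelfDualPairing b) :
    Continuous fun p : G × G => b p.1 p.2 := by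
  obtain ⟨Φ, hΦ⟩ := hb.selfDual
  have h1 : Continuous fun x : Multiplicative G =>
      ContinuousMonoidHom.toContinuousMap (Φ x) :=
    (ContinuousMonoidHom.isInducing_toContinuousMap
      (Multiplicative G) Circle).continuous.comp Φ.continuous_toFun
  have : LocallyCompactSpace (Multiplicative G) := ‹LocallyCompactSpace G›
  have h2 : Continuous fun p : Multiplicative G × Multiplicative G =>
      (ContinuousMonoidHom.toContinuousMap (Φ p.1)) p.2 :=
    ContinuousMap.continuous_uncurry_of_continuous
      ⟨fun x => ContinuousMonoidHom.toContinuousMap (Φ x), h1⟩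
  have : (fun p : Multiplicative G × Multiplicative G =>
      (ContinuousMonoidHom.toContinuousMap (Φ p.1)) p.2) = fun p : G × G => b p.1 p.2 := by
    ext p; exact congrArg _ (hΦ _ _)
  exact this ▸ h2

variable [IsTopologicalAddGroup G] [LocallyCompactSpace G]

theorem continuous_left (hb : IsSelfDualPairing b) (y : G) : Continuous fun x => b x y :=
  hb.continuous_uncurry.comp (by fun_prop : Continuous fun x : G => (x, y))

theorem continuous_right (hb : IsSelfDualPairing b) (x : G) : Continuous fun y => b x y :=
  hb.continuous_uncurry.comp (by fun_prop : Continuous fun y : G => (x, y))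

theorem continuous_coe_left (hb : IsSelfDualPairing b) (y : G) :
    Continuous fun x => (b x y : ℂ) :=
  continuous_subtype_val.comp (hb.continuous_left y)

theorem continuous_coe_right (hb : IsSelfDualPairing b) (x : G) :
    Continuous fun y => (b x y : ℂ) :=
  continuous_subtype_val.comp (hb.continuous_right x)

/-- The characters of `G`, as bounded continuous functions. -/
def character (hb : IsSelfDualPairing b) : Multiplicative G →* BoundedContinuousFunction G ℂ where
  toFun x := BoundedContinuousFunction.ofNormedAddCommGroup (fun y => (b y x.toAdd : ℂ))
    (hb.continuous_coe_left _) 1 (fun y => (Circle.norm_coe _).le)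
  map_one' := by
    ext y
    simp [hb.zero_right]
  map_mul' x x' := by
    ext y
    simp [hb.add_right]

variable [SecondCountableTopology G] [MeasurableSpace G] [BorelSpace G]

theorem measurable_uncurry (hb : IsSelfDualPairing b) :
    Measurable fun p : G × G => (b p.1 p.2 : ℂ) := by
  have := hb.t2Space
  exact (continuous_subtype_val.comp hb.continuous_uncurry).measurable

theorem polishSpace (hb : IsSelfDualPairing b) : PolishSpace G := by
  have := hb.t2Space
  let := IsTopologicalAddGroup.rightUniformSpace G
  have := isUniformAddGroup_of_addCommGroup (G := G)
  have : (uniformity G).IsCountablyGenerated :=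
    IsUniformAddGroup.uniformity_countably_generated
  have : CompleteSpace G := IsRightUniformAddGroup.completeSpace_of_weaklyLocallyCompactSpace
  infer_instance

/-- Finite measures on `G` are determined by their Fourier transforms. -/
theorem measure_ext (hb : IsSelfDualPairing b) {P Q : Measure G} [IsFiniteMeasure P]
    [IsFiniteMeasure Q] (h : ∀ x, ∫ y, (b y x : ℂ) ∂P = ∫ y, (b y x : ℂ) ∂Q) : P = Q := by
  have := hb.polishSpace
  -- The characters form a monoid stable under conjugation, so the algebra they generate is a star
  -- algebra. It separates points because `b` is non-degenerate.
  let M : Submonoid (BoundedContinuousFunction G ℂ) := MonoidHom.mrange hb.character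
  let A : StarSubalgebra ℂ (BoundedContinuousFunction G ℂ) :=
    { toSubalgebra := Algebra.adjoin ℂ (M : Set (BoundedContinuousFunction G ℂ))
      star_mem' := by
        intro a ha
        change star a ∈ Algebra.adjoin ℂ (M : Set (BoundedContinuousFunction G ℂ))
        induction ha using Algebra.adjoin_induction with
        | mem x hx =>
          obtain ⟨z, rfl⟩ := hx
          refine Algebra.subset_adjoin ⟨z⁻¹, ?_⟩
          ext y
          simpa [character, hb.neg_right] using
            Circle.coe_inv_eq_conj (b y z.toAdd)
        | algebraMap r => rw [← algebraMap_star_comm]; exact Subalgebra.algebraMap_mem _ _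
        | add x y _ _ hx hy => rw [star_add]; exact add_mem hx hy
        | mul x y _ _ hx hy => rw [star_mul]; exact mul_mem hy hx }
  refine ext_of_forall_mem_subalgebra_integral_eq_of_polish (𝕜 := ℂ) (A := A) ?_ ?_
  · intro x y hxy
    by_contra! hcon
    refine hxy (sub_eq_zero.1 (hb.eq_zero_of_forall fun z => ?_))
    have h1 := hcon (hb.character (Multiplicative.ofAdd z))
      ⟨_, ⟨hb.character (Multiplicative.ofAdd z), Algebra.subset_adjoin ⟨_, rfl⟩, rfl⟩, rfl⟩
    have h2 : b x z = b y z := Circle.ext h1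
    rw [hb.sub_left, h2, mul_inv_cancel]
  · intro g hg
    -- A product of characters is a character, so the generated algebra is just their linear span
    -- and the hypothesis extends by linearity.
    have hg' : g ∈ Submodule.span ℂ (M : Set (BoundedContinuousFunction G ℂ)) := by
      have : g ∈ Subalgebra.toSubmodule (Algebra.adjoin ℂ
        (M : Set (BoundedContinuousFunction G ℂ))) := hg
      rwa [Algebra.adjoin_eq_span, Submonoid.closure_eq] at this
    clear hg
    induction hg' using Submodule.span_induction with
    | mem x hx => obtain ⟨z, rfl⟩ := hx; exact h _
    | zero => simp
    | add f g _ _ hf hg =>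
      simp only [BoundedContinuousFunction.coe_add, Pi.add_apply]
      rw [integral_add (f.integrable P) (g.integrable P),
        integral_add (f.integrable Q) (g.integrable Q), hf, hg]
    | smul c f _ hf =>
      simp only [BoundedContinuousFunction.coe_smul]
      rw [integral_smul, integral_smul, hf]

theorem integrable_mul_left (hb : IsSelfDualPairing b) {μ : Measure G} {g : G → ℂ}
    (hg : Integrable g μ) (x : G) : Integrable (fun y => g y * (b y x : ℂ)) μ := by
  refine hg.mul_bdd (c := 1) ?_ (ae_of_all _ fun y => (Circle.norm_coe _).le)
  exact (hb.continuous_coe_left x).aestronglyMeasurable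

/-- The positive and negative parts of `g` are densities of two finite measures with equal Fourier
transforms, so these measures coincide. -/
theorem ae_eq_zero_of_real (hb : IsSelfDualPairing b) {μ : Measure G} [SigmaFinite μ] {g : G → ℝ}
    (hg : Integrable g μ) (h : ∀ x, ∫ y, (g y : ℂ) * (b y x : ℂ) ∂μ = 0) : g =ᵐ[μ] 0 := by
  have hfin : ∀ {f : G → ℝ}, Integrable f μ →
      IsFiniteMeasure (μ.withDensity fun y => ENNReal.ofReal (f y)) := fun hf =>
    isFiniteMeasure_withDensity_ofReal hf.2
  have := hfin hg
  have := hfin hg.neg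
  have key : ∀ {f : G → ℝ}, Integrable f μ → ∀ x,
      ∫ y, (b y x : ℂ) ∂(μ.withDensity fun y => ENNReal.ofReal (f y)) =
        ∫ y, ((max (f y) 0 : ℝ) : ℂ) * (b y x : ℂ) ∂μ := by
    intro f hf x
    rw [integral_withDensity_eq_integral_toReal_smul₀ hf.1.aemeasurable.ennreal_ofReal
      (ae_of_all _ fun _ => ENNReal.ofReal_lt_top)]
    refine integral_congr_ae (ae_of_all _ fun y => ?_)
    simp only [ENNReal.toReal_ofReal', Complex.real_smul]
  have heq : (μ.withDensity fun y => ENNReal.ofReal (g y)) =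
      μ.withDensity fun y => ENNReal.ofReal ((-g) y) := by
    refine hb.measure_ext fun x => ?_
    rw [key hg, key hg.neg, ← sub_eq_zero, ← integral_sub, ← h x]
    · refine integral_congr_ae (ae_of_all _ fun y => ?_)
      simp only [Pi.neg_apply]
      rw [← sub_mul, ← Complex.ofReal_sub, max_zero_sub_max_neg_zero_eq_self]
    · exact hb.integrable_mul_left (hg.pos_part.ofReal) x
    · exact hb.integrable_mul_left (hg.neg.pos_part.ofReal) x
  rw [withDensity_eq_iff hg.1.aemeasurable.ennreal_ofReal hg.neg.1.aemeasurable.ennreal_ofReal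
    ?_] at heq
  swap
  · exact ((lintegral_mono fun y => Real.ofReal_le_enorm (g y)).trans_lt hg.2).ne
  filter_upwards [heq] with y hy
  have h1 := congrArg ENNReal.toReal hy
  simp only [ENNReal.toReal_ofReal', Pi.neg_apply] at h1
  have h2 := max_zero_sub_max_neg_zero_eq_self (g y)
  simp only [Pi.zero_apply]
  linarith

/-- An integrable function whose Fourier transform vanishes is zero almost everywhere. -/
theorem ae_eq_zero_of_forall (hb : IsSelfDualPairing b) {μ : Measure G} [SigmaFinite μ] {g : G → ℂ}
    (hg : Integrable g μ) (h : ∀ x, ∫ y, g y * (b y x : ℂ) ∂μ = 0) : g =ᵐ[μ] 0 := by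
  -- Conjugating `g` conjugates its transform and replaces x by -x, so the transforms of the real
  -- and imaginary parts vanish as well.
  have hc : ∀ x, ∫ y, conj (g y) * (b y x : ℂ) ∂μ = 0 := by
    intro x
    rw [← map_zero (starRingEnd ℂ), ← h (-x), ← integral_conj]
    refine integral_congr_ae (ae_of_all _ fun y => ?_)
    simp only [map_mul, hb.neg_right, Circle.coe_inv_eq_conj, Complex.conj_conj]
  have hgc : Integrable (fun y => conj (g y)) μ := by
    simpa using (LinearIsometryEquiv.integrable_comp_iff Complex.conjLIE).2 hg
  have hre : (fun y => (g y).re) =ᵐ[μ] 0 := by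
    refine hb.ae_eq_zero_of_real hg.re fun x => ?_
    have : ∀ y, ((g y).re : ℂ) * (b y x : ℂ) =
        (1 / 2 : ℂ) * (g y * (b y x : ℂ) + conj (g y) * (b y x : ℂ)) := fun y => by
      rw [Complex.re_eq_add_conj]; ring
    simp_rw [this]
    rw [integral_const_mul, integral_add (hb.integrable_mul_left hg x)
      (hb.integrable_mul_left hgc x), h, hc, add_zero, mul_zero]
  have him : (fun y => (g y).im) =ᵐ[μ] 0 := by
    refine hb.ae_eq_zero_of_real hg.im fun x => ?_
    have : ∀ y, ((g y).im : ℂ) * (b y x : ℂ) =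
        (1 / (2 * Complex.I) : ℂ) * (g y * (b y x : ℂ) - conj (g y) * (b y x : ℂ)) := fun y => by
      rw [Complex.im_eq_sub_conj]; ring
    simp_rw [this]
    rw [integral_const_mul, integral_sub (hb.integrable_mul_left hg x)
      (hb.integrable_mul_left hgc x), h, hc, sub_zero, mul_zero]
  filter_upwards [hre, him] with y h1 h2
  exact Complex.ext h1 h2

end IsSelfDualPairing

/-! ### Spectral measures through Gelfand duality -/

section SpectralMeasure

open WeakDual

variable {A : Type*} [CommCStarAlgebra A] {K : Type*} [NormedAddCommGroup K]
  [InnerProductSpace ℂ K] [CompleteSpace K]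

/-- The positive functional on real continuous functions on the Gelfand spectrum given by a vector
of a representation. -/
def gelfandVectorFunctional (ρ : A →⋆ₐ[ℂ] (K →L[ℂ] K)) (v : K) :
    C_c(characterSpace ℂ A, ℝ) →ₚ[ℝ] ℝ where
  toFun g := (⟪v, ρ ((gelfandStarTransform A).symm
    ⟨fun ω => (g ω : ℂ), by fun_prop⟩) v⟫_ℂ).re
  map_add' f g := by
    have : (⟨fun ω => ((f + g) ω : ℂ), by fun_prop⟩ : C(characterSpace ℂ A, ℂ)) =
        ⟨fun ω => (f ω : ℂ), by fun_prop⟩ + ⟨fun ω => (g ω : ℂ), by fun_prop⟩ := by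
      ext; simp
    rw [this, map_add, map_add, add_apply, inner_add_right, Complex.add_re]
  map_smul' c g := by
    have : (⟨fun ω => ((c • g) ω : ℂ), by fun_prop⟩ : C(characterSpace ℂ A, ℂ)) =
        (c : ℂ) • ⟨fun ω => (g ω : ℂ), by fun_prop⟩ := by
      ext; simp
    rw [this, map_smul, map_smul, smul_apply, inner_smul_right]
    simp
  monotone' f g hfg := by
    -- The difference g - f is h*h for its square root h, so the functional increases by ‖ρ(h)v‖².
    let h : C(characterSpace ℂ A, ℂ) := ⟨fun ω => (Real.sqrt (g ω - f ω) : ℂ), by fun_prop⟩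
    have h1 : (⟨fun ω => (g ω : ℂ), by fun_prop⟩ : C(characterSpace ℂ A, ℂ)) =
        ⟨fun ω => (f ω : ℂ), by fun_prop⟩ + star h * h := by
      ext ω
      have : (0 : ℝ) ≤ g ω - f ω := sub_nonneg.2 (hfg ω)
      simp only [ContinuousMap.coe_mk, ContinuousMap.add_apply, ContinuousMap.mul_apply,
        ContinuousMap.star_apply, h, RCLike.star_def, Complex.conj_ofReal]
      rw [← Complex.ofReal_mul, Real.mul_self_sqrt this]
      push_cast; ring
    change (⟪v, ρ _ v⟫_ℂ).re ≤ (⟪v, ρ _ v⟫_ℂ).re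
    rw [h1, map_add, map_mul, map_star, map_add, map_mul, map_star, add_apply,
      inner_add_right, Complex.add_re, mul_apply_eq_comp,
      ContinuousLinearMap.star_eq_adjoint, ContinuousLinearMap.adjoint_inner_right]
    have := inner_self_nonneg (𝕜 := ℂ) (x := ρ ((gelfandStarTransform A).symm h) v)
    simpa using this

variable [MeasurableSpace (characterSpace ℂ A)] [BorelSpace (characterSpace ℂ A)]

/-- The spectral measure of a vector in a representation of a commutative C⋆-algebra. -/
theorem exists_spectralMeasure (ρ : A →⋆ₐ[ℂ] (K →L[ℂ] K)) (v : K) :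
    ∃ m : Measure (characterSpace ℂ A), IsFiniteMeasure m ∧
      ∀ a, ∫ ω, ω a ∂m = ⟪v, ρ a v⟫_ℂ := by
  refine ⟨RealRMK.rieszMeasure (gelfandVectorFunctional ρ v), inferInstance, ?_⟩
  -- The Gelfand transform of a self-adjoint element is real, so the Riesz–Markov formula applies
  -- directly; the general case splits into real and imaginary parts.
  have hsa : ∀ a : A, IsSelfAdjoint a →
      ∫ ω, ω a ∂(RealRMK.rieszMeasure (gelfandVectorFunctional ρ v)) = ⟪v, ρ a v⟫_ℂ := by
    intro a ha
    have hre : ∀ ω : characterSpace ℂ A, ((ω a).re : ℂ) = ω a := fun ω => by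
      refine Complex.conj_eq_iff_re.1 ?_
      have := map_star ω a
      rw [ha.star_eq] at this
      exact this.symm
    let g : C_c(characterSpace ℂ A, ℝ) :=
      ⟨⟨fun ω => (ω a).re, by
        exact Complex.continuous_re.comp (gelfandTransform ℂ A a).continuous⟩,
        HasCompactSupport.of_compactSpace _⟩
    have h1 := RealRMK.integral_rieszMeasure (gelfandVectorFunctional ρ v) g
    have h2 : (gelfandVectorFunctional ρ v) g = (⟪v, ρ a v⟫_ℂ).re := by
      change (⟪v, ρ ((gelfandStarTransform A).symm _) v⟫_ℂ).re = _
      congr 4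
      rw [StarAlgEquiv.symm_apply_eq]
      ext ω
      exact hre ω
    have h3 : ((⟪v, ρ a v⟫_ℂ).re : ℂ) = ⟪v, ρ a v⟫_ℂ := by
      refine Complex.conj_eq_iff_re.1 ?_
      rw [inner_conj_symm, ← ContinuousLinearMap.adjoint_inner_right,
        ← ContinuousLinearMap.star_eq_adjoint, ← map_star, ha.star_eq]
    rw [← h3, ← h2, ← h1, ← integral_complex_ofReal]
    exact integral_congr_ae (ae_of_all _ fun ω => (hre ω).symm)
  have hint : ∀ a : A, Integrable (fun ω : characterSpace ℂ A => ω a)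
      (RealRMK.rieszMeasure (gelfandVectorFunctional ρ v)) := fun a =>
    (BoundedContinuousFunction.mkOfCompact (gelfandTransform ℂ A a)).integrable _
  intro a
  rw [← realPart_add_I_smul_imaginaryPart a]
  simp only [map_add, map_smul, smul_eq_mul]
  rw [integral_add (hint _) ((hint _).const_mul _), integral_const_mul, hsa _ (realPart a).2,
    hsa _ (imaginaryPart a).2, add_apply, smul_apply,
    inner_add_right, inner_smul_right]

variable {G : Type u} [AddCommGroup G] [TopologicalSpace G] [IsTopologicalAddGroup G]
  [LocallyCompactSpace G] [SecondCountableTopology G] [MeasurableSpace G] [BorelSpace G]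
  {b : G → G → Circle}

theorem continuous_characterSpace_eval :
    Continuous fun p : characterSpace ℂ A × A => p.1 p.2 := by
  have h : Continuous fun p : characterSpace ℂ A × A => (gelfandTransform ℂ A p.2) p.1 := by
    have := (gelfandTransform_isometry A).continuous
    fun_prop
  exact h

/-- Bochner's theorem for a unitary group `p x` in a commutative C⋆-algebra that is norm continuous
after multiplication by the elements of an approximate identity `s`. -/
theorem IsSelfDualPairing.exists_measure_of_commCStarAlgebra (hb : IsSelfDualPairing b)
    (ρ : A →⋆ₐ[ℂ] (K →L[ℂ] K)) (p : G → A) (hadd : ∀ x y, p (x + y) = p x * p y) (h0 : p 0 = 1)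
    (hstar : ∀ x, star (p x) = p (-x)) (s : Set A) (hs : ∀ a ∈ s, Continuous fun x => p x * a)
    (v : K) (hv : ∀ ε > 0, ∃ a ∈ s, ‖v - ρ a v‖ ≤ ε) :
    ∃ μ : Measure G, IsFiniteMeasure μ ∧ ∀ x, ∫ y, (b y x : ℂ) ∂μ = ⟪v, ρ (p x) v⟫_ℂ := by
  obtain ⟨m, hm, hint⟩ := exists_spectralMeasure ρ v
  -- The functions x ↦ ω(p x) need not be continuous for every ω. On `Ω₀` they are, since ω(p x) =
  -- ω(p x · a) / ω(a) with a in `s`.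
  let Ω₀ : Set (characterSpace ℂ A) := {ω | ∃ a ∈ s, ω a ≠ 0}
  have hnorm : ∀ (ω : characterSpace ℂ A) x, ‖ω (p x)‖ = 1 := by
    intro ω x
    have h1 : ω (p x) * conj (ω (p x)) = 1 := by
      have := map_star ω (p x)
      rw [← Complex.star_def, ← this, hstar, ← map_mul, ← hadd, add_neg_cancel, h0, map_one]
    rw [Complex.mul_conj, ← Complex.ofReal_one, Complex.ofReal_inj, Complex.normSq_eq_norm_sq] at h1
    exact (pow_eq_one_iff_of_nonneg (norm_nonneg _) two_ne_zero).1 h1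
  have hcont : ∀ q : Ω₀ × G, ContinuousAt (fun q : Ω₀ × G => q.1.1 (p q.2)) q := by
    rintro ⟨⟨ω, a, ha, hω⟩, x⟩
    have h1 : Continuous fun q : Ω₀ × G => q.1.1 (p q.2 * a) :=
      continuous_characterSpace_eval.comp
        ((continuous_subtype_val.comp continuous_fst).prodMk ((hs a ha).comp continuous_snd))
    have h2 : Continuous fun q : Ω₀ × G => q.1.1 a :=
      continuous_characterSpace_eval.comp
        ((continuous_subtype_val.comp continuous_fst).prodMk continuous_const)
    refine (h1.continuousAt.div h2.continuousAt hω).congr ?_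
    filter_upwards [h2.continuousAt.eventually_ne hω] with q hq
    change q.1.1 (p q.2 * a) / q.1.1 a = _
    rw [map_mul]
    exact mul_div_cancel_right₀ _ hq
  have hcont' : Continuous fun q : Ω₀ × G => q.1.1 (p q.2) := continuous_iff_continuousAt.2 hcont
  -- Each such ω restricts to a continuous character of the group, hence to a point θ(ω) of G.
  have hex : ∀ ω : Ω₀, ∃ y, ∀ x, (b y x : ℂ) = ω.1 (p x) := by
    intro ω
    obtain ⟨y, hy⟩ := hb.exists_eq
      (ψ := fun x => (⟨ω.1 (p x), mem_sphere_zero_iff_norm.2 (hnorm ω.1 x)⟩ : Circle))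
      (Continuous.subtype_mk (hcont'.comp (by fun_prop : Continuous fun x : G => (ω, x))) _)
      (fun x y => by
        refine Circle.ext ?_
        change ω.1 (p (x + y)) = ω.1 (p x) * ω.1 (p y)
        rw [hadd, map_mul])
    exact ⟨y, fun x => by rw [hy]⟩
  choose θ hθ using hex
  have hθc : Continuous θ := by
    refine hb.continuous_of_continuous_pairing (continuous_induced_rng.2 ?_)
    refine hcont'.congr fun q => (hθ q.1 q.2).symm
  have hopen : IsOpen Ω₀ := by
    have : Ω₀ = ⋃ a ∈ s, {ω | ω a ≠ 0} := by ext; simp [Ω₀]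
    rw [this]
    exact isOpen_biUnion fun a _ => isOpen_ne_fun
      (gelfandTransform ℂ A a).continuous continuous_const
  have hnull : m Ω₀ᶜ = 0 := by
    -- Off `Ω₀` the function |1 - ω(a)|² is identically 1, while its full integral is ‖v - ρ(a)v‖².
    have h1 : ∀ ε > 0, m.real Ω₀ᶜ ≤ ε ^ 2 := by
      intro ε hε
      obtain ⟨a, ha, hav⟩ := hv ε hε
      have h2 : ∀ ω : characterSpace ℂ A, ω (star (1 - a) * (1 - a)) = ((‖1 - ω a‖ ^ 2 : ℝ) : ℂ) := by
        intro ω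
        have := map_star ω (1 - a)
        rw [map_mul, this, map_sub, map_one, Complex.star_def, Complex.conj_mul']
        push_cast; rfl
      have h3 : ∫ ω, ‖1 - ω a‖ ^ 2 ∂m = ‖v - ρ a v‖ ^ 2 := by
        have h4 := hint (star (1 - a) * (1 - a))
        simp_rw [h2] at h4
        rw [integral_complex_ofReal, map_mul, map_star, mul_apply_eq_comp,
          ContinuousLinearMap.star_eq_adjoint, ContinuousLinearMap.adjoint_inner_right,
          inner_self_eq_norm_sq_to_K, map_sub, map_one, sub_apply,
          one_apply_eq_self] at h4
        exact Complex.ofReal_injective (h4.trans (by push_cast; rfl))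
      have hc : Continuous fun ω : characterSpace ℂ A => ‖1 - ω a‖ ^ 2 :=
        ((continuous_const.sub (gelfandTransform ℂ A a).continuous).norm).pow 2
      have h5 : Integrable (fun ω : characterSpace ℂ A => ‖1 - ω a‖ ^ 2) m :=
        (BoundedContinuousFunction.mkOfCompact ⟨_, hc⟩).integrable _
      calc m.real Ω₀ᶜ = ∫ ω in Ω₀ᶜ, ‖1 - ω a‖ ^ 2 ∂m := by
            rw [setIntegral_congr_fun (g := fun _ => (1 : ℝ)) hopen.measurableSet.compl]
            · simp
            · intro ω hω
              have : ω a = 0 := by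
                by_contra hne
                exact hω ⟨a, ha, hne⟩
              simp [this]
        _ ≤ ∫ ω, ‖1 - ω a‖ ^ 2 ∂m :=
            setIntegral_le_integral h5 (ae_of_all _ fun ω => sq_nonneg _)
        _ ≤ ε ^ 2 := by rw [h3]; gcongr
    have h2 : m.real Ω₀ᶜ ≤ 0 := by
      refine le_of_forall_pos_le_add fun δ hδ => ?_
      have := h1 (Real.sqrt δ) (Real.sqrt_pos.2 hδ)
      rwa [Real.sq_sqrt hδ.le, ← zero_add δ] at this
    exact (measureReal_eq_zero_iff).1 (le_antisymm h2 measureReal_nonneg)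
  -- The required measure is the image under θ of the spectral measure, which is carried by `Ω₀`.
  refine ⟨(m.comap ((↑) : Ω₀ → characterSpace ℂ A)).map θ, ?_, fun x => ?_⟩
  · have : IsFiniteMeasure (m.comap ((↑) : Ω₀ → characterSpace ℂ A)) := inferInstance
    infer_instance
  · rw [integral_map hθc.measurable.aemeasurable
      (hb.continuous_coe_left x).aestronglyMeasurable]
    simp_rw [hθ]
    rw [integral_subtype_comap hopen.measurableSet (fun ω : characterSpace ℂ A => ω (p x)),
      ← hint, setIntegral_eq_integral_of_ae_compl_eq_zero]
    have h1 : ∀ᵐ ω ∂m, ω ∈ Ω₀ := by rwa [ae_iff]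
    filter_upwards [h1] with ω hω hn
    exact absurd hω hn

end SpectralMeasure

/-! ### Unitary representations and Bochner's theorem -/

/-- A strongly continuous unitary representation of an abelian group by bounded operators. -/
structure IsUnitaryRepresentation {G : Type u} [AddCommGroup G] [TopologicalSpace G] {K : Type*}
    [NormedAddCommGroup K] [InnerProductSpace ℂ K] [CompleteSpace K] (π : G → K →L[ℂ] K) :
    Prop where
  add : ∀ x y, π (x + y) = π x * π y
  zero : π 0 = 1
  star : ∀ x, star (π x) = π (-x)
  continuous : ∀ v, Continuous fun x => π x v

variable {G : Type u} [AddCommGroup G] [TopologicalSpace G] [IsTopologicalAddGroup G]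
  [LocallyCompactSpace G] [SecondCountableTopology G] [MeasurableSpace G] [BorelSpace G]
  {b : G → G → Circle} {K : Type*} [NormedAddCommGroup K] [InnerProductSpace ℂ K] [CompleteSpace K]

/-- Integrated form of a bounded strongly measurable family of operators. -/
theorem exists_integratedForm {X : Type*} [MeasurableSpace X] {μ : Measure X} {K' : Type*}
    [NormedAddCommGroup K'] [InnerProductSpace ℂ K'] [CompleteSpace K'] {π : X → K →L[ℂ] K'}
    (hmeas : ∀ v, AEStronglyMeasurable (fun x => π x v) μ) (hbd : ∀ x v, ‖π x v‖ ≤ ‖v‖)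
    {f : X → ℂ} (hf : Integrable f μ) :
    (∀ v, Integrable (fun x => f x • π x v) μ) ∧
      ∃ A : K →L[ℂ] K', ∀ v, A v = ∫ x, f x • π x v ∂μ := by
  have h1 : ∀ v, Integrable (fun x => f x • π x v) μ := fun v =>
    hf.smul_bdd ‖v‖ (hmeas v) (ae_of_all _ fun x => hbd x v)
  refine ⟨h1, LinearMap.mkContinuous
    { toFun := fun v => ∫ x, f x • π x v ∂μ
      map_add' := fun v w => by
        simp only [map_add, smul_add]
        exact integral_add (h1 v) (h1 w)
      map_smul' := fun c v => by
        simp only [map_smul, RingHom.id_apply, smul_comm _ c]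
        exact integral_smul _ _ } (∫ x, ‖f x‖ ∂μ) fun v => ?_, fun v => rfl⟩
  refine (norm_integral_le_integral_norm _).trans ?_
  rw [← integral_mul_const]
  refine integral_mono (h1 v).norm (hf.norm.mul_const _) fun x => ?_
  simp only [norm_smul]
  exact mul_le_mul_of_nonneg_left (hbd x v) (norm_nonneg _)

/-- Continuity in mean of a jointly continuous family of functions supported in a common compact
set. -/
theorem tendsto_integral_norm_sub {X Y : Type*} [TopologicalSpace X] [TopologicalSpace Y]
    [MeasurableSpace Y] [OpensMeasurableSpace Y] {μ : Measure Y} [IsFiniteMeasureOnCompacts μ]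
    {F : X → Y → ℂ} {p₀ : X} {s : Set X} (hs : s ∈ 𝓝 p₀) {k : Set Y} (hk : IsCompact k)
    (hF : Continuous F.uncurry) (hsupp : ∀ p ∈ s, ∀ y ∉ k, F p y = 0) :
    Tendsto (fun p => ∫ y, ‖F p y - F p₀ y‖ ∂μ) (𝓝 p₀) (𝓝 0) := by
  have h1 : ContinuousOn (fun p => ∫ y, ‖F p y - F p₀ y‖ ∂μ) s := by
    refine continuousOn_integral_of_compact_support hk ?_ ?_
    · refine Continuous.continuousOn ?_
      have : Continuous fun q : X × Y => F p₀ q.2 :=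
        hF.comp (continuous_const.prodMk continuous_snd)
      exact (hF.sub this).norm
    · intro p y hp hy
      rw [hsupp p hp y hy, hsupp p₀ (mem_of_mem_nhds hs) y hy, sub_zero, norm_zero]
  have h2 := h1.continuousAt hs
  rw [ContinuousAt] at h2
  simpa using h2

theorem tendsto_integral_norm_translate_sub [T2Space G] (μ : Measure G)
    [IsFiniteMeasureOnCompacts μ] {f : G → ℂ} (hf : Continuous f) (hc : HasCompactSupport f) :
    Tendsto (fun x => ∫ t, ‖f (t - x) - f t‖ ∂μ) (𝓝 0) (𝓝 0) := by
  obtain ⟨V, hV, hV0⟩ := exists_compact_mem_nhds (0 : G)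
  have h := tendsto_integral_norm_sub (μ := μ) (F := fun x t => f (t - x)) hV0
    (hc.isCompact.add hV) (by exact hf.comp (continuous_snd.sub continuous_fst)) ?_
  · simpa using h
  · intro x hx t ht
    by_contra hne
    exact ht ⟨t - x, subset_tsupport _ hne, x, hx, sub_add_cancel _ _⟩

namespace IsUnitaryRepresentation

theorem norm_apply {π : G → K →L[ℂ] K} (hπ : IsUnitaryRepresentation π) (x : G) (v : K) :
    ‖π x v‖ = ‖v‖ := by
  have h : ⟪π x v, π x v⟫_ℂ = ⟪v, v⟫_ℂ := by
    rw [← ContinuousLinearMap.adjoint_inner_right, ← ContinuousLinearMap.star_eq_adjoint, hπ.star,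
      ← mul_apply_eq_comp, ← hπ.add, neg_add_cancel, hπ.zero, one_apply_eq_self]
  rw [inner_self_eq_norm_sq_to_K, inner_self_eq_norm_sq_to_K] at h
  exact (pow_left_inj₀ (norm_nonneg _) (norm_nonneg _) two_ne_zero).1 (by exact_mod_cast h)

/-- The von Neumann algebra generated by the operators of a representation. -/
def algebra (π : G → K →L[ℂ] K) : StarSubalgebra ℂ (K →L[ℂ] K) :=
  StarSubalgebra.centralizer ℂ (StarSubalgebra.centralizer ℂ (Set.range π) : Set (K →L[ℂ] K))

theorem mem_centralizer_iff {π : G → K →L[ℂ] K} (hπ : IsUnitaryRepresentation π) {T : K →L[ℂ] K} :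
    T ∈ StarSubalgebra.centralizer ℂ (Set.range π) ↔ ∀ x, π x * T = T * π x := by
  rw [StarSubalgebra.mem_centralizer_iff, Set.forall_mem_range]
  exact ⟨fun h x => (h x).1, fun h x => ⟨h x, by rw [hπ.star]; exact h _⟩⟩

theorem mem_algebra_iff {π : G → K →L[ℂ] K} (hπ : IsUnitaryRepresentation π) {T : K →L[ℂ] K} :
    T ∈ algebra π ↔ ∀ g, (∀ x, π x * g = g * π x) → g * T = T * g := by
  rw [algebra, StarSubalgebra.mem_centralizer_iff]
  constructor
  · intro h g hg
    exact (h g (hπ.mem_centralizer_iff.2 hg)).1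
  · intro h g hg
    refine ⟨h g (hπ.mem_centralizer_iff.1 hg), h _ (hπ.mem_centralizer_iff.1 (star_mem hg))⟩

theorem isClosed_algebra (π : G → K →L[ℂ] K) : IsClosed (algebra π : Set (K →L[ℂ] K)) := by
  rw [algebra, StarSubalgebra.coe_centralizer]
  exact Set.isClosed_centralizer _

theorem apply_mem_algebra {π : G → K →L[ℂ] K} (hπ : IsUnitaryRepresentation π) (x : G) :
    π x ∈ algebra π :=
  hπ.mem_algebra_iff.2 fun _ hg => (hg x).symm

/-- The algebra generated by a representation of an abelian group is a commutative C⋆-algebra. -/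
abbrev commCStarAlgebra {π : G → K →L[ℂ] K} (hπ : IsUnitaryRepresentation π) :
    CommCStarAlgebra (algebra π) :=
  have := isClosed_algebra π
  { (inferInstance : CStarAlgebra (algebra π)) with
    mul_comm := fun a c => Subtype.ext <| by
      refine hπ.mem_algebra_iff.1 c.2 a.1 fun x => ?_
      refine hπ.mem_algebra_iff.1 a.2 (π x) fun y => ?_
      rw [← hπ.add, ← hπ.add, add_comm] }

/-- Bochner's theorem: the matrix coefficients of a strongly continuous unitary representation are
Fourier transforms of finite measures. -/
theorem exists_measure {π : G → K →L[ℂ] K} (hπ : IsUnitaryRepresentation π)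
    (hb : IsSelfDualPairing b) (v : K) :
    ∃ μ : Measure G, IsFiniteMeasure μ ∧ ∀ x, ∫ y, (b y x : ℂ) ∂μ = ⟪v, π x v⟫_ℂ := by
  have := hb.t2Space
  let := hπ.commCStarAlgebra
  let : MeasurableSpace (WeakDual.characterSpace ℂ (algebra π)) := borel _
  have : BorelSpace (WeakDual.characterSpace ℂ (algebra π)) := ⟨rfl⟩
  let μ : Measure G := Measure.addHaar
  -- The integrated operators π(f), with f continuous of compact support, serve as the approximate
  -- identity.
  let s : Set (algebra π) := {a | ∃ f : G → ℂ, Continuous f ∧ HasCompactSupport f ∧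
    ∀ v, a.1 v = ∫ x, f x • π x v ∂μ}
  have hmeas : ∀ v, AEStronglyMeasurable (fun x => π x v) μ := fun v =>
    (hπ.continuous v).aestronglyMeasurable
  have hbd : ∀ x v, ‖π x v‖ ≤ ‖v‖ := fun x v => (hπ.norm_apply x v).le
  have hmem : ∀ {f : G → ℂ}, Continuous f → HasCompactSupport f →
      ∃ a ∈ s, ∀ v, a.1 v = ∫ x, f x • π x v ∂μ := by
    intro f hf hc
    obtain ⟨h1, a, ha⟩ := exists_integratedForm hmeas hbd (hf.integrable_of_hasCompactSupport hc)
    have : a ∈ algebra π := by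
      refine hπ.mem_algebra_iff.2 fun g hg => ?_
      ext w
      rw [mul_apply_eq_comp, mul_apply_eq_comp, ha, ha, ← ContinuousLinearMap.integral_comp_comm g (h1 w)]
      refine integral_congr_ae (ae_of_all _ fun x => ?_)
      simp only [map_smul]
      rw [← mul_apply_eq_comp, ← hg, mul_apply_eq_comp]
    exact ⟨⟨a, this⟩, ⟨f, hf, hc, ha⟩, ha⟩
  refine hb.exists_measure_of_commCStarAlgebra (algebra π).subtype
    (fun x => ⟨π x, hπ.apply_mem_algebra x⟩) (fun x y => Subtype.ext (hπ.add x y))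
    (Subtype.ext hπ.zero) (fun x => Subtype.ext (hπ.star x)) s ?_ v ?_
  · rintro a ⟨f, hf, hc, ha⟩
    have hf1 := hf.integrable_of_hasCompactSupport hc (μ := μ)
    have hint := (exists_integratedForm hmeas hbd hf1).1
    -- Here π(x)π(f) - π(f) is π applied to the difference of a translate of f and f, so
    -- L¹-continuity of translation gives norm continuity.
    have key : ∀ x, ‖π x * a.1 - a.1‖ ≤ ∫ t, ‖f (t - x) - f t‖ ∂μ := by
      intro x
      refine ContinuousLinearMap.opNorm_le_bound _ (integral_nonneg fun _ => norm_nonneg _)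
        fun w => ?_
      have hfx : Integrable (fun t => f (t - x)) μ := hf1.comp_sub_right x
      have h1 : (π x * a.1 - a.1) w = ∫ t, (f (t - x) - f t) • π t w ∂μ := by
        have h2 := (exists_integratedForm hmeas hbd hfx).1 w
        simp only [sub_smul]
        rw [integral_sub h2 (hint w), sub_apply, mul_apply_eq_comp, ha,
          ← ContinuousLinearMap.integral_comp_comm (π x) (hint w)]
        congr 1
        rw [← integral_sub_right_eq_self (fun t => π x (f t • π t w)) x]
        refine integral_congr_ae (ae_of_all _ fun t => ?_)
        simp only [map_smul]
        rw [← mul_apply_eq_comp, ← hπ.add, add_sub_cancel]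
      rw [h1, ← integral_mul_const]
      refine (norm_integral_le_integral_norm _).trans
        (integral_mono (((exists_integratedForm hmeas hbd (hfx.sub hf1)).1 w).norm)
          ((hfx.sub hf1).norm.mul_const _) fun t => ?_)
      simp only [norm_smul, hπ.norm_apply, le_refl]
    have h0 := tendsto_integral_norm_translate_sub μ hf hc
    refine continuous_iff_continuousAt.2 fun x₀ => ?_
    rw [ContinuousAt, tendsto_iff_norm_sub_tendsto_zero]
    have h3 : Tendsto (fun x => x - x₀) (𝓝 x₀) (𝓝 0) := by
      have : Continuous fun x => x - x₀ := by fun_prop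
      simpa using this.tendsto x₀
    refine squeeze_zero (fun _ => norm_nonneg _) (fun x => ?_) (h0.comp h3)
    refine le_trans ?_ (key (x - x₀))
    change ‖π x * a.1 - π x₀ * a.1‖ ≤ _
    have h4 : π x * a.1 - π x₀ * a.1 = π x₀ * (π (x - x₀) * a.1 - a.1) := by
      rw [mul_sub, ← mul_assoc, ← hπ.add, add_sub_cancel]
    rw [h4]
    refine ContinuousLinearMap.opNorm_le_bound _ (norm_nonneg _) fun w => ?_
    rw [mul_apply_eq_comp, hπ.norm_apply]
    exact ContinuousLinearMap.le_opNorm _ _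
  · intro ε hε
    -- A bump function supported where π(x) moves v by less than ε, normalised to integral 1, gives
    -- π(f)v within ε of v.
    have hU : IsOpen {x : G | ‖π x v - v‖ < ε} :=
      isOpen_lt ((hπ.continuous v).sub continuous_const).norm continuous_const
    obtain ⟨f, hf1, hfc, hfs, hf01⟩ := exists_continuousMap_one_of_isCompact_subset_isOpen
      (isCompact_singleton (x := (0 : G))) hU (by simpa [hπ.zero] using hε)
    have hpos : 0 < ∫ x, f x ∂μ :=
      f.continuous.integral_pos_of_hasCompactSupport_nonneg_nonzero hfc (fun x => (hf01 x).1)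
        (x := 0) (by simp [hf1 (Set.mem_singleton 0)])
    set c := ∫ x, f x ∂μ with hc
    have hgc : Continuous fun x => ((c⁻¹ * f x : ℝ) : ℂ) := by fun_prop
    have hgs : HasCompactSupport fun x => ((c⁻¹ * f x : ℝ) : ℂ) :=
      HasCompactSupport.comp_left (g := fun t : ℝ => ((c⁻¹ * t : ℝ) : ℂ)) hfc (by simp)
    obtain ⟨a, ha, hav⟩ := hmem hgc hgs
    refine ⟨a, ha, ?_⟩
    have hgi := hgc.integrable_of_hasCompactSupport hgs (μ := μ)
    have hfi : Integrable f μ := f.continuous.integrable_of_hasCompactSupport hfc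
    have h1 : v = ∫ x, ((c⁻¹ * f x : ℝ) : ℂ) • v ∂μ := by
      rw [integral_smul_const, integral_complex_ofReal, integral_const_mul, ← hc,
        inv_mul_cancel₀ hpos.ne', Complex.ofReal_one, one_smul]
    change ‖v - a.1 v‖ ≤ ε
    rw [hav]
    nth_rewrite 1 [h1]
    rw [← integral_sub (hgi.smul_const v) ((exists_integratedForm hmeas hbd hgi).1 v)]
    calc _ ≤ ∫ x, c⁻¹ * f x * ε ∂μ := by
          refine norm_integral_le_of_norm_le ((hfi.const_mul _).mul_const _) (ae_of_all _ fun x => ?_)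
          rw [← smul_sub, norm_smul, Complex.norm_real, Real.norm_of_nonneg
            (mul_nonneg (inv_nonneg.2 hpos.le) (hf01 x).1)]
          by_cases hx : f x = 0
          · simp [hx]
          · have := hfs (subset_tsupport _ hx)
            rw [norm_sub_rev]
            exact mul_le_mul_of_nonneg_left (le_of_lt this)
              (mul_nonneg (inv_nonneg.2 hpos.le) (hf01 x).1)
      _ = ε := by
          rw [integral_mul_const, integral_const_mul, ← hc, inv_mul_cancel₀ hpos.ne', one_mul]

end IsUnitaryRepresentation

/-! ### The Fourier transform and spectral measures -/

variable {G : Type u} [AddCommGroup G] [TopologicalSpace G] [IsTopologicalAddGroup G]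
  [LocallyCompactSpace G] [SecondCountableTopology G] [MeasurableSpace G] [BorelSpace G]
  {b : G → G → Circle} {K : Type*} [NormedAddCommGroup K] [InnerProductSpace ℂ K] [CompleteSpace K]

/-- The Fourier transform with respect to the pairing `b`. -/
def pairingFourier (b : G → G → Circle) (μ : Measure G) (w : G → ℂ) (y : G) : ℂ :=
  ∫ x, w x * (b y x : ℂ) ∂μ

namespace IsSelfDualPairing

variable {μ : Measure G}

theorem norm_pairingFourier_le (w : G → ℂ) (y : G) :
    ‖pairingFourier b μ w y‖ ≤ ∫ x, ‖w x‖ ∂μ := by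
  refine (norm_integral_le_integral_norm _).trans_eq (integral_congr_ae (ae_of_all _ fun x => ?_))
  change ‖w x * (b y x : ℂ)‖ = _
  rw [norm_mul, Circle.norm_coe, mul_one]

theorem measurable_pairingFourier [SFinite μ] (hb : IsSelfDualPairing b) {w : G → ℂ}
    (hw : Measurable w) : Measurable (pairingFourier b μ w) := by
  have h : StronglyMeasurable (Function.uncurry fun y x => w x * (b y x : ℂ)) :=
    ((hw.comp measurable_snd).mul hb.measurable_uncurry).stronglyMeasurable
  exact h.integral_prod_right.measurable

theorem integrable_mul_right (hb : IsSelfDualPairing b) {w : G → ℂ}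
    (hw : Integrable w μ) (y : G) : Integrable (fun x => w x * (b y x : ℂ)) μ := by
  refine hw.mul_bdd (c := 1) ?_ (ae_of_all _ fun x => (Circle.norm_coe _).le)
  exact (hb.continuous_coe_right y).aestronglyMeasurable

theorem integral_mul_integral_pairing [SFinite μ] (hb : IsSelfDualPairing b) {ν : Measure G}
    [IsFiniteMeasure ν] {w h : G → ℂ} (hwi : Integrable w μ)
    (hh : Measurable h) {C : ℝ} (hC : ∀ y, ‖h y‖ ≤ C) :
    ∫ x, w x * ∫ y, (b y x : ℂ) * h y ∂ν ∂μ = ∫ y, pairingFourier b μ w y * h y ∂ν := by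
  have hint : Integrable (Function.uncurry fun x y => w x * ((b y x : ℂ) * h y)) (μ.prod ν) := by
    have h1 : Integrable (fun p : G × G => w p.1 * h p.2) (μ.prod ν) :=
      hwi.mul_prod (Integrable.of_bound hh.aestronglyMeasurable C (ae_of_all _ hC))
    have h2 : Integrable (fun p : G × G => (w p.1 * h p.2) * (b p.2 p.1 : ℂ)) (μ.prod ν) :=
      h1.mul_bdd (c := 1) (hb.measurable_uncurry.comp measurable_swap).aestronglyMeasurable
        (ae_of_all _ fun x => (Circle.norm_coe _).le)
    refine h2.congr (ae_of_all _ fun p => ?_)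
    simp only [Function.uncurry]
    ring
  simp_rw [← integral_const_mul]
  rw [integral_integral_swap hint]
  refine integral_congr_ae (ae_of_all _ fun y => ?_)
  simp only [pairingFourier]
  rw [← integral_mul_const]
  refine integral_congr_ae (ae_of_all _ fun x => ?_)
  ring

end IsSelfDualPairing

/-- Applying an integrated operator to a vector multiplies its spectral measure by the squared
modulus of the Fourier transform. -/
theorem IsUnitaryRepresentation.inner_integral_smul {μ : Measure G} [SFinite μ]
    {π : G → K →L[ℂ] K} (hπ : IsUnitaryRepresentation π) (hb : IsSelfDualPairing b) {v : K}
    {ν : Measure G} [IsFiniteMeasure ν] (hν : ∀ x, ∫ y, (b y x : ℂ) ∂ν = ⟪v, π x v⟫_ℂ)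
    {w : G → ℂ} (hw : Measurable w) (hwi : Integrable w μ)
    (hint : Integrable (fun x => w x • π x v) μ) (x : G) :
    ⟪∫ s, w s • π s v ∂μ, π x (∫ s, w s • π s v ∂μ)⟫_ℂ =
      ∫ y, ((‖pairingFourier b μ w y‖ ^ 2 : ℝ) : ℂ) * (b y x : ℂ) ∂ν := by
  set u := ∫ s, w s • π s v ∂μ with hu
  have hm := hb.measurable_pairingFourier (μ := μ) hw
  have hbd := fun y => IsSelfDualPairing.norm_pairingFourier_le (b := b) (μ := μ) w y
  -- Fubini is used once for each occurrence of `u`: here for the one in the second slot, in `h2`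
  -- for the one in the first. Each contributes a factor of the Fourier transform of `w`, one of
  -- them conjugated.
  have h1 : ∀ s, ⟪π s v, π x u⟫_ℂ = ∫ y, pairingFourier b μ w y * (b y (x - s) : ℂ) ∂ν := by
    intro s
    rw [← hb.integral_mul_integral_pairing hwi (h := fun y => (b y (x - s) : ℂ))
      (hb.continuous_coe_left _).measurable (C := 1) (fun y => (Circle.norm_coe _).le), hu,
      ← ContinuousLinearMap.integral_comp_comm (π x) hint, ← integral_inner
        ((π x).integrable_comp hint)]
    refine integral_congr_ae (ae_of_all _ fun t => ?_)
    simp only [map_smul, inner_smul_right]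
    congr 1
    rw [← ContinuousLinearMap.adjoint_inner_right, ← ContinuousLinearMap.star_eq_adjoint, hπ.star,
      ← mul_apply_eq_comp, ← mul_apply_eq_comp, ← hπ.add, ← hπ.add, ← hν]
    refine integral_congr_ae (ae_of_all _ fun y => ?_)
    change ((b y (-s + x + t) : Circle) : ℂ) = (b y t : ℂ) * (b y (x - s) : ℂ)
    rw [← Circle.coe_mul, ← hb.add_right]
    congr 2
    abel
  have h2 : conj ⟪u, π x u⟫_ℂ =
      ∫ y, pairingFourier b μ w y * conj (pairingFourier b μ w y * (b y x : ℂ)) ∂ν := by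
    rw [← hb.integral_mul_integral_pairing hwi
      (h := fun y => conj (pairingFourier b μ w y * (b y x : ℂ)))
      (Complex.continuous_conj.measurable.comp
        (hm.mul (hb.continuous_coe_left _).measurable)) (C := ∫ x, ‖w x‖ ∂μ)
      (fun y => by
        rw [RCLike.norm_conj, norm_mul, Circle.norm_coe, mul_one]; exact hbd y), inner_conj_symm]
    nth_rewrite 2 [hu]
    rw [← integral_inner hint]
    refine integral_congr_ae (ae_of_all _ fun s => ?_)
    simp only [inner_smul_right]
    congr 1
    rw [← inner_conj_symm, h1, ← integral_conj]
    refine integral_congr_ae (ae_of_all _ fun y => ?_)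
    simp only [map_mul]
    rw [hb.sub_right, Circle.coe_mul, Circle.coe_inv_eq_conj, map_mul, Complex.conj_conj]
    ring
  rw [← Complex.conj_conj ⟪u, π x u⟫_ℂ, h2, ← integral_conj]
  refine integral_congr_ae (ae_of_all _ fun y => ?_)
  simp only [map_mul, Complex.conj_conj]
  rw [← mul_assoc, Complex.conj_mul']
  push_cast
  rfl

/-! ### The translation representation on L² -/

section RegularRepresentation

variable (μ : Measure G) [μ.IsAddHaarMeasure]

/-- The translation representation on `L²`. -/
def translationRep (x : G) : Lp ℂ 2 μ →L[ℂ] Lp ℂ 2 μ :=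
  (Lp.compMeasurePreservingₗᵢ ℂ (fun t => t - x)
    (measurePreserving_sub_right μ x)).toContinuousLinearMap

theorem translationRep_coeFn (x : G) (v : Lp ℂ 2 μ) :
    translationRep μ x v =ᵐ[μ] fun t => v (t - x) :=
  Lp.coeFn_compMeasurePreserving v (measurePreserving_sub_right μ x)

theorem translationRep_add (x y : G) :
    translationRep μ (x + y) = translationRep μ x * translationRep μ y := by
  ext1 v
  refine Lp.ext ?_
  rw [mul_apply_eq_comp]
  filter_upwards [translationRep_coeFn μ (x + y) v, translationRep_coeFn μ x (translationRep μ y v),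
    (measurePreserving_sub_right μ x).quasiMeasurePreserving.ae_eq_comp
      (translationRep_coeFn μ y v)] with t h1 h2 h3
  simp only [Function.comp_apply] at h3
  rw [h1, h2, h3, sub_sub]

theorem translationRep_zero : translationRep μ (0 : G) = 1 := by
  ext1 v
  refine Lp.ext ?_
  filter_upwards [translationRep_coeFn μ 0 v] with t h1
  rw [h1, one_apply_eq_self, sub_zero]

theorem translationRep_inner (x : G) (v w : Lp ℂ 2 μ) :
    ⟪translationRep μ x v, translationRep μ x w⟫_ℂ = ⟪v, w⟫_ℂ :=
  LinearIsometry.inner_map_map _ v w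

theorem isUnitaryRepresentation_translationRep [T2Space G] :
    IsUnitaryRepresentation (translationRep μ) where
  add := translationRep_add μ
  zero := translationRep_zero μ
  star x := by
    rw [ContinuousLinearMap.star_eq_adjoint]
    symm
    rw [ContinuousLinearMap.eq_adjoint_iff]
    intro v w
    rw [← translationRep_inner μ x, ← mul_apply_eq_comp, ← translationRep_add, add_neg_cancel,
      translationRep_zero, one_apply_eq_self]
  continuous v := by
    let g : C(G, C(G, G)) := ContinuousMap.curry ⟨fun p : G × G => p.2 - p.1, by fun_prop⟩
    exact (continuous_const (y := v)).compMeasurePreservingLp g.continuous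
      (fun x => measurePreserving_sub_right μ x) (by norm_num)

end RegularRepresentation

variable {G : Type u} [AddCommGroup G] [TopologicalSpace G] [IsTopologicalAddGroup G]
  [LocallyCompactSpace G] [SecondCountableTopology G] [MeasurableSpace G] [BorelSpace G]
  {b : G → G → Circle} {μ : Measure G} [μ.IsAddHaarMeasure]

/-! ### Convolution -/

section Convolution

variable [T2Space G]

theorem integrable_smul_translationRep {w : G → ℂ} (hw : Integrable w μ) (v : Lp ℂ 2 μ) :
    Integrable (fun x => w x • translationRep μ x v) μ := by
  have hπ := isUnitaryRepresentation_translationRep μ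
  refine hw.smul_bdd ‖v‖ ?_ (ae_of_all _ fun x => (hπ.norm_apply x v).le)
  have : SecondCountableTopologyEither G (Lp ℂ 2 μ) := inferInstance
  exact (hπ.continuous v).aestronglyMeasurable

/-- The inner product of a vector with a convolution, as an iterated integral. -/
theorem inner_integral_smul_translationRep (u : Lp ℂ 2 μ) {v w : G → ℂ} (hv : Measurable v)
    (hv2 : MemLp v 2 μ) (hw : Measurable w) (hwi : Integrable w μ) :
    ⟪u, ∫ x, w x • translationRep μ x (hv2.toLp v) ∂μ⟫_ℂ =
      ∫ t, conj (u t) * ∫ x, w x * v (t - x) ∂μ ∂μ := by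
  have hcoe : ∀ x, translationRep μ x (hv2.toLp v) =ᵐ[μ] fun t => v (t - x) := by
    intro x
    filter_upwards [translationRep_coeFn μ x (hv2.toLp v),
      (measurePreserving_sub_right μ x).quasiMeasurePreserving.ae_eq_comp hv2.coeFn_toLp]
      with t h1 h2
    rw [h1]; exact h2
  have hu : Measurable u := (Lp.stronglyMeasurable u).measurable
  have hu2 : MemLp u 2 μ := Lp.memLp u
  have hv2' : ∀ x, MemLp (fun t => v (t - x)) 2 μ := fun x =>
    hv2.comp_measurePreserving (measurePreserving_sub_right μ x)
  -- By Cauchy–Schwarz and translation invariance the bound is uniform in x; with `w` integrable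
  -- this justifies Fubini.
  have hbound : ∀ x, ∫ t, ‖conj (u t) * v (t - x)‖ ∂μ ≤
      (∫ t, ‖u t‖ ^ (2 : ℝ) ∂μ) ^ (1 / 2 : ℝ) * (∫ t, ‖v t‖ ^ (2 : ℝ) ∂μ) ^ (1 / 2 : ℝ) := by
    intro x
    have h := integral_mul_norm_le_Lp_mul_Lq (f := u) (g := fun t => v (t - x)) (μ := μ)
      Real.HolderConjugate.two_two (by simpa using hu2) (by simpa using hv2' x)
    rw [integral_sub_right_eq_self (fun t => ‖v t‖ ^ (2 : ℝ)) x] at h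
    refine le_trans (le_of_eq ?_) h
    simp
  have hint : Integrable (Function.uncurry fun x t => conj (u t) * (w x * v (t - x)))
      (μ.prod μ) := by
    have hm : Measurable (Function.uncurry fun x t => conj (u t) * (w x * v (t - x))) :=
      (Complex.continuous_conj.measurable.comp (hu.comp measurable_snd)).mul
        ((hw.comp measurable_fst).mul (hv.comp (measurable_snd.sub measurable_fst)))
    have hx : ∀ x, Integrable (fun t => conj (u t) * v (t - x)) μ := fun x =>
      (hu2.star).integrable_mul (hv2' x)
    refine (integrable_prod_iff hm.aestronglyMeasurable).2 ⟨ae_of_all _ fun x => ?_, ?_⟩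
    · refine ((hx x).const_mul (w x)).congr (ae_of_all _ fun t => ?_)
      simp only [Function.uncurry]
      ring
    · refine Integrable.mono' (hwi.norm.mul_const ((∫ t, ‖u t‖ ^ (2 : ℝ) ∂μ) ^ (1 / 2 : ℝ) *
        (∫ t, ‖v t‖ ^ (2 : ℝ) ∂μ) ^ (1 / 2 : ℝ)))
        hm.stronglyMeasurable.norm.integral_prod_right.aestronglyMeasurable
        (ae_of_all _ fun x => ?_)
      rw [Real.norm_of_nonneg (integral_nonneg fun _ => norm_nonneg _)]
      refine le_trans (le_of_eq ?_) (mul_le_mul_of_nonneg_left (hbound x) (norm_nonneg (w x)))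
      rw [← integral_const_mul]
      refine integral_congr_ae (ae_of_all _ fun t => ?_)
      simp only [Function.uncurry, norm_mul]
      ring
  rw [← integral_inner (integrable_smul_translationRep hwi _)]
  simp_rw [← integral_const_mul]
  rw [← integral_integral_swap hint]
  refine integral_congr_ae (ae_of_all _ fun x => ?_)
  simp only [inner_smul_right]
  rw [L2.inner_def, ← integral_const_mul]
  refine integral_congr_ae ?_
  filter_upwards [hcoe x] with t ht
  rw [ht, RCLike.inner_apply']
  simp only [starRingEnd_apply]
  ring

/-- Commutativity of convolution: after pairing with an arbitrary vector, substitute t - x for x in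
the inner integral. -/
theorem integral_smul_translationRep_comm {v w : G → ℂ} (hv : Measurable v)
    (hv2 : MemLp v 2 μ) (hvi : Integrable v μ) (hw : Measurable w) (hw2 : MemLp w 2 μ)
    (hwi : Integrable w μ) :
    ∫ x, w x • translationRep μ x (hv2.toLp v) ∂μ =
      ∫ x, v x • translationRep μ x (hw2.toLp w) ∂μ := by
  refine ext_inner_left ℂ fun u => ?_
  rw [inner_integral_smul_translationRep u hv hv2 hw hwi,
    inner_integral_smul_translationRep u hw hw2 hv hvi]
  congr 1 with t
  congr 1
  rw [← integral_sub_left_eq_self _ μ t]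
  refine integral_congr_ae (ae_of_all _ fun x => ?_)
  simp only [sub_sub_cancel]
  ring

end Convolution

/-! ### Bessel's inequality for the Fourier transform -/

theorem IsSelfDualPairing.measurable_withDensity_pairingFourier (hb : IsSelfDualPairing b)
    {w : G → ℂ} (hw : Measurable w) :
    Measurable fun y => ENNReal.ofReal (‖pairingFourier b μ w y‖ ^ 2) :=
  ((hb.measurable_pairingFourier hw).norm.pow_const 2).ennreal_ofReal

theorem IsSelfDualPairing.isFiniteMeasure_withDensity_pairingFourier (ν : Measure G)
    [IsFiniteMeasure ν] (w : G → ℂ) :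
    IsFiniteMeasure (ν.withDensity fun y => ENNReal.ofReal (‖pairingFourier b μ w y‖ ^ 2)) := by
  refine isFiniteMeasure_withDensity (ne_of_lt ?_)
  refine (lintegral_mono (g := fun _ => ENNReal.ofReal ((∫ x, ‖w x‖ ∂μ) ^ 2)) fun y => ?_).trans_lt
    ?_
  · exact ENNReal.ofReal_le_ofReal
      (pow_le_pow_left₀ (norm_nonneg _) (IsSelfDualPairing.norm_pairingFourier_le w y) 2)
  · rw [lintegral_const]
    exact ENNReal.mul_lt_top ENNReal.ofReal_lt_top (measure_lt_top _ _)

/-- Both sides are the spectral measure of the same vector v*w = w*v, so their Fourier transforms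
agree. -/
theorem IsSelfDualPairing.withDensity_pairingFourier_comm [T2Space G] (hb : IsSelfDualPairing b)
    {v w : G → ℂ} (hv : Measurable v) (hv2 : MemLp v 2 μ) (hvi : Integrable v μ)
    (hw : Measurable w) (hw2 : MemLp w 2 μ) (hwi : Integrable w μ) {νv νw : Measure G}
    [IsFiniteMeasure νv] [IsFiniteMeasure νw]
    (hνv : ∀ x, ∫ y, (b y x : ℂ) ∂νv = ⟪hv2.toLp v, translationRep μ x (hv2.toLp v)⟫_ℂ)
    (hνw : ∀ x, ∫ y, (b y x : ℂ) ∂νw = ⟪hw2.toLp w, translationRep μ x (hw2.toLp w)⟫_ℂ) :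
    (νv.withDensity fun y => ENNReal.ofReal (‖pairingFourier b μ w y‖ ^ 2)) =
      νw.withDensity fun y => ENNReal.ofReal (‖pairingFourier b μ v y‖ ^ 2) := by
  have := isFiniteMeasure_withDensity_pairingFourier (b := b) (μ := μ) νv w
  have := isFiniteMeasure_withDensity_pairingFourier (b := b) (μ := μ) νw v
  have hπ := isUnitaryRepresentation_translationRep μ
  have key : ∀ {f : G → ℂ} (_ : Measurable f) (ν : Measure G) (x : G),
      ∫ y, (b y x : ℂ) ∂(ν.withDensity fun y => ENNReal.ofReal (‖pairingFourier b μ f y‖ ^ 2)) =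
        ∫ y, ((‖pairingFourier b μ f y‖ ^ 2 : ℝ) : ℂ) * (b y x : ℂ) ∂ν := by
    intro f hf ν x
    rw [integral_withDensity_eq_integral_toReal_smul (hb.measurable_withDensity_pairingFourier hf)
      (ae_of_all _ fun _ => ENNReal.ofReal_lt_top)]
    refine integral_congr_ae (ae_of_all _ fun y => ?_)
    simp only [ENNReal.toReal_ofReal (sq_nonneg _), Complex.real_smul]
  refine hb.measure_ext fun x => ?_
  rw [key hw, key hv, ← hπ.inner_integral_smul hb hνv hw hwi (integrable_smul_translationRep hwi _),
    ← hπ.inner_integral_smul hb hνw hv hvi (integrable_smul_translationRep hvi _)]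
  exact congrArg (fun u => ⟪u, translationRep μ x u⟫_ℂ)
    (integral_smul_translationRep_comm hv hv2 hvi hw hw2 hwi)


/-- Modulation by a character translates spectral measures. -/
theorem IsSelfDualPairing.inner_translationRep_modulate [T2Space G] (hb : IsSelfDualPairing b)
    {w : G → ℂ} (hw2 : MemLp w 2 μ) (a : G) (hwa : MemLp (fun t => w t * (b a t : ℂ)) 2 μ) (x : G) :
    ⟪hwa.toLp _, translationRep μ x (hwa.toLp _)⟫_ℂ =
      (b (-a) x : ℂ) * ⟪hw2.toLp w, translationRep μ x (hw2.toLp w)⟫_ℂ := by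
  have hcoe : ∀ {v : G → ℂ} (hv2 : MemLp v 2 μ),
      translationRep μ x (hv2.toLp v) =ᵐ[μ] fun t => v (t - x) := by
    intro v hv2
    filter_upwards [translationRep_coeFn μ x (hv2.toLp v),
      (measurePreserving_sub_right μ x).quasiMeasurePreserving.ae_eq_comp hv2.coeFn_toLp]
      with t h1 h2
    rw [h1]; exact h2
  rw [L2.inner_def, L2.inner_def, ← integral_const_mul]
  refine integral_congr_ae ?_
  filter_upwards [hcoe hw2, hcoe hwa, hw2.coeFn_toLp, hwa.coeFn_toLp] with t h1 h2 h3 h4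
  rw [h1, h2, h3, h4, RCLike.inner_apply', RCLike.inner_apply', hb.sub_right, hb.neg_left,
    Circle.coe_mul, map_mul]
  have : conj (b a t : ℂ) * (b a t : ℂ) = 1 := by
    rw [Complex.conj_mul', Circle.norm_coe]; norm_num
  linear_combination (conj (w t) * w (t - x) * ((b a x)⁻¹ : Circle)) * this

/-- This evaluates the preceding identity on `E` for `v` and the modulation of `w` by b(a,·).
Modulation translates the Fourier transform by a and the spectral measure by -a. -/
theorem IsSelfDualPairing.lintegral_pairingFourier_translate (hb : IsSelfDualPairing b)
    {v w : G → ℂ} (hv : Measurable v) (hv2 : MemLp v 2 μ) (hvi : Integrable v μ)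
    (hw : Measurable w) (hw2 : MemLp w 2 μ) (hwi : Integrable w μ) {νv νw : Measure G}
    [IsFiniteMeasure νv] [IsFiniteMeasure νw]
    (hνv : ∀ x, ∫ y, (b y x : ℂ) ∂νv = ⟪hv2.toLp v, translationRep μ x (hv2.toLp v)⟫_ℂ)
    (hνw : ∀ x, ∫ y, (b y x : ℂ) ∂νw = ⟪hw2.toLp w, translationRep μ x (hw2.toLp w)⟫_ℂ)
    {E : Set G} (hE : MeasurableSet E) (a : G) :
    ∫⁻ y in E, ENNReal.ofReal (‖pairingFourier b μ w (y + a)‖ ^ 2) ∂νv =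
      ∫⁻ y, E.indicator (fun y => ENNReal.ofReal (‖pairingFourier b μ v y‖ ^ 2)) (y - a) ∂νw := by
  have := hb.t2Space
  have hm : Measurable fun t => w t * (b a t : ℂ) := hw.mul (hb.continuous_coe_right a).measurable
  have hnorm : ∀ t, ‖w t * (b a t : ℂ)‖ = ‖w t‖ := fun t => by
    rw [norm_mul, Circle.norm_coe, mul_one]
  have hwa2 : MemLp (fun t => w t * (b a t : ℂ)) 2 μ :=
    hw2.of_le hm.aestronglyMeasurable (ae_of_all _ fun t => (hnorm t).le)
  have hFa : ∀ y, pairingFourier b μ (fun t => w t * (b a t : ℂ)) y =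
      pairingFourier b μ w (y + a) := by
    intro y
    simp only [pairingFourier, hb.add_left, Circle.coe_mul]
    refine integral_congr_ae (ae_of_all _ fun t => ?_)
    ring
  have hνa : ∀ x, ∫ y, (b y x : ℂ) ∂(νw.map fun y => y - a) =
      ⟪hwa2.toLp _, translationRep μ x (hwa2.toLp _)⟫_ℂ := by
    intro x
    rw [integral_map (by fun_prop) (hb.continuous_coe_left x).aestronglyMeasurable,
      hb.inner_translationRep_modulate hw2 a hwa2, ← hνw, ← integral_const_mul]
    refine integral_congr_ae (ae_of_all _ fun y => ?_)
    change ((b (y - a) x : Circle) : ℂ) = _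
    rw [sub_eq_add_neg, hb.add_left, Circle.coe_mul, mul_comm]
  have h := hb.withDensity_pairingFourier_comm hv hv2 hvi hm hwa2 (hb.integrable_mul_right hwi a)
    hνv hνa
  simp only [hFa] at h
  have h1 := congrArg (fun ν => ν E) h
  rw [withDensity_apply _ hE, withDensity_apply _ hE, ← lintegral_indicator hE,
    ← lintegral_indicator hE, lintegral_map
    ((hb.measurable_withDensity_pairingFourier hv).indicator hE) (by fun_prop)] at h1
  rw [← lintegral_indicator hE, h1]

/-- The averaged form of the comparison of spectral measures. -/
theorem IsSelfDualPairing.measure_mul_lintegral_pairingFourier (hb : IsSelfDualPairing b)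
    {v w : G → ℂ} (hv : Measurable v) (hv2 : MemLp v 2 μ) (hvi : Integrable v μ)
    (hw : Measurable w) (hw2 : MemLp w 2 μ) (hwi : Integrable w μ) {νv νw : Measure G}
    [IsFiniteMeasure νv] [IsFiniteMeasure νw]
    (hνv : ∀ x, ∫ y, (b y x : ℂ) ∂νv = ⟪hv2.toLp v, translationRep μ x (hv2.toLp v)⟫_ℂ)
    (hνw : ∀ x, ∫ y, (b y x : ℂ) ∂νw = ⟪hw2.toLp w, translationRep μ x (hw2.toLp w)⟫_ℂ)
    {E : Set G} (hE : MeasurableSet E) :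
    νv E * ∫⁻ y, ENNReal.ofReal (‖pairingFourier b μ w y‖ ^ 2) ∂μ =
      νw Set.univ * ∫⁻ y in E, ENNReal.ofReal (‖pairingFourier b μ v y‖ ^ 2) ∂μ := by
  have hFw := hb.measurable_withDensity_pairingFourier (μ := μ) hw
  have hFv := (hb.measurable_withDensity_pairingFourier (μ := μ) hv).indicator hE
  -- Integrate the identity over all modulations a. After Tonelli, invariance of Haar measure makes
  -- the inner integrals independent of y, and both sides become products.
  have h := lintegral_congr (μ := μ) fun a =>
    hb.lintegral_pairingFourier_translate hv hv2 hvi hw hw2 hwi hνv hνw hE a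
  rw [lintegral_lintegral_swap (f := fun a y =>
      ENNReal.ofReal (‖pairingFourier b μ w (y + a)‖ ^ 2))
      (hFw.comp (measurable_snd.add measurable_fst)).aemeasurable,
    lintegral_lintegral_swap (f := fun a y =>
      E.indicator (fun y => ENNReal.ofReal (‖pairingFourier b μ v y‖ ^ 2)) (y - a))
      (hFv.comp (measurable_snd.sub measurable_fst)).aemeasurable] at h
  have e1 : ∀ y, ∫⁻ a, ENNReal.ofReal (‖pairingFourier b μ w (y + a)‖ ^ 2) ∂μ =
      ∫⁻ a, ENNReal.ofReal (‖pairingFourier b μ w a‖ ^ 2) ∂μ := fun y =>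
    lintegral_add_left_eq_self (fun y => ENNReal.ofReal (‖pairingFourier b μ w y‖ ^ 2)) y
  have e2 : ∀ y, ∫⁻ a, E.indicator (fun y => ENNReal.ofReal (‖pairingFourier b μ v y‖ ^ 2))
      (y - a) ∂μ =
      ∫⁻ a, E.indicator (fun y => ENNReal.ofReal (‖pairingFourier b μ v y‖ ^ 2)) a ∂μ := fun y =>
    lintegral_sub_left_eq_self _ y
  simp_rw [e1, e2] at h
  rw [lintegral_const, lintegral_const, Measure.restrict_apply_univ, lintegral_indicator hE] at h
  rw [mul_comm, h, mul_comm]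

/-- Bessel's inequality for the Fourier transform of a self-dual group, up to a constant. -/
theorem IsSelfDualPairing.exists_lintegral_pairingFourier_le (hb : IsSelfDualPairing b)
    (μ : Measure G) [μ.IsAddHaarMeasure] :
    ∃ C : ℝ≥0∞, C ≠ ∞ ∧ ∀ w : G → ℂ, Measurable w → MemLp w 2 μ → Integrable w μ →
      ∫⁻ y, ENNReal.ofReal (‖pairingFourier b μ w y‖ ^ 2) ∂μ ≤ C * ∫⁻ x, ‖w x‖ₑ ^ 2 ∂μ := by
  have := hb.t2Space
  have hπ := isUnitaryRepresentation_translationRep μ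
  -- Evaluation of the Fourier transform at x = 0 shows that the spectral measure of w has total
  -- mass ‖w‖².
  have huniv : ∀ {w : G → ℂ} (hw2 : MemLp w 2 μ) {ν : Measure G} [IsFiniteMeasure ν],
      (∀ x, ∫ y, (b y x : ℂ) ∂ν = ⟪hw2.toLp w, translationRep μ x (hw2.toLp w)⟫_ℂ) →
      ν Set.univ = ∫⁻ x, ‖w x‖ₑ ^ 2 ∂μ := by
    intro w hw2 ν _ hν
    have h := hν 0
    rw [translationRep_zero, one_apply_eq_self, inner_self_eq_norm_sq_to_K] at h
    have h1 : ∫ y, (b y 0 : ℂ) ∂ν = ((ν.real Set.univ : ℝ) : ℂ) := by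
      simp_rw [hb.zero_right]
      simp
    rw [h1] at h
    have h2 : ν.real Set.univ = ‖hw2.toLp w‖ ^ 2 := Complex.ofReal_injective (h.trans (by push_cast; rfl))
    have h3 : ‖hw2.toLp w‖ₑ ^ 2 = ∫⁻ x, ‖w x‖ₑ ^ 2 ∂μ := by
      rw [Lp.enorm_toLp, eLpNorm_eq_lintegral_rpow_enorm_toReal two_ne_zero ENNReal.ofNat_ne_top,
        ← ENNReal.rpow_natCast, ← ENNReal.rpow_mul]
      simp
    rw [← h3, ← ENNReal.ofReal_toReal (measure_ne_top ν Set.univ), ← measureReal_def, h2,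
      ENNReal.ofReal_pow (norm_nonneg _), ofReal_norm]
  obtain ⟨S, hS, hS0⟩ := exists_compact_mem_nhds (0 : G)
  have hSm := hS.measurableSet
  have hSpos : 0 < μ S := Measure.measure_pos_of_mem_nhds μ hS0
  let v : G → ℂ := S.indicator fun _ => 1
  have hv : Measurable v := measurable_const.indicator hSm
  have hv2 : MemLp v 2 μ := memLp_indicator_const 2 hSm 1 (Or.inr hS.measure_lt_top.ne)
  have hvi : Integrable v μ := (integrable_indicator_iff hSm).2
    (integrableOn_const hS.measure_lt_top.ne)
  obtain ⟨νv, hνf, hνv⟩ := hπ.exists_measure hb (hv2.toLp v)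
  have hνpos : νv Set.univ ≠ 0 := by
    rw [huniv hv2 hνv]
    have : ∀ x, ‖v x‖ₑ ^ 2 = S.indicator (fun _ => (1 : ℝ≥0∞)) x := by
      intro x
      by_cases hx : x ∈ S <;> simp [v, hx]
    simp_rw [this]
    rw [lintegral_indicator hSm, setLIntegral_one]
    exact hSpos.ne'
  -- With the indicator `v` of a compact neighbourhood fixed, choose a compact set charged by its
  -- spectral measure. The transform of `v` is bounded there, so the quotient taken as C is finite.
  obtain ⟨n, hn⟩ : ∃ n, νv (compactCovering G n) ≠ 0 := by
    by_contra! hcon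
    refine hνpos ?_
    rw [← iUnion_compactCovering G]
    exact measure_iUnion_null hcon
  have hE := isCompact_compactCovering G n
  set E := compactCovering G n
  refine ⟨(∫⁻ y in E, ENNReal.ofReal (‖pairingFourier b μ v y‖ ^ 2) ∂μ) / νv E,
    ENNReal.div_ne_top (ne_of_lt ?_) hn, fun w hw hw2 hwi => ?_⟩
  · refine (lintegral_mono (g := fun _ => ENNReal.ofReal ((∫ x, ‖v x‖ ∂μ) ^ 2)) fun y => ?_).trans_lt
      ?_
    · exact ENNReal.ofReal_le_ofReal
        (pow_le_pow_left₀ (norm_nonneg _) (IsSelfDualPairing.norm_pairingFourier_le v y) 2)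
    · rw [lintegral_const, Measure.restrict_apply_univ]
      exact ENNReal.mul_lt_top ENNReal.ofReal_lt_top hE.measure_lt_top
  · obtain ⟨νw, hνwf, hνw⟩ := hπ.exists_measure hb (hw2.toLp w)
    have h := hb.measure_mul_lintegral_pairingFourier hv hv2 hvi hw hw2 hwi hνv hνw hE.measurableSet
    rw [← huniv hw2 hνw, mul_comm, ← mul_div_assoc, ENNReal.le_div_iff_mul_le (Or.inl hn)
      (Or.inl (measure_ne_top _ _)), mul_comm, h]

/-! ### Schur's lemma -/

section Schur

variable {G : Type u} {H : Type v} [NormedAddCommGroup H] [InnerProductSpace ℂ H]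
  [CompleteSpace H] {W : G → (H ≃ₗᵢ[ℂ] H)}
  {H' : Type*} [NormedAddCommGroup H'] [InnerProductSpace ℂ H'] [CompleteSpace H']
  {W' : G → (H' ≃ₗᵢ[ℂ] H')}

/-- By functional calculus the spectrum is a single point. If it had two, there would be continuous
f and g with fg = 0 and f(T), g(T) both nonzero; but the kernel of f(T) is closed, invariant and
contains the range of g(T), so irreducibility kills one of them. -/
theorem IsIrreducibleFamily.eq_algebraMap_of_isSelfAdjoint (hirr : IsIrreducibleFamily W)
    {T : H →L[ℂ] H} (hsa : IsSelfAdjoint T) (hT : ∀ x h, T (W x h) = W x (T h)) :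
    ∃ r : ℝ, T = algebraMap ℝ (H →L[ℂ] H) r := by
  have := hirr.1
  have hcomm : ∀ (f : ℝ → ℝ) x h, cfc f T (W x h) = W x (cfc f T h) := by
    intro f x h
    let w : H →L[ℂ] H := (W x).toContinuousLinearEquiv
    have h1 : Commute T w := by
      ext k
      exact hT x k
    exact congrArg (fun A : H →L[ℂ] H => A h) (h1.cfc_real f).eq
  have hker : ∀ f g : ℝ → ℝ, Continuous f → Continuous g → (∀ t, f t * g t = 0) →
      cfc f T = 0 ∨ cfc g T = 0 := by
    intro f g hf hg hfg
    have hmul : cfc f T * cfc g T = 0 := by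
      rw [← cfc_mul f g T hf.continuousOn hg.continuousOn]
      simp [hfg]
    rcases hirr.2 (LinearMap.ker (cfc f T).toLinearMap) (cfc f T : H →L[ℂ] H).isClosed_ker
      (fun x h hh => by
        change cfc f T (W x h) = 0
        rw [hcomm, show cfc f T h = 0 from hh, map_zero]) with h0 | h0
    · right
      ext h
      have : cfc g T h ∈ LinearMap.ker (cfc f T).toLinearMap :=
        congrArg (fun A : H →L[ℂ] H => A h) hmul
      rw [h0] at this
      exact this
    · left
      ext h
      have : h ∈ LinearMap.ker (cfc f T).toLinearMap := by rw [h0]; trivial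
      exact this
  have hne : ∀ f : ℝ → ℝ, Continuous f → cfc f T = 0 → ∀ t ∈ spectrum ℝ T, f t = 0 := by
    intro f hf h0 t ht
    have h1 : f t ∈ spectrum ℝ (cfc f T) := by
      rw [cfc_map_spectrum (R := ℝ) f T hsa hf.continuousOn]
      exact ⟨t, ht, rfl⟩
    rw [h0, spectrum.zero_eq] at h1
    exact h1
  have hlt : ∀ s ∈ spectrum ℝ T, ∀ t ∈ spectrum ℝ T, ¬ s < t := by
    intro s hs t ht hst
    -- The two ramps meet at the midpoint of s and t: the first is positive at t, the second at s.
    rcases hker (fun x => max (x - (s + t) / 2) 0) (fun x => max ((s + t) / 2 - x) 0)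
      (by fun_prop) (by fun_prop) (fun x => by
        rcases le_total x ((s + t) / 2) with h | h
        · rw [max_eq_right (sub_nonpos.2 h), zero_mul]
        · rw [max_eq_right (sub_nonpos.2 h), mul_zero]) with h | h
    · have := hne _ (by fun_prop) h t ht
      simp only [max_eq_right_iff] at this
      linarith
    · have := hne _ (by fun_prop) h s hs
      simp only [max_eq_right_iff] at this
      linarith
  obtain ⟨r, hr⟩ := ContinuousFunctionalCalculus.spectrum_nonempty (R := ℝ) T hsa
  refine ⟨r, ?_⟩
  rw [← cfc_const r T hsa]
  nth_rewrite 1 [← cfc_id ℝ T hsa]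
  refine cfc_congr fun t ht => ?_
  exact le_antisymm (not_lt.1 (hlt r hr t ht)) (not_lt.1 (hlt t ht r hr))

/-- Schur's lemma: an operator commuting with an irreducible family of unitaries is a scalar. -/
theorem IsIrreducibleFamily.exists_eq_smul (hirr : IsIrreducibleFamily W)
    {T : H →L[ℂ] H} (hT : ∀ x h k, ⟪W x h, T (W x k)⟫_ℂ = ⟪h, T k⟫_ℂ) :
    ∃ c : ℂ, ∀ h, T h = c • h := by
  have hcomm : ∀ {A : H →L[ℂ] H}, (∀ x h k, ⟪W x h, A (W x k)⟫_ℂ = ⟪h, A k⟫_ℂ) →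
      ∀ x h, A (W x h) = W x (A h) := by
    intro A hA x h
    refine ext_inner_left ℂ fun k => ?_
    rw [← (W x).apply_symm_apply k, hA, LinearIsometryEquiv.inner_map_map]
  -- The adjoint satisfies the same invariance, so the self-adjoint case applies to the real and
  -- imaginary parts.
  have hstar : ∀ x h k, ⟪W x h, star T (W x k)⟫_ℂ = ⟪h, star T k⟫_ℂ := by
    intro x h k
    rw [ContinuousLinearMap.star_eq_adjoint, ContinuousLinearMap.adjoint_inner_right,
      ContinuousLinearMap.adjoint_inner_right, ← inner_conj_symm, hT, inner_conj_symm]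
  obtain ⟨r, hr⟩ := hirr.eq_algebraMap_of_isSelfAdjoint (realPart T).2 (hcomm fun x h k => by
    rw [realPart_apply_coe]
    simp only [smul_apply, add_apply, inner_smul_right_eq_smul, inner_add_right, hT, hstar])
  obtain ⟨s, hs⟩ := hirr.eq_algebraMap_of_isSelfAdjoint (imaginaryPart T).2 (hcomm fun x h k => by
    rw [imaginaryPart_apply_coe]
    simp only [smul_apply, sub_apply, inner_smul_right_eq_smul, inner_sub_right, hT, hstar])
  refine ⟨r + Complex.I * s, fun h => ?_⟩
  rw [← realPart_add_I_smul_imaginaryPart T, hr, hs, Algebra.algebraMap_eq_smul_one,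
    Algebra.algebraMap_eq_smul_one, add_apply, smul_apply, smul_apply, smul_apply,
    one_apply_eq_self, add_smul, mul_smul]
  rfl

theorem IsIrreducibleFamily.exists_phase_of_commute (hirr : IsIrreducibleFamily W)
    {U : H ≃ₗᵢ[ℂ] H} (hU : ∀ x, U * W x = W x * U) : U ∈ phases H := by
  have hU' : ∀ x h, U (W x h) = W x (U h) := fun x h =>
    congrArg (fun A : H ≃ₗᵢ[ℂ] H => A h) (hU x)
  obtain ⟨c, hc⟩ := hirr.exists_eq_smul (T := (U.toContinuousLinearEquiv : H →L[ℂ] H))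
    (fun x h k => by
      change ⟪W x h, U (W x k)⟫_ℂ = ⟪h, U k⟫_ℂ
      rw [hU', LinearIsometryEquiv.inner_map_map])
  have := hirr.1
  obtain ⟨h, hh⟩ := exists_ne (0 : H)
  have hn : ‖c‖ = 1 := by
    have h1 : ‖U h‖ = ‖c • h‖ := congrArg norm (hc h)
    rw [LinearIsometryEquiv.norm_map, norm_smul] at h1
    exact (mul_eq_right₀ (norm_ne_zero_iff.2 hh)).1 h1.symm
  refine ⟨⟨c, mem_sphere_zero_iff_norm.2 hn⟩, ?_⟩
  ext k
  exact (hc k).symm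

/-- A nonzero intertwiner between irreducible families is a multiple of a unitary intertwiner. -/
theorem IsIrreducibleFamily.exists_unitary_of_intertwiner (hirr : IsIrreducibleFamily W)
    (hirr' : IsIrreducibleFamily W') {T : H →L[ℂ] H'} (hT0 : T ≠ 0)
    (hT : ∀ x h k, ⟪W' x h, T (W x k)⟫_ℂ = ⟪h, T k⟫_ℂ) :
    ∃ U : H ≃ₗᵢ[ℂ] H', ∀ x h, U (W x h) = W' x (U h) := by
  have hTW : ∀ x h, T (W x h) = W' x (T h) := by
    intro x h
    refine ext_inner_left ℂ fun k => ?_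
    rw [← (W' x).apply_symm_apply k, hT, LinearIsometryEquiv.inner_map_map]
  -- The operator T*T commutes with `W`, so it is a scalar and T is √‖c‖ times an isometry. The
  -- range of that isometry is closed, invariant and nonzero, hence everything.
  obtain ⟨c, hc⟩ := hirr.exists_eq_smul (T := ContinuousLinearMap.adjoint T ∘L T) (fun x h k => by
    simp only [ContinuousLinearMap.comp_apply, ContinuousLinearMap.adjoint_inner_right]
    rw [hTW, hTW, LinearIsometryEquiv.inner_map_map])
  simp only [ContinuousLinearMap.comp_apply] at hc
  have hnorm : ∀ h, ‖T h‖ ^ 2 = ‖c‖ * ‖h‖ ^ 2 := by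
    intro h
    have h1 : ⟪T h, T h⟫_ℂ = c * ⟪h, h⟫_ℂ := by
      rw [← ContinuousLinearMap.adjoint_inner_right, hc, inner_smul_right]
    have h2 := congrArg norm h1
    rw [norm_mul, inner_self_eq_norm_sq_to_K, inner_self_eq_norm_sq_to_K, norm_pow, norm_pow] at h2
    simpa using h2
  have hc0 : 0 < ‖c‖ := by
    refine norm_pos_iff.2 fun h0 => hT0 ?_
    ext h
    have := hnorm h
    rw [h0, norm_zero, zero_mul] at this
    exact norm_eq_zero.1 (pow_eq_zero_iff two_ne_zero |>.1 this)
  set r : ℝ := (Real.sqrt ‖c‖)⁻¹ with hr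
  have hrpos : 0 < r := inv_pos.2 (Real.sqrt_pos.2 hc0)
  let V : H →ₗᵢ[ℂ] H' :=
    { ((r : ℂ) • T : H →L[ℂ] H').toLinearMap with
      norm_map' := fun h => by
        change ‖(r : ℂ) • T h‖ = ‖h‖
        rw [norm_smul, Complex.norm_real, Real.norm_of_nonneg hrpos.le]
        refine (pow_left_inj₀ (by positivity) (norm_nonneg _) two_ne_zero).1 ?_
        rw [mul_pow, hnorm, hr, inv_pow, Real.sq_sqrt hc0.le, inv_mul_cancel_left₀ hc0.ne'] }
  have hV : ∀ h, V h = (r : ℂ) • T h := fun h => rfl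
  have hsurj : LinearMap.range V.toLinearMap = ⊤ := by
    refine (hirr'.2 (LinearMap.range V.toLinearMap) ?_ ?_).resolve_left ?_
    · have : (LinearMap.range V.toLinearMap : Set H') = Set.range V := by
        ext; simp
      rw [this]
      exact V.isometry.isClosedEmbedding.isClosed_range
    · rintro x _ ⟨h, rfl⟩
      refine ⟨W x h, ?_⟩
      change V (W x h) = W' x (V h)
      rw [hV, hV, hTW, map_smul]
    · intro h0
      have := hirr.1
      obtain ⟨h, hh⟩ := exists_ne (0 : H)
      have h1 : V h ∈ LinearMap.range V.toLinearMap := ⟨h, rfl⟩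
      rw [h0, Submodule.mem_bot, map_eq_zero_iff V V.injective] at h1
      exact hh h1
  refine ⟨LinearIsometryEquiv.ofSurjective V (LinearMap.range_eq_top.1 hsurj), fun x h => ?_⟩
  change V (W x h) = W' x (V h)
  rw [hV, hV, hTW, map_smul]

end Schur

/-! ### Orthonormal families in separable spaces -/

section HilbertBasis

variable {H : Type v} [NormedAddCommGroup H] [InnerProductSpace ℂ H]

/-- Orthonormal vectors are √2 apart, so balls of radius 1/2 around them are disjoint. Countability
later allows sums over a basis to be exchanged with integrals. -/
theorem Orthonormal.countable_of_separableSpace [TopologicalSpace.SeparableSpace H] {ι : Type*}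
    {e : ι → H} (he : Orthonormal ℂ e) : Countable ι := by
  have h : Pairwise (Function.onFun Disjoint fun i => Metric.ball (e i) (1 / 2)) := by
    intro i j hij
    refine Metric.ball_disjoint_ball ?_
    have h1 : ‖e i - e j‖ ^ 2 = 2 := by
      rw [@norm_sub_sq ℂ, he.1 i, he.1 j, he.2 hij]
      norm_num
    rw [dist_eq_norm]
    nlinarith [norm_nonneg (e i - e j)]
  exact h.countable_of_isOpen_disjoint (fun i => Metric.isOpen_ball)
    fun i => Metric.nonempty_ball.2 (by norm_num)

theorem HilbertBasis.tsum_enorm_inner_sq {ι : Type*} (e : HilbertBasis ι ℂ H) (v : H) :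
    ∑' i, ‖⟪e i, v⟫_ℂ‖ₑ ^ 2 = ‖v‖ₑ ^ 2 := by
  have h1 : ∀ i, ⟪v, e i⟫_ℂ * ⟪e i, v⟫_ℂ = ((‖⟪e i, v⟫_ℂ‖ ^ 2 : ℝ) : ℂ) := by
    intro i
    rw [← inner_conj_symm, Complex.conj_mul']
    push_cast; rfl
  have h2 := e.tsum_inner_mul_inner v v
  have h3 := e.summable_inner_mul_inner v v
  simp_rw [h1] at h2 h3
  rw [← Complex.ofReal_tsum, inner_self_eq_norm_sq_to_K] at h2
  have h4 : ∑' i, ‖⟪e i, v⟫_ℂ‖ ^ 2 = ‖v‖ ^ 2 :=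
    Complex.ofReal_injective (h2.trans (by push_cast; rfl))
  have h5 := ENNReal.ofReal_tsum_of_nonneg (fun i => sq_nonneg ‖⟪e i, v⟫_ℂ‖)
    (Complex.summable_ofReal.1 h3)
  rw [h4] at h5
  simp_rw [ENNReal.ofReal_pow (norm_nonneg _), ofReal_norm] at h5
  exact h5.symm

end HilbertBasis

/-! ### Existence of a vector with square integrable coefficients -/

section SigmaRepresentation

variable {G : Type u} [AddCommGroup G] [TopologicalSpace G] [IsTopologicalAddGroup G]
  [LocallyCompactSpace G] [SecondCountableTopology G] [MeasurableSpace G] [BorelSpace G]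
  {H : Type v} [NormedAddCommGroup H] [InnerProductSpace ℂ H] [CompleteSpace H]
  [TopologicalSpace.SeparableSpace H] [MeasurableSpace H] [BorelSpace H]
  {σ : G → G → Circle} {W : G → (H ≃ₗᵢ[ℂ] H)}

/-- The commutation pairing of a multiplier. -/
def commutationPairing (σ : G → G → Circle) (x y : G) : Circle := σ x y * (σ y x)⁻¹

theorem IsHeisenbergMultiplier.isSelfDualPairing (hσ : IsHeisenbergMultiplier σ) :
    IsSelfDualPairing (commutationPairing σ) where
  selfDual := hσ.selfDual
  symm x y := by simp [commutationPairing]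

namespace IsSigmaRepresentation

theorem apply_apply (hW : IsSigmaRepresentation σ W) (x y : G) (h : H) :
    W x (W y h) = (σ x y : ℂ) • W (x + y) h :=
  congrArg (fun A : H ≃ₗᵢ[ℂ] H => A h) (hW.mul x y)

theorem comm (hW : IsSigmaRepresentation σ W) (x y : G) :
    W x * W y = phase H (commutationPairing σ x y) * (W y * W x) := by
  rw [hW.mul, hW.mul, add_comm y x, commutationPairing, ← mul_assoc, ← map_mul,
    inv_mul_cancel_right]

theorem apply_comm (hW : IsSigmaRepresentation σ W) (x y : G) (h : H) :
    W x (W y h) = (commutationPairing σ x y : ℂ) • W y (W x h) :=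
  congrArg (fun A : H ≃ₗᵢ[ℂ] H => A h) (hW.comm x y)

theorem symm_apply (hσ : IsTwoCocycle σ) (hW : IsSigmaRepresentation σ W) (x : G) (h : H) :
    (W x).symm h = conj (σ x (-x) : ℂ) • W (-x) h := by
  rw [LinearIsometryEquiv.symm_apply_eq, map_smul, hW.apply_apply, add_neg_cancel,
    hW.map_zero hσ, smul_smul, Complex.conj_mul', Circle.norm_coe]
  simp

theorem measurable_symm (hσ : IsTwoCocycle σ) (hW : IsSigmaRepresentation σ W) (h : H) :
    Measurable fun x => (W x).symm h := by
  have : SecondCountableTopology H := UniformSpace.secondCountable_of_separable H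
  simp_rw [symm_apply hσ hW]
  have h1 : Measurable fun x : G => (σ x (-x) : ℂ) :=
    hσ.borel.comp (measurable_id.prodMk measurable_neg)
  exact (Complex.continuous_conj.measurable.comp h1).smul ((hW.borel h).comp measurable_neg)

theorem measurable_coeff (hW : IsSigmaRepresentation σ W) (ζ ξ : H) :
    Measurable fun x => ⟪ζ, W x ξ⟫_ℂ :=
  (innerSL ℂ ζ).continuous.measurable.comp (hW.borel ξ)

end IsSigmaRepresentation

/-- A vector all of whose matrix coefficients are square integrable. -/
def IsAdmissible (μ : Measure G) (W : G → (H ≃ₗᵢ[ℂ] H)) (ζ : H) : Prop :=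
  ∀ ξ, MemLp (fun x => ⟪ζ, W x ξ⟫_ℂ) 2 μ

theorem memLp_two_iff_lintegral {X : Type*} [MeasurableSpace X] {μ : Measure X} {f : X → ℂ}
    (hf : Measurable f) : MemLp f 2 μ ↔ ∫⁻ x, ‖f x‖ₑ ^ 2 ∂μ < ∞ := by
  have h : eLpNorm f 2 μ ^ 2 = ∫⁻ x, ‖f x‖ₑ ^ 2 ∂μ := by
    rw [eLpNorm_eq_lintegral_rpow_enorm_toReal two_ne_zero ENNReal.ofNat_ne_top,
      ← ENNReal.rpow_natCast, ← ENNReal.rpow_mul]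
    simp
  rw [← h, MemLp]
  simp [hf.aestronglyMeasurable]

/-- A σ-representation of a Heisenberg multiplier has a nonzero vector with square integrable
matrix coefficients. -/
theorem IsSigmaRepresentation.exists_isAdmissible (hσ : IsHeisenbergMultiplier σ)
    (hW : IsSigmaRepresentation σ W) [Nontrivial H] (μ : Measure G) [μ.IsAddHaarMeasure] :
    ∃ ζ, ζ ≠ 0 ∧ IsAdmissible μ W ζ := by
  have : SecondCountableTopology H := UniformSpace.secondCountable_of_separable H
  have hb := hσ.isSelfDualPairing
  have := hb.t2Space
  obtain ⟨η, hη⟩ := exists_ne (0 : H)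
  have hmη := hW.measurable_symm hσ.toIsTwoCocycle η
  have hint : ∀ {E : Set G}, IsCompact E → IntegrableOn (fun x => (W x).symm η) E μ := fun hE =>
    Measure.integrableOn_of_bounded hE.measure_lt_top.ne hmη.aestronglyMeasurable (M := ‖η‖)
      (ae_of_all _ fun x => (LinearIsometryEquiv.norm_map _ _).le)
  -- The candidate is a local average of W(x)⁻¹η. If all such averages vanished, W(x)⁻¹η would be
  -- zero almost everywhere.
  obtain ⟨E, hE, hE0⟩ : ∃ E, IsCompact E ∧ ∫ x in E, (W x).symm η ∂μ ≠ 0 := by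
    by_contra! hcon
    have h := ae_eq_zero_of_forall_setIntegral_isCompact_eq_zero'
      (locallyIntegrable_iff.2 fun k hk => hint hk) hcon
    have h1 : ∀ᵐ x ∂μ, False := by
      filter_upwards [h] with x hx
      exact hη ((map_eq_zero_iff _ (W x).symm.injective).1 hx)
    rw [eventually_false_iff_eq_bot, ae_eq_bot] at h1
    exact (NeZero.ne μ) h1
  refine ⟨_, hE0, fun ξ => (memLp_two_iff_lintegral (hW.measurable_coeff _ ξ)).2 ?_⟩
  obtain ⟨w, e, -⟩ := exists_hilbertBasis ℂ H
  have := e.orthonormal.countable_of_separableSpace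
  obtain ⟨C, hC, hbes⟩ := hb.exists_lintegral_pairingFourier_le μ
  let f : w → G → ℂ := fun i => E.indicator fun x => ⟪e i, W x ξ⟫_ℂ
  have hfm : ∀ i, Measurable (f i) := fun i => (hW.measurable_coeff _ ξ).indicator hE.measurableSet
  have hfb : ∀ i x, ‖f i x‖ ≤ E.indicator (fun _ => ‖e i‖ * ‖ξ‖) x := by
    intro i x
    by_cases hx : x ∈ E
    · simp only [f, Set.indicator_of_mem hx]
      exact (norm_inner_le_norm _ _).trans_eq (by rw [LinearIsometryEquiv.norm_map])
    · simp [f, hx]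
  have hf1 : ∀ i, Integrable (f i) μ := fun i =>
    Integrable.mono' ((integrable_indicator_iff hE.measurableSet).2
      (integrableOn_const hE.measure_lt_top.ne)) (hfm i).aestronglyMeasurable
      (ae_of_all _ (hfb i))
  have hf2 : ∀ i, MemLp (f i) 2 μ := fun i =>
    (memLp_indicator_const 2 hE.measurableSet (‖e i‖ * ‖ξ‖) (Or.inr hE.measure_lt_top.ne)).mono'
      (hfm i).aestronglyMeasurable (ae_of_all _ (hfb i))
  -- Commuting W(x) past W(y) gives ⟪ζ, W(y)ξ⟫ = ⟪W(y)⁻¹η, Ψ(y)⟫ for the average ζ. In a Hilbert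
  -- basis the coordinates of Ψ are Fourier transforms of functions supported in `E`.
  let Ψ : G → H := fun y => ∫ x in E, (commutationPairing σ x y : ℂ) • W x ξ ∂μ
  have hΨint : ∀ y, IntegrableOn (fun x => (commutationPairing σ x y : ℂ) • W x ξ) E μ := fun y =>
    Measure.integrableOn_of_bounded hE.measure_lt_top.ne
      ((hb.continuous_coe_left y).measurable.smul (hW.borel ξ)).aestronglyMeasurable (M := ‖ξ‖)
      (ae_of_all _ fun x => by
        rw [norm_smul, Circle.norm_coe, one_mul, LinearIsometryEquiv.norm_map])
  have hcoef : ∀ i y, ⟪e i, Ψ y⟫_ℂ = pairingFourier (commutationPairing σ) μ (f i) (-y) := by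
    intro i y
    rw [← integral_inner (hΨint y), pairingFourier, ← integral_indicator hE.measurableSet]
    refine integral_congr_ae (ae_of_all _ fun x => ?_)
    by_cases hx : x ∈ E
    · simp only [Set.indicator_of_mem hx, f, inner_smul_right]
      rw [hb.neg_left, ← hb.symm, mul_comm]
    · simp [hx, f]
  have hle : ∀ y, ‖⟪∫ x in E, (W x).symm η ∂μ, W y ξ⟫_ℂ‖ₑ ^ 2 ≤ ‖η‖ₑ ^ 2 * ‖Ψ y‖ₑ ^ 2 := by
    intro y
    have h1 : ⟪∫ x in E, (W x).symm η ∂μ, W y ξ⟫_ℂ = ⟪(W y).symm η, Ψ y⟫_ℂ := by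
      rw [← inner_conj_symm, ← integral_inner (hint hE), ← integral_conj, ← integral_inner (hΨint y)]
      refine integral_congr_ae (ae_of_all _ fun x => ?_)
      simp only
      rw [inner_conj_symm, ← LinearIsometryEquiv.inner_map_map (W x),
        LinearIsometryEquiv.apply_symm_apply, hW.apply_comm, inner_smul_right, inner_smul_right,
        ← LinearIsometryEquiv.inner_map_map (W y) ((W y).symm η),
        LinearIsometryEquiv.apply_symm_apply]
    rw [h1, ← mul_pow]
    refine pow_le_pow_left' ?_ 2
    rw [← ofReal_norm, ← ofReal_norm, ← ofReal_norm, ← ENNReal.ofReal_mul (norm_nonneg _)]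
    refine ENNReal.ofReal_le_ofReal ((norm_inner_le_norm _ _).trans_eq ?_)
    rw [LinearIsometryEquiv.norm_map]
  have hFm := fun i => (hb.measurable_pairingFourier (μ := μ) (hfm i))
  -- Bessel's inequality is applied to each coordinate; Parseval, pointwise on `E`, sums the results
  -- to ‖ξ‖².
  have hΨ : ∫⁻ y, ‖Ψ y‖ₑ ^ 2 ∂μ ≤ C * (‖ξ‖ₑ ^ 2 * μ E) := by
    calc ∫⁻ y, ‖Ψ y‖ₑ ^ 2 ∂μ
        = ∫⁻ y, ∑' i, ‖pairingFourier (commutationPairing σ) μ (f i) (-y)‖ₑ ^ 2 ∂μ := by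
          simp_rw [← hcoef, e.tsum_enorm_inner_sq]
      _ = ∑' i, ∫⁻ y, ‖pairingFourier (commutationPairing σ) μ (f i) (-y)‖ₑ ^ 2 ∂μ :=
          lintegral_tsum fun i => ((hFm i).comp measurable_neg).enorm.pow_const 2 |>.aemeasurable
      _ = ∑' i, ∫⁻ y, ‖pairingFourier (commutationPairing σ) μ (f i) y‖ₑ ^ 2 ∂μ := by
          congr 1 with i
          exact lintegral_neg_eq_self
            (fun y => ‖pairingFourier (commutationPairing σ) μ (f i) y‖ₑ ^ 2)
      _ ≤ ∑' i, C * ∫⁻ x, ‖f i x‖ₑ ^ 2 ∂μ := by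
          refine ENNReal.tsum_le_tsum fun i => ?_
          have := hbes (f i) (hfm i) (hf2 i) (hf1 i)
          simp_rw [ENNReal.ofReal_pow (norm_nonneg _), ofReal_norm] at this
          exact this
      _ = C * ∫⁻ x, ∑' i, ‖f i x‖ₑ ^ 2 ∂μ := by
          rw [ENNReal.tsum_mul_left, lintegral_tsum fun i =>
            ((hfm i).enorm.pow_const 2).aemeasurable]
      _ = C * (‖ξ‖ₑ ^ 2 * μ E) := by
          congr 1
          rw [← setLIntegral_const, ← lintegral_indicator hE.measurableSet]
          congr 1 with x
          by_cases hx : x ∈ E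
          · simp only [f, Set.indicator_of_mem hx]
            rw [e.tsum_enorm_inner_sq, ← ofReal_norm, LinearIsometryEquiv.norm_map, ofReal_norm]
          · simp [f, hx]
  refine (lintegral_mono hle).trans_lt ?_
  rw [lintegral_const_mul' _ _ (ENNReal.pow_ne_top enorm_ne_top)]
  exact ENNReal.mul_lt_top (ENNReal.pow_lt_top enorm_lt_top) (hΨ.trans_lt
    (ENNReal.mul_lt_top hC.lt_top (ENNReal.mul_lt_top (ENNReal.pow_lt_top enorm_lt_top)
      hE.measure_lt_top)))

end SigmaRepresentation

/-! ### Orthogonality relations -/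

section Moyal

variable {G : Type u} [AddCommGroup G] [TopologicalSpace G] [IsTopologicalAddGroup G]
  [LocallyCompactSpace G] [SecondCountableTopology G] [MeasurableSpace G] [BorelSpace G]
  {H : Type v} [NormedAddCommGroup H] [InnerProductSpace ℂ H] [CompleteSpace H]
  [TopologicalSpace.SeparableSpace H] [MeasurableSpace H] [BorelSpace H]
  {H' : Type*} [NormedAddCommGroup H'] [InnerProductSpace ℂ H'] [CompleteSpace H']
  [TopologicalSpace.SeparableSpace H'] [MeasurableSpace H'] [BorelSpace H']
  {σ : G → G → Circle} {W : G → (H ≃ₗᵢ[ℂ] H)} {W' : G → (H' ≃ₗᵢ[ℂ] H')}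
  {μ : Measure G} [μ.IsAddHaarMeasure]

/-- The matrix coefficient map `ξ ↦ ⟪ζ, W · ξ⟫` into `L²`. -/
def coeffMap {ζ : H} (hζ : IsAdmissible μ W ζ) : H →L[ℂ] Lp ℂ 2 μ :=
  ContinuousLinearMap.ofSeqClosedGraph (g :=
    { toFun := fun ξ => (hζ ξ).toLp _
      map_add' := fun ξ ξ' => by
        rw [← MemLp.toLp_add]
        refine MemLp.toLp_congr _ _ (ae_of_all _ fun x => ?_)
        simp
      map_smul' := fun c ξ => by
        rw [RingHom.id_apply, ← MemLp.toLp_const_smul]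
        refine MemLp.toLp_congr _ _ (ae_of_all _ fun x => ?_)
        simp }) (by
    intro u ξ y hu hy
    -- Boundedness comes from the closed graph theorem: an L²-limit is an almost everywhere limit
    -- along a subsequence, while the coefficients converge pointwise.
    obtain ⟨ns, hns, hae⟩ := (tendstoInMeasure_of_tendsto_Lp hy).exists_seq_tendsto_ae
    refine Lp.ext ?_
    change _ =ᵐ[μ] (hζ ξ).toLp _
    have hall : ∀ᵐ x ∂μ, ∀ n, (hζ (u n)).toLp _ x = ⟪ζ, W x (u n)⟫_ℂ :=
      ae_all_iff.2 fun n => (hζ (u n)).coeFn_toLp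
    filter_upwards [hae, (hζ ξ).coeFn_toLp, hall] with x h1 h2 h3
    rw [h2]
    refine tendsto_nhds_unique h1 ?_
    have h4 : Tendsto (fun n => ⟪ζ, W x (u (ns n))⟫_ℂ) atTop (𝓝 ⟪ζ, W x ξ⟫_ℂ) :=
      ((((innerSL ℂ ζ).continuous.comp (W x).continuous).tendsto ξ).comp hu).comp
        hns.tendsto_atTop
    refine h4.congr fun n => ?_
    exact (h3 (ns n)).symm)

theorem coeffMap_coeFn {ζ : H} (hζ : IsAdmissible μ W ζ) (ξ : H) :
    coeffMap hζ ξ =ᵐ[μ] fun x => ⟪ζ, W x ξ⟫_ℂ :=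
  (hζ ξ).coeFn_toLp

/-- The pairing of two matrix coefficients. -/
def coeffPairing (μ : Measure G) (W' : G → (H' ≃ₗᵢ[ℂ] H')) (W : G → (H ≃ₗᵢ[ℂ] H)) (ζ' ξ' : H')
    (ζ ξ : H) : ℂ :=
  ∫ x, conj ⟪ζ', W' x ξ'⟫_ℂ * ⟪ζ, W x ξ⟫_ℂ ∂μ

theorem IsAdmissible.integrable_mul {ζ : H} {ζ' : H'} (hζ : IsAdmissible μ W ζ)
    (hζ' : IsAdmissible μ W' ζ') (ξ' : H') (ξ : H) :
    Integrable (fun x => conj ⟪ζ', W' x ξ'⟫_ℂ * ⟪ζ, W x ξ⟫_ℂ) μ :=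
  (hζ' ξ').star.integrable_mul (hζ ξ)

/-- Averaging produces operators intertwining two σ-representations. -/
theorem IsAdmissible.exists_intertwiner (hW : IsSigmaRepresentation σ W)
    (hW' : IsSigmaRepresentation σ W') {ζ : H} {ζ' : H'} (hζ : IsAdmissible μ W ζ)
    (hζ' : IsAdmissible μ W' ζ') :
    ∃ T : H →L[ℂ] H', (∀ ξ' ξ, ⟪ξ', T ξ⟫_ℂ = coeffPairing μ W' W ζ' ξ' ζ ξ) ∧
      ∀ x h k, ⟪W' x h, T (W x k)⟫_ℂ = ⟪h, T k⟫_ℂ := by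
  let T : H →L[ℂ] H' := ContinuousLinearMap.adjoint (coeffMap hζ') ∘L coeffMap hζ
  have hT : ∀ ξ' ξ, ⟪ξ', T ξ⟫_ℂ = coeffPairing μ W' W ζ' ξ' ζ ξ := by
    intro ξ' ξ
    simp only [T, ContinuousLinearMap.comp_apply, ContinuousLinearMap.adjoint_inner_right]
    rw [L2.inner_def, coeffPairing]
    refine integral_congr_ae ?_
    filter_upwards [coeffMap_coeFn hζ ξ, coeffMap_coeFn hζ' ξ'] with x h1 h2
    rw [h1, h2, RCLike.inner_apply']
  refine ⟨T, hT, fun a h k => ?_⟩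
  -- Translation by a in the Haar integral: both representations contribute the same phase σ(x,a),
  -- once conjugated, so the phases cancel.
  rw [hT, hT, coeffPairing, coeffPairing,
    ← integral_add_right_eq_self (fun x => conj ⟪ζ', W' x h⟫_ℂ * ⟪ζ, W x k⟫_ℂ) a]
  refine integral_congr_ae (ae_of_all _ fun x => ?_)
  simp only [hW.apply_apply, hW'.apply_apply, inner_smul_right, map_mul]
  have : conj (σ x a : ℂ) * (σ x a : ℂ) = 1 := by
    rw [Complex.conj_mul', Circle.norm_coe]; norm_num
  linear_combination (conj ⟪ζ', W' (x + a) h⟫_ℂ * ⟪ζ, W (x + a) k⟫_ℂ) * this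

/-- Substitute -x for x; since W(x)⁻¹ is W(-x) up to a phase, the phases cancel. The exchange of
(ζ,ζ') with (ξ',ξ) lets Schur's lemma, which controls only ξ and ξ', control ζ and ζ' too. -/
theorem coeffPairing_symm [T2Space G] (hσ : IsTwoCocycle σ) (hW : IsSigmaRepresentation σ W)
    (ζ ζ' ξ ξ' : H) :
    coeffPairing μ W W ζ' ξ' ζ ξ = coeffPairing μ W W ξ ζ ξ' ζ' := by
  rw [coeffPairing, coeffPairing,
    ← integral_neg_eq_self (fun x => conj ⟪ξ, W x ζ⟫_ℂ * ⟪ξ', W x ζ'⟫_ℂ)]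
  refine integral_congr_ae (ae_of_all _ fun x => ?_)
  have h1 : ∀ h k : H, ⟪h, W x k⟫_ℂ = (σ x (-x) : ℂ) * conj ⟪k, W (-x) h⟫_ℂ := by
    intro h k
    rw [← LinearIsometryEquiv.inner_map_map (W x).symm, LinearIsometryEquiv.symm_apply_apply,
      IsSigmaRepresentation.symm_apply hσ hW, inner_smul_left, Complex.conj_conj, inner_conj_symm]
  simp only [h1 ζ ξ, h1 ζ' ξ', map_mul, Complex.conj_conj]
  have : conj (σ x (-x) : ℂ) * (σ x (-x) : ℂ) = 1 := by
    rw [Complex.conj_mul', Circle.norm_coe]; norm_num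
  linear_combination (⟪ξ', W (-x) ζ'⟫_ℂ * conj ⟪ξ, W (-x) ζ⟫_ℂ) * this

theorem IsAdmissible.exists_coeffPairing_eq (hW : IsSigmaRepresentation σ W)
    (hirr : IsIrreducibleFamily W) {ζ ζ' : H} (hζ : IsAdmissible μ W ζ)
    (hζ' : IsAdmissible μ W ζ') :
    ∃ c : ℂ, ∀ ξ' ξ, coeffPairing μ W W ζ' ξ' ζ ξ = c * ⟪ξ', ξ⟫_ℂ := by
  obtain ⟨T, hT, hTW⟩ := hζ.exists_intertwiner hW hW hζ'
  obtain ⟨c, hc⟩ := hirr.exists_eq_smul hTW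
  exact ⟨c, fun ξ' ξ => by rw [← hT, hc, inner_smul_right]⟩

theorem coeffPairing_self (ζ ξ : H) :
    coeffPairing μ W W ζ ξ ζ ξ = ((∫ x, ‖⟪ζ, W x ξ⟫_ℂ‖ ^ 2 ∂μ : ℝ) : ℂ) := by
  rw [coeffPairing, ← integral_complex_ofReal]
  refine integral_congr_ae (ae_of_all _ fun x => ?_)
  simp only [Complex.conj_mul']
  push_cast; rfl

/-- The submodule of admissible vectors. -/
def admissibleSubmodule (μ : Measure G) (W : G → (H ≃ₗᵢ[ℂ] H)) : Submodule ℂ H where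
  carrier := {ζ | IsAdmissible μ W ζ}
  add_mem' := fun {ζ ζ'} hζ hζ' ξ => by
    simp only [inner_add_left]
    exact (hζ ξ).add (hζ' ξ)
  zero_mem' := fun ξ => by simp
  smul_mem' := fun c ζ hζ ξ => by
    simp only [inner_smul_left]
    exact (hζ ξ).const_mul _

theorem IsAdmissible.apply (hW : IsSigmaRepresentation σ W) {ζ : H}
    (hζ : IsAdmissible μ W ζ) (a : G) : IsAdmissible μ W (W a ζ) := by
  intro ξ
  refine (hζ ((W a).symm ξ)).of_le (hW.measurable_coeff _ _).aestronglyMeasurable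
    (ae_of_all _ fun x => le_of_eq ?_)
  nth_rewrite 1 [← (W a).apply_symm_apply ξ]
  rw [hW.apply_comm, inner_smul_right, LinearIsometryEquiv.inner_map_map, norm_mul,
    Circle.norm_coe, one_mul]

/-- Admissible vectors form a nonzero invariant subspace, hence a dense one. On it the L² norm of a
coefficient is at most a constant times ‖z‖‖ξ‖, so Fatou's lemma carries square integrability to
limits. -/
theorem IsIrreducibleFamily.isAdmissible [T2Space G] (hirr : IsIrreducibleFamily W)
    (hσ : IsHeisenbergMultiplier σ) (hW : IsSigmaRepresentation σ W) (ζ : H) :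
    IsAdmissible μ W ζ := by
  have := hirr.1
  obtain ⟨ζ₀, hζ₀, hadm₀⟩ := hW.exists_isAdmissible hσ μ
  obtain ⟨c, hc⟩ := hadm₀.exists_coeffPairing_eq hW hirr hadm₀
  have hn0 : ‖ζ₀‖ ≠ 0 := norm_ne_zero_iff.2 hζ₀
  have hbound : ∀ {z : H}, IsAdmissible μ W z → ∀ ξ,
      ∫⁻ x, ‖⟪z, W x ξ⟫_ℂ‖ₑ ^ 2 ∂μ ≤ ENNReal.ofReal (‖c‖ / ‖ζ₀‖ ^ 2 * ‖z‖ ^ 2 * ‖ξ‖ ^ 2) := by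
    intro z hz ξ
    obtain ⟨d, hd⟩ := hz.exists_coeffPairing_eq hW hirr hz
    -- Schur's lemma gives a constant d depending on z; the symmetry of the pairing compares it with
    -- the constant of ζ₀ and shows that it is proportional to ‖z‖².
    have h1 : d * ⟪ζ₀, ζ₀⟫_ℂ = c * ⟪z, z⟫_ℂ := by
      rw [← hd, ← hc, coeffPairing_symm hσ.toIsTwoCocycle hW]
    have h2 : ‖d‖ * ‖ζ₀‖ ^ 2 = ‖c‖ * ‖z‖ ^ 2 := by
      have := congrArg norm h1
      rw [norm_mul, norm_mul, inner_self_eq_norm_sq_to_K, inner_self_eq_norm_sq_to_K, norm_pow,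
        norm_pow] at this
      simpa using this
    have h3 : ∫ x, ‖⟪z, W x ξ⟫_ℂ‖ ^ 2 ∂μ = ‖d‖ * ‖ξ‖ ^ 2 := by
      have h4 := congrArg norm ((coeffPairing_self (μ := μ) (W := W) z ξ).symm.trans (hd ξ ξ))
      rw [norm_mul, inner_self_eq_norm_sq_to_K, norm_pow, Complex.norm_real,
        Real.norm_of_nonneg (integral_nonneg fun _ => sq_nonneg _)] at h4
      simpa using h4
    have h5 : ‖d‖ = ‖c‖ / ‖ζ₀‖ ^ 2 * ‖z‖ ^ 2 := by
      field_simp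
      linarith
    rw [← h5, ← h3, ofReal_integral_eq_lintegral_ofReal ((hz ξ).integrable_norm_pow two_ne_zero)
      (ae_of_all _ fun _ => sq_nonneg _)]
    refine le_of_eq (lintegral_congr fun x => ?_)
    rw [ENNReal.ofReal_pow (norm_nonneg _), ofReal_norm]
  have hdense : (admissibleSubmodule μ W).topologicalClosure = ⊤ := by
    refine (hirr.2 _ (Submodule.isClosed_topologicalClosure _) fun a h hh => ?_).resolve_left ?_
    · have h1 : (admissibleSubmodule μ W).topologicalClosure ≤
          (admissibleSubmodule μ W).topologicalClosure.comap (W a).toLinearEquiv.toLinearMap := by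
        refine Submodule.topologicalClosure_minimal _ (fun z hz => ?_) ?_
        · exact Submodule.le_topologicalClosure _ (IsAdmissible.apply hW hz a)
        · exact (Submodule.isClosed_topologicalClosure _).preimage (W a).continuous
      exact h1 hh
    · intro h0
      have h1 := Submodule.le_topologicalClosure (admissibleSubmodule μ W) hadm₀
      rw [h0] at h1
      exact hζ₀ h1
  have hmem : ζ ∈ closure (admissibleSubmodule μ W : Set H) := by
    rw [← Submodule.topologicalClosure_coe, hdense]; trivial
  obtain ⟨z, hz, hlim⟩ := mem_closure_iff_seq_limit.1 hmem
  intro ξ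
  refine (memLp_two_iff_lintegral (hW.measurable_coeff _ ξ)).2 ?_
  have h1 : ∀ x, ‖⟪ζ, W x ξ⟫_ℂ‖ₑ ^ 2 = liminf (fun n => ‖⟪z n, W x ξ⟫_ℂ‖ₑ ^ 2) atTop := by
    intro x
    refine (Tendsto.liminf_eq ?_).symm
    refine (ENNReal.continuous_pow 2).continuousAt.tendsto.comp ?_
    exact (hlim.inner tendsto_const_nhds).enorm
  simp_rw [h1]
  refine (lintegral_liminf_le fun n => (hW.measurable_coeff _ ξ).enorm.pow_const 2).trans_lt ?_
  refine (liminf_le_liminf (Eventually.of_forall fun n => hbound (hz n) ξ)).trans_lt ?_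
  have h2 : Tendsto (fun n => ENNReal.ofReal (‖c‖ / ‖ζ₀‖ ^ 2 * ‖z n‖ ^ 2 * ‖ξ‖ ^ 2)) atTop
      (𝓝 (ENNReal.ofReal (‖c‖ / ‖ζ₀‖ ^ 2 * ‖ζ‖ ^ 2 * ‖ξ‖ ^ 2))) :=
    (ENNReal.continuous_ofReal.tendsto _).comp
      (((hlim.norm.pow 2).const_mul _).mul_const _)
  rw [h2.liminf_eq]
  exact ENNReal.ofReal_lt_top

/-- The orthogonality relations for an irreducible representation of a Heisenberg multiplier. -/
theorem IsIrreducibleFamily.exists_coeffPairing_eq [T2Space G] (hirr : IsIrreducibleFamily W)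
    (hσ : IsHeisenbergMultiplier σ) (hW : IsSigmaRepresentation σ W) (μ : Measure G)
    [μ.IsAddHaarMeasure] :
    ∃ κ : ℂ, κ ≠ 0 ∧ ∀ ζ' ξ' ζ ξ,
      coeffPairing μ W W ζ' ξ' ζ ξ = κ * ⟪ζ, ζ'⟫_ℂ * ⟪ξ', ξ⟫_ℂ := by
  have hadm := fun ζ => hirr.isAdmissible (μ := μ) hσ hW ζ
  have := hirr.1
  obtain ⟨ζ₀, hζ₀⟩ := exists_ne (0 : H)
  have hn0 : ⟪ζ₀, ζ₀⟫_ℂ ≠ 0 := inner_self_ne_zero.2 hζ₀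
  obtain ⟨c, hc⟩ := (hadm ζ₀).exists_coeffPairing_eq hW hirr (hadm ζ₀)
  have hκ : ∀ ζ' ξ' ζ ξ,
      coeffPairing μ W W ζ' ξ' ζ ξ = c / ⟪ζ₀, ζ₀⟫_ℂ * ⟪ζ, ζ'⟫_ℂ * ⟪ξ', ξ⟫_ℂ := by
    intro ζ' ξ' ζ ξ
    obtain ⟨d, hd⟩ := (hadm ζ).exists_coeffPairing_eq hW hirr (hadm ζ')
    have h1 : d * ⟪ζ₀, ζ₀⟫_ℂ = c * ⟪ζ, ζ'⟫_ℂ := by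
      rw [← hd, ← hc, coeffPairing_symm hσ.toIsTwoCocycle hW]
    rw [hd, div_mul_eq_mul_div, ← h1, mul_div_cancel_right₀ _ hn0]
  refine ⟨_, fun h0 => ?_, hκ⟩
  have : SecondCountableTopology H := UniformSpace.secondCountable_of_separable H
  -- If κ were 0, then for almost every x the coefficient would vanish on a countable dense set of
  -- ξ, hence for all ξ, including W(x)⁻¹ζ₀.
  have h1 : ∀ ξ, ∀ᵐ x ∂μ, ⟪ζ₀, W x ξ⟫_ℂ = 0 := by
    intro ξ
    have h2 := hκ ζ₀ ξ ζ₀ ξ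
    rw [h0, zero_mul, zero_mul, coeffPairing_self, Complex.ofReal_eq_zero,
      integral_eq_zero_iff_of_nonneg (fun _ => sq_nonneg _)
        ((hadm ζ₀ ξ).integrable_norm_pow two_ne_zero)] at h2
    filter_upwards [h2] with x hx
    simpa using hx
  have h2 : ∀ᵐ x ∂μ, ∀ n, ⟪ζ₀, W x (TopologicalSpace.denseSeq H n)⟫_ℂ = 0 :=
    ae_all_iff.2 fun n => h1 _
  have h3 : ∀ᵐ x ∂μ, False := by
    filter_upwards [h2] with x hx
    have h4 : (fun ξ => ⟪ζ₀, W x ξ⟫_ℂ) = fun _ => 0 :=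
      ((innerSL ℂ ζ₀).continuous.comp (W x).continuous).ext_on
        (TopologicalSpace.denseRange_denseSeq H) continuous_const
        (by rintro _ ⟨n, rfl⟩; exact hx n)
    have h5 := congrFun h4 ((W x).symm ζ₀)
    simp only [LinearIsometryEquiv.apply_symm_apply] at h5
    exact hn0 h5
  rw [eventually_false_iff_eq_bot, ae_eq_bot] at h3
  exact (NeZero.ne μ) h3

end Moyal

/-! ### The Stone–von Neumann theorem and gaussian unitaries -/

section StoneVonNeumann

variable {G : Type u} [AddCommGroup G] [TopologicalSpace G] [IsTopologicalAddGroup G]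
  [LocallyCompactSpace G] [SecondCountableTopology G] [MeasurableSpace G] [BorelSpace G]
  {H : Type v} [NormedAddCommGroup H] [InnerProductSpace ℂ H] [CompleteSpace H]
  [TopologicalSpace.SeparableSpace H] [MeasurableSpace H] [BorelSpace H]
  {H' : Type*} [NormedAddCommGroup H'] [InnerProductSpace ℂ H'] [CompleteSpace H']
  [TopologicalSpace.SeparableSpace H'] [MeasurableSpace H'] [BorelSpace H']
  {σ : G → G → Circle} {W : G → (H ≃ₗᵢ[ℂ] H)} {W' : G → (H' ≃ₗᵢ[ℂ] H')}

/-- Some average of two irreducible representations does not vanish. -/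
theorem IsIrreducibleFamily.exists_coeffPairing_ne_zero [T2Space G] (hσ : IsHeisenbergMultiplier σ)
    (hW : IsSigmaRepresentation σ W) (hirr : IsIrreducibleFamily W)
    (hW' : IsSigmaRepresentation σ W') (hirr' : IsIrreducibleFamily W')
    (μ : Measure G) [μ.IsAddHaarMeasure] :
    ∃ ζ' ξ' ζ ξ, coeffPairing μ W' W ζ' ξ' ζ ξ ≠ 0 := by
  by_contra! hcon
  have hb := hσ.isSelfDualPairing
  have := hirr.1
  have := hirr'.1
  obtain ⟨ζ, hζ⟩ := exists_ne (0 : H)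
  obtain ⟨ζ', hζ'⟩ := exists_ne (0 : H')
  have hadm := hirr.isAdmissible (μ := μ) hσ hW
  have hadm' := hirr'.isAdmissible (μ := μ) hσ hW'
  have h1 : ∀ ξ' ξ, (fun x => conj ⟪ζ', W' x ξ'⟫_ℂ * ⟪ζ, W x ξ⟫_ℂ) =ᵐ[μ] 0 := by
    intro ξ' ξ
    refine hb.ae_eq_zero_of_forall ((hadm ζ).integrable_mul (hadm' ζ') ξ' ξ) fun y => ?_
    -- Replacing ζ, ξ by W(y)ζ, W(y)ξ multiplies the integrand by b(x,y), so vanishing of all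
    -- averages is vanishing of a Fourier transform.
    rw [← hcon ζ' ξ' (W y ζ) (W y ξ), coeffPairing]
    refine integral_congr_ae (ae_of_all _ fun x => ?_)
    simp only [hW.apply_comm x y, inner_smul_right, LinearIsometryEquiv.inner_map_map]
    ring
  have h2 : ∀ᵐ x ∂μ, ∀ m n, conj ⟪ζ', W' x (TopologicalSpace.denseSeq H' m)⟫_ℂ *
      ⟪ζ, W x (TopologicalSpace.denseSeq H n)⟫_ℂ = 0 :=
    ae_all_iff.2 fun m => ae_all_iff.2 fun n => h1 _ _
  have h3 : ∀ᵐ x ∂μ, False := by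
    filter_upwards [h2] with x hx
    have h4 : (fun p : H' × H => conj ⟪ζ', W' x p.1⟫_ℂ * ⟪ζ, W x p.2⟫_ℂ) = fun _ => 0 := by
      refine Continuous.ext_on ((TopologicalSpace.denseRange_denseSeq H').prodMap
        (TopologicalSpace.denseRange_denseSeq H)) ?_ continuous_const ?_
      · exact (Complex.continuous_conj.comp ((innerSL ℂ ζ').continuous.comp
          ((W' x).continuous.comp continuous_fst))).mul ((innerSL ℂ ζ).continuous.comp
          ((W x).continuous.comp continuous_snd))
      · rintro _ ⟨⟨m, n⟩, rfl⟩
        exact hx m n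
    have h5 := congrFun h4 ((W' x).symm ζ', (W x).symm ζ)
    simp only [LinearIsometryEquiv.apply_symm_apply] at h5
    rcases mul_eq_zero.1 h5 with h6 | h6
    · exact hζ' (inner_self_eq_zero.1 ((map_eq_zero _).1 h6))
    · exact hζ (inner_self_eq_zero.1 h6)
  rw [eventually_false_iff_eq_bot, ae_eq_bot] at h3
  exact (NeZero.ne μ) h3

/-- The Stone–von Neumann theorem. -/
theorem IsIrreducibleFamily.exists_unitary [T2Space G] (hσ : IsHeisenbergMultiplier σ)
    (hW : IsSigmaRepresentation σ W) (hirr : IsIrreducibleFamily W)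
    (hW' : IsSigmaRepresentation σ W') (hirr' : IsIrreducibleFamily W') :
    ∃ U : H ≃ₗᵢ[ℂ] H', ∀ x h, U (W x h) = W' x (U h) := by
  obtain ⟨ζ', ξ', ζ, ξ, h0⟩ :=
    hirr.exists_coeffPairing_ne_zero hσ hW hW' hirr' Measure.addHaar
  obtain ⟨T, hT, hTW⟩ := (hirr.isAdmissible hσ hW ζ).exists_intertwiner hW hW'
    (hirr'.isAdmissible (μ := Measure.addHaar) hσ hW' ζ')
  refine hirr.exists_unitary_of_intertwiner hirr' (T := T) ?_ hTW
  rintro rfl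
  rw [← hT] at h0
  simp at h0

/-- The composition of a representation with a symplectic automorphism. -/
theorem IsSigmaRepresentation.comp_symplectic (hW : IsSigmaRepresentation σ W)
    (S : symplecticGroup σ) : IsSigmaRepresentation σ fun x => W (S.1 x) where
  borel h := (hW.borel h).comp S.1.continuous.measurable
  mul x y := by rw [hW.mul, S.2, map_add]

theorem IsIrreducibleFamily.comp_surjective (hirr : IsIrreducibleFamily W) {S : G → G}
    (hS : Function.Surjective S) : IsIrreducibleFamily fun x => W (S x) :=
  ⟨hirr.1, fun K hK hinv => hirr.2 K hK fun x h hh => by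
    obtain ⟨y, rfl⟩ := hS x
    exact hinv y h hh⟩

theorem IsIrreducibleFamily.exists_isGaussianUnitary (hσ : IsHeisenbergMultiplier σ)
    (hW : IsSigmaRepresentation σ W) (hirr : IsIrreducibleFamily W) (S : symplecticGroup σ) :
    ∃ V : H ≃ₗᵢ[ℂ] H, IsGaussianUnitary W S.1 V := by
  have := hσ.isSelfDualPairing.t2Space
  obtain ⟨U, hU⟩ := hirr.exists_unitary hσ hW (hW.comp_symplectic S)
    (hirr.comp_surjective S.1.surjective)
  refine ⟨U, fun x => ?_⟩
  rw [mul_inv_eq_iff_eq_mul]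
  exact LinearIsometryEquiv.ext (hU x)

end StoneVonNeumann

/-! ### Approximation of rank one operators and invariance of Haar measure -/

section RankOne

theorem norm_integral_mul_le {X : Type*} [MeasurableSpace X] {μ : Measure X} {f g : X → ℂ}
    (hf : MemLp f 2 μ) (hg : MemLp g 2 μ) :
    ‖∫ x, f x * g x ∂μ‖ ≤ (eLpNorm f 2 μ).toReal * (eLpNorm g 2 μ).toReal := by
  have h : ∫ x, f x * g x ∂μ = ⟪hf.star.toLp _, hg.toLp _⟫_ℂ := by
    rw [L2.inner_def]
    refine integral_congr_ae ?_
    filter_upwards [hf.star.coeFn_toLp, hg.coeFn_toLp] with x h1 h2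
    rw [h1, h2, RCLike.inner_apply']
    simp
  rw [h]
  refine (norm_inner_le_norm _ _).trans_eq ?_
  rw [Lp.norm_toLp, Lp.norm_toLp]
  congr 2
  exact eLpNorm_congr_norm_ae (ae_of_all _ fun x => by simp)

theorem sq_toReal_eLpNorm_two {X : Type*} [MeasurableSpace X] {μ : Measure X} {f : X → ℂ}
    (hf : MemLp f 2 μ) : (eLpNorm f 2 μ).toReal ^ 2 = ∫ x, ‖f x‖ ^ 2 ∂μ := by
  have h : ((∫ x, ‖f x‖ ^ 2 ∂μ : ℝ) : ℂ) = ⟪hf.toLp _, hf.toLp _⟫_ℂ := by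
    rw [L2.inner_def, ← integral_complex_ofReal]
    refine integral_congr_ae ?_
    filter_upwards [hf.coeFn_toLp] with x h1
    rw [h1, RCLike.inner_apply', RCLike.conj_mul]
    push_cast; rfl
  rw [inner_self_eq_norm_sq_to_K, Lp.norm_toLp] at h
  exact (Complex.ofReal_injective (h.trans (by push_cast; rfl))).symm

variable {G : Type u} [AddCommGroup G] [TopologicalSpace G] [IsTopologicalAddGroup G]
  [LocallyCompactSpace G] [SecondCountableTopology G] [MeasurableSpace G] [BorelSpace G]
  {H : Type v} [NormedAddCommGroup H] [InnerProductSpace ℂ H] [CompleteSpace H]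
  [TopologicalSpace.SeparableSpace H] [MeasurableSpace H] [BorelSpace H]
  {σ : G → G → Circle} {W : G → (H ≃ₗᵢ[ℂ] H)}

/-- Rank one operators are approximated by operators `∫ f(x) W(x) dx`. -/
theorem IsIrreducibleFamily.exists_approx_rankOne [T2Space G] (hirr : IsIrreducibleFamily W)
    (hσ : IsHeisenbergMultiplier σ) (hW : IsSigmaRepresentation σ W) (μ : Measure G)
    [μ.IsAddHaarMeasure] (h k : H) {ε : ℝ} (hε : 0 < ε) :
    ∃ f : G → ℂ, Continuous f ∧ HasCompactSupport f ∧ ∀ ζ ξ,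
      ‖∫ x, f x * ⟪ζ, W x ξ⟫_ℂ ∂μ - ⟪ζ, h⟫_ℂ * ⟪k, ξ⟫_ℂ‖ ≤ ε * ‖ζ‖ * ‖ξ‖ := by
  obtain ⟨κ, hκ0, hκ⟩ := hirr.exists_coeffPairing_eq hσ hW μ
  have hadm := fun ζ => hirr.isAdmissible (μ := μ) hσ hW ζ
  -- By the orthogonality relations this `g` is the exact symbol of the rank one operator.
  -- Coefficients have L² norm √‖κ‖‖ζ‖‖ξ‖, so an L² error of ε/√‖κ‖ in the symbol costs ε‖ζ‖‖ξ‖.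
  let g : G → ℂ := fun x => κ⁻¹ * conj ⟪h, W x k⟫_ℂ
  have hg : MemLp g 2 μ := (hadm h k).star.const_mul κ⁻¹
  have hs : 0 < √‖κ‖ := Real.sqrt_pos.2 (norm_pos_iff.2 hκ0)
  have hδ : 0 < ε / √‖κ‖ := div_pos hε hs
  obtain ⟨f, hfc, hfg, hf, hf2⟩ := hg.exists_hasCompactSupport_eLpNorm_sub_le (by simp)
    (ε := ENNReal.ofReal (ε / √‖κ‖)) (by simpa using hδ)
  refine ⟨f, hf, hfc, fun ζ ξ => ?_⟩
  have h1 : ∫ x, g x * ⟪ζ, W x ξ⟫_ℂ ∂μ = ⟪ζ, h⟫_ℂ * ⟪k, ξ⟫_ℂ := by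
    simp only [g, mul_assoc]
    rw [integral_const_mul]
    change κ⁻¹ * coeffPairing μ W W h k ζ ξ = _
    rw [hκ]
    field_simp
  have h2 : (eLpNorm (fun x => ⟪ζ, W x ξ⟫_ℂ) 2 μ).toReal = √‖κ‖ * ‖ζ‖ * ‖ξ‖ := by
    rw [← sq_eq_sq₀ ENNReal.toReal_nonneg (by positivity), sq_toReal_eLpNorm_two (hadm ζ ξ),
      mul_pow, mul_pow, Real.sq_sqrt (norm_nonneg _)]
    have h4 := congrArg norm ((coeffPairing_self (μ := μ) (W := W) ζ ξ).symm.trans (hκ ζ ξ ζ ξ))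
    rw [norm_mul, norm_mul, inner_self_eq_norm_sq_to_K, inner_self_eq_norm_sq_to_K, norm_pow,
      norm_pow, Complex.norm_real,
      Real.norm_of_nonneg (integral_nonneg fun _ => sq_nonneg _)] at h4
    simpa using h4
  have h4 : ∫ x, (g - f) x * ⟪ζ, W x ξ⟫_ℂ ∂μ =
      ∫ x, g x * ⟪ζ, W x ξ⟫_ℂ ∂μ - ∫ x, f x * ⟪ζ, W x ξ⟫_ℂ ∂μ := by
    simp_rw [Pi.sub_apply, sub_mul]
    exact integral_sub (hg.integrable_mul (hadm ζ ξ)) (hf2.integrable_mul (hadm ζ ξ))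
  rw [← h1, ← norm_neg, neg_sub, ← h4]
  refine (norm_integral_mul_le (hg.sub hf2) (hadm ζ ξ)).trans ?_
  rw [h2]
  have h3 : (eLpNorm (g - f) 2 μ).toReal ≤ ε / √‖κ‖ := ENNReal.toReal_le_of_le_ofReal hδ.le hfg
  calc _ ≤ ε / √‖κ‖ * (√‖κ‖ * ‖ζ‖ * ‖ξ‖) := by gcongr
    _ = ε * ‖ζ‖ * ‖ξ‖ := by field_simp

/-- Symplectic automorphisms preserve Haar measure. -/
theorem IsIrreducibleFamily.measurePreserving [T2Space G] (hirr : IsIrreducibleFamily W)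
    (hσ : IsHeisenbergMultiplier σ) (hW : IsSigmaRepresentation σ W) (μ : Measure G)
    [μ.IsAddHaarMeasure] (S : symplecticGroup σ) : MeasurePreserving S.1 μ μ := by
  have hm : Measurable S.1 := S.1.continuous.measurable
  refine ⟨hm, ?_⟩
  obtain ⟨V, hV⟩ := hirr.exists_isGaussianUnitary hσ hW S
  obtain ⟨κ, hκ0, hκ⟩ := hirr.exists_coeffPairing_eq hσ hW μ
  have := hirr.1
  obtain ⟨ζ, hζ⟩ := exists_ne (0 : H)
  have hI : coeffPairing μ W W ζ ζ ζ ζ ≠ 0 := by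
    rw [hκ]
    exact mul_ne_zero (mul_ne_zero hκ0 (inner_self_ne_zero.2 hζ)) (inner_self_ne_zero.2 hζ)
  -- The image measure is a multiple of μ. Transport by S replaces ζ by V⁻¹ζ, and the orthogonality
  -- relations see only the norm, so this nonzero integral is unchanged and the multiple is 1.
  have h1 : coeffPairing (μ.map S.1) W W ζ ζ ζ ζ = coeffPairing μ W W ζ ζ ζ ζ := by
    have h2 : ∀ x, ⟪ζ, W (S.1 x) ζ⟫_ℂ = ⟪V.symm ζ, W x (V.symm ζ)⟫_ℂ := by
      intro x
      rw [← hV x, ← LinearIsometryEquiv.inner_map_map V (V.symm ζ),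
        LinearIsometryEquiv.apply_symm_apply]
      rfl
    rw [coeffPairing, integral_map hm.aemeasurable]
    · simp_rw [h2]
      change coeffPairing μ W W (V.symm ζ) (V.symm ζ) (V.symm ζ) (V.symm ζ) = _
      rw [hκ, hκ, LinearIsometryEquiv.inner_map_map]
    · exact ((Complex.continuous_conj.measurable.comp (hW.measurable_coeff _ _)).mul
        (hW.measurable_coeff _ _)).aestronglyMeasurable
  have := S.1.isAddHaarMeasure_map μ
  have h3 := Measure.isAddLeftInvariant_eq_smul (μ.map S.1) μ
  rw [h3, coeffPairing, integral_smul_nnreal_measure] at h1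
  change _ • coeffPairing μ W W ζ ζ ζ ζ = _ at h1
  rw [NNReal.smul_def, Complex.real_smul, mul_eq_right₀ hI, Complex.ofReal_eq_one] at h1
  rw [h3, NNReal.coe_eq_one.1 h1, one_smul]

end RankOne

/-! ### The strong operator topology -/

section StrongTopology

variable {H : Type v} [NormedAddCommGroup H] [InnerProductSpace ℂ H]
  {X : Type*} [TopologicalSpace X]

theorem continuous_unitary_iff {f : X → (H ≃ₗᵢ[ℂ] H)} :
    Continuous f ↔ ∀ h, Continuous fun x => f x h := by
  rw [continuous_induced_rng, continuous_pi_iff]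
  rfl

/-- Unitaries are isometries, so varying the vector costs exactly its displacement, uniformly in the
operator. -/
theorem Continuous.unitary_apply {f : X → (H ≃ₗᵢ[ℂ] H)} {g : X → H} (hf : Continuous f)
    (hg : Continuous g) : Continuous fun x => f x (g x) := by
  rw [continuous_iff_continuousAt]
  intro x₀
  have h1 := ((continuous_unitary_iff.1 hf (g x₀)).tendsto x₀)
  have h2 : Tendsto (fun x => f x (g x) - f x (g x₀)) (𝓝 x₀) (𝓝 0) := by
    rw [tendsto_zero_iff_norm_tendsto_zero]
    have h3 : Tendsto (fun x => ‖g x - g x₀‖) (𝓝 x₀) (𝓝 0) := by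
      simpa using ((hg.tendsto x₀).sub_const (g x₀)).norm
    refine h3.congr fun x => ?_
    rw [← map_sub, LinearIsometryEquiv.norm_map]
  have h3 := h2.add h1
  simp only [sub_add_cancel, zero_add] at h3
  exact h3

instance unitary_isTopologicalGroup : IsTopologicalGroup (H ≃ₗᵢ[ℂ] H) where
  continuous_mul := continuous_unitary_iff.2 fun _ =>
    continuous_fst.unitary_apply (continuous_snd.unitary_apply continuous_const)
  continuous_inv := by
    refine continuous_unitary_iff.2 fun h => continuous_iff_continuousAt.2 fun U₀ => ?_
    have h1 : Continuous fun U : H ≃ₗᵢ[ℂ] H => U (U₀⁻¹ h) :=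
      continuous_id.unitary_apply continuous_const
    -- Applying U to U⁻¹h - U₀⁻¹h preserves the norm and removes the inverse of U.
    have h2 : Tendsto (fun U : H ≃ₗᵢ[ℂ] H => ‖h - U (U₀⁻¹ h)‖) (𝓝 U₀) (𝓝 0) := by
      have h3 := (tendsto_const_nhds (x := h)).sub (h1.tendsto U₀)
      have h4 : U₀ (U₀⁻¹ h) = h := U₀.apply_symm_apply h
      simpa [h4] using h3.norm
    refine tendsto_iff_norm_sub_tendsto_zero.2 (h2.congr fun U => ?_)
    rw [← LinearIsometryEquiv.norm_map U (U⁻¹ h - U₀⁻¹ h), map_sub]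
    congr 2
    exact (U.apply_symm_apply h).symm

end StrongTopology

/-! ### Topological semidirect products -/

section SemidirectProduct

variable {N : Type u} {K : Type v} [Group N] [Group K] [TopologicalSpace N] [TopologicalSpace K]
  {φ : K →* MulAut N} {X : Type*} [TopologicalSpace X]

theorem continuous_semidirectProduct_iff {f : X → N ⋊[φ] K} :
    Continuous f ↔ Continuous (fun x => (f x).left) ∧ Continuous fun x => (f x).right := by
  rw [continuous_induced_rng]
  exact continuous_prodMk

theorem SemidirectProduct.continuous_left : Continuous fun p : N ⋊[φ] K => p.left :=
  (continuous_semidirectProduct_iff.1 continuous_id).1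

theorem SemidirectProduct.continuous_right : Continuous fun p : N ⋊[φ] K => p.right :=
  (continuous_semidirectProduct_iff.1 continuous_id).2

theorem SemidirectProduct.isTopologicalGroup [IsTopologicalGroup N] [IsTopologicalGroup K]
    (h : Continuous fun p : K × N => φ p.1 p.2) : IsTopologicalGroup (N ⋊[φ] K) where
  continuous_mul := by
    have hl := SemidirectProduct.continuous_left (φ := φ)
    have hr := SemidirectProduct.continuous_right (φ := φ)
    refine continuous_semidirectProduct_iff.2 ⟨?_, ?_⟩
    · exact (hl.comp continuous_fst).mul
        (h.comp ((hr.comp continuous_fst).prodMk (hl.comp continuous_snd)))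
    · exact (hr.comp continuous_fst).mul (hr.comp continuous_snd)
  continuous_inv := by
    have hl := SemidirectProduct.continuous_left (φ := φ)
    have hr := SemidirectProduct.continuous_right (φ := φ)
    refine continuous_semidirectProduct_iff.2 ⟨?_, hr.inv⟩
    exact h.comp (hr.inv.prodMk hl.inv)

end SemidirectProduct

/-! ### Topological automorphism groups -/

section Automorphisms

variable {G : Type u} [AddCommGroup G] [TopologicalSpace G] {X : Type*} [TopologicalSpace X]

theorem continuous_topologicalAut_iff {f : X → (G ≃ₜ+ G)} :
    Continuous f ↔ Continuous (fun x => (⟨f x, (f x).continuous⟩ : C(G, G))) ∧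
      Continuous fun x => (⟨(f x).symm, (f x).symm.continuous⟩ : C(G, G)) := by
  rw [continuous_induced_rng]
  exact continuous_prodMk

theorem continuous_topologicalAut_toContinuousMap :
    Continuous fun S : G ≃ₜ+ G => (⟨S, S.continuous⟩ : C(G, G)) :=
  (continuous_topologicalAut_iff.1 continuous_id).1

theorem continuous_topologicalAut_symm_toContinuousMap :
    Continuous fun S : G ≃ₜ+ G => (⟨S.symm, S.symm.continuous⟩ : C(G, G)) :=
  (continuous_topologicalAut_iff.1 continuous_id).2

instance topologicalAut_isTopologicalGroup [LocallyCompactSpace G] :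
    IsTopologicalGroup (G ≃ₜ+ G) where
  continuous_mul := by
    refine continuous_topologicalAut_iff.2 ⟨?_, ?_⟩
    · exact (continuous_topologicalAut_toContinuousMap.comp continuous_fst).compCM
        (continuous_topologicalAut_toContinuousMap.comp continuous_snd)
    · exact (continuous_topologicalAut_symm_toContinuousMap.comp continuous_snd).compCM
        (continuous_topologicalAut_symm_toContinuousMap.comp continuous_fst)
  continuous_inv := continuous_topologicalAut_iff.2
    ⟨continuous_topologicalAut_symm_toContinuousMap, continuous_topologicalAut_toContinuousMap⟩

theorem continuous_topologicalAut_apply [LocallyCompactSpace G] :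
    Continuous fun p : (G ≃ₜ+ G) × G => p.1 p.2 :=
  (continuous_eval (F := C(G, G))).comp
    ((continuous_topologicalAut_toContinuousMap.comp continuous_fst).prodMk continuous_snd)

theorem continuous_symplectic_apply [LocallyCompactSpace G] {σ : G → G → Circle} :
    Continuous fun p : symplecticGroup σ × G => p.1.1 p.2 :=
  continuous_topologicalAut_apply.comp
    ((continuous_subtype_val.comp continuous_fst).prodMk continuous_snd)

/-- A continuous family of continuous endomaps of `G`, with continuous family of inverses, defines
a continuous family of automorphisms. -/
theorem continuous_topologicalAut_of_continuous_uncurry {f : X → (G ≃ₜ+ G)}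
    (h1 : Continuous fun p : X × G => f p.1 p.2)
    (h2 : Continuous fun p : X × G => (f p.1).symm p.2) : Continuous f :=
  continuous_topologicalAut_iff.2 ⟨ContinuousMap.continuous_of_continuous_uncurry _ h1,
    ContinuousMap.continuous_of_continuous_uncurry _ h2⟩

instance symplecticSemidirect_isTopologicalGroup [LocallyCompactSpace G] [IsTopologicalAddGroup G]
    {σ : G → G → Circle} : IsTopologicalGroup (SymplecticSemidirect σ) :=
  SemidirectProduct.isTopologicalGroup (by
    exact continuous_ofAdd.comp ((continuous_symplectic_apply (G := G) (σ := σ)).comp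
      (continuous_fst.prodMk (continuous_toAdd.comp continuous_snd))))

end Automorphisms

/-! ### Implementers of automorphisms near the identity -/

section Implementers

variable {G : Type u} [AddCommGroup G] [TopologicalSpace G] [IsTopologicalAddGroup G]
  [LocallyCompactSpace G] [SecondCountableTopology G] [MeasurableSpace G] [BorelSpace G]
  {H : Type v} [NormedAddCommGroup H] [InnerProductSpace ℂ H] [CompleteSpace H]
  [TopologicalSpace.SeparableSpace H] [MeasurableSpace H] [BorelSpace H]
  {σ : G → G → Circle} {W : G → (H ≃ₗᵢ[ℂ] H)}

/-- `U` implements the automorphism of the Weyl system determined by `(y, S)`. -/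
def IsImplementer (σ : G → G → Circle) (W : G → (H ≃ₗᵢ[ℂ] H)) (p : G × symplecticGroup σ)
    (U : H ≃ₗᵢ[ℂ] H) : Prop :=
  ∀ x, U * W x = phase H (commutationPairing σ p.1 (p.2.1 x)) * W (p.2.1 x) * U

theorem IsGaussianUnitary.isImplementer (hW : IsSigmaRepresentation σ W) {S : symplecticGroup σ}
    {V : H ≃ₗᵢ[ℂ] H} (hV : IsGaussianUnitary W S.1 V) (y : G) :
    IsImplementer σ W (y, S) (W y * V) := by
  intro x
  have h1 : V * W x = W (S.1 x) * V := mul_inv_eq_iff_eq_mul.1 (hV x)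
  rw [mul_assoc, h1, ← mul_assoc, hW.comm]
  simp only [mul_assoc]

/-- The symbol of `∫ f(x) W(x) dx` transported by `(y, S)`. -/
def transportedSymbol (σ : G → G → Circle) (f : G → ℂ) (p : G × symplecticGroup σ) (x : G) : ℂ :=
  f (p.2.1 x) * conj (commutationPairing σ p.1 (p.2.1 x) : ℂ)

theorem continuous_transportedSymbol (hσ : IsHeisenbergMultiplier σ) {f : G → ℂ}
    (hf : Continuous f) : Continuous (transportedSymbol σ f).uncurry := by
  have h1 : Continuous fun q : (G × symplecticGroup σ) × G => q.1.2.1 q.2 :=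
    continuous_symplectic_apply.comp
      ((continuous_snd.comp continuous_fst).prodMk continuous_snd)
  have h2 : Continuous fun q : (G × symplecticGroup σ) × G =>
      commutationPairing σ q.1.1 (q.1.2.1 q.2) :=
    hσ.isSelfDualPairing.continuous_uncurry.comp ((continuous_fst.comp continuous_fst).prodMk h1)
  exact (hf.comp h1).mul (Complex.continuous_conj.comp (continuous_subtype_val.comp h2))

theorem transportedSymbol_zero_one (hσ : IsHeisenbergMultiplier σ) (f : G → ℂ) :
    transportedSymbol σ f (0, 1) = f := by
  ext x
  rw [transportedSymbol, hσ.isSelfDualPairing.zero_left]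
  change f x * _ = _
  simp

theorem tendsto_integral_transportedSymbol (hσ : IsHeisenbergMultiplier σ) (μ : Measure G)
    [μ.IsAddHaarMeasure] {f : G → ℂ} (hf : Continuous f) (hfc : HasCompactSupport f) :
    Tendsto (fun p => ∫ x, ‖transportedSymbol σ f p x - f x‖ ∂μ) (𝓝 (0, 1)) (𝓝 0) := by
  obtain ⟨L, hL, hKL⟩ := exists_compact_superset hfc
  -- Near the identity S⁻¹ maps the support of f into a fixed compact set, so the transported
  -- symbols have a common compact support. This uses the compact-open topology on inverses.
  have hs : {p : G × symplecticGroup σ | Set.MapsTo p.2.1.symm (tsupport f) (interior L)} ∈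
      𝓝 ((0, 1) : G × symplecticGroup σ) := by
    have h1 : Continuous fun p : G × symplecticGroup σ =>
        (⟨p.2.1.symm, p.2.1.symm.continuous⟩ : C(G, G)) :=
      continuous_topologicalAut_symm_toContinuousMap.comp
        (continuous_subtype_val.comp continuous_snd)
    exact ((ContinuousMap.isOpen_setOfPred_mapsTo hfc isOpen_interior).preimage h1).mem_nhds
      fun x hx => hKL hx
  have h := tendsto_integral_norm_sub (μ := μ) hs hL (continuous_transportedSymbol hσ hf) ?_
  · rwa [transportedSymbol_zero_one hσ] at h
  · intro p hp x hx
    rw [transportedSymbol, mul_eq_zero]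
    left
    by_contra h0
    refine hx (interior_subset ?_)
    have h1 := hp (subset_tsupport _ h0)
    rwa [ContinuousAddEquiv.symm_apply_apply] at h1

theorem integrable_transportedSymbol [T2Space G] (hσ : IsHeisenbergMultiplier σ) (μ : Measure G)
    [μ.IsAddHaarMeasure] {f : G → ℂ} (hf : Continuous f) (hfc : HasCompactSupport f)
    (p : G × symplecticGroup σ) : Integrable (transportedSymbol σ f p) μ := by
  refine Continuous.integrable_of_hasCompactSupport
    ((continuous_transportedSymbol hσ hf).comp (continuous_const.prodMk continuous_id)) ?_
  exact (hfc.comp_homeomorph p.2.1.toHomeomorph).mul_right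

theorem IsImplementer.inner_apply {p : G × symplecticGroup σ} {U : H ≃ₗᵢ[ℂ] H}
    (hU : IsImplementer σ W p U) (ζ ξ : H) (x : G) :
    ⟪U ζ, W (p.2.1 x) (U ξ)⟫_ℂ =
      conj (commutationPairing σ p.1 (p.2.1 x) : ℂ) * ⟪ζ, W x ξ⟫_ℂ := by
  have h1 : U (W x ξ) = (commutationPairing σ p.1 (p.2.1 x) : ℂ) • W (p.2.1 x) (U ξ) :=
    congrArg (fun A : H ≃ₗᵢ[ℂ] H => A ξ) (hU x)
  rw [← U.inner_map_map ζ (W x ξ), h1, inner_smul_right, ← mul_assoc, Complex.conj_mul',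
    Circle.norm_coe]
  simp

/-- In operator form, U⁻¹W(f)U = W(f') for the transported symbol f'. The change of variables by S
is free because S preserves Haar measure. -/
theorem IsImplementer.integral_eq [T2Space G] (hirr : IsIrreducibleFamily W)
    (hσ : IsHeisenbergMultiplier σ) (hW : IsSigmaRepresentation σ W) (μ : Measure G)
    [μ.IsAddHaarMeasure] {p : G × symplecticGroup σ} {U : H ≃ₗᵢ[ℂ] H}
    (hU : IsImplementer σ W p U) (f : G → ℂ) (ζ ξ : H) :
    ∫ x, f x * ⟪U ζ, W x (U ξ)⟫_ℂ ∂μ = ∫ x, transportedSymbol σ f p x * ⟪ζ, W x ξ⟫_ℂ ∂μ := by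
  rw [← (hirr.measurePreserving hσ hW μ p.2).integral_comp
    p.2.1.toHomeomorph.measurableEmbedding]
  refine integral_congr_ae (ae_of_all _ fun x => ?_)
  simp only [hU.inner_apply, transportedSymbol, mul_assoc]

theorem IsImplementer.norm_integral_sub_le [T2Space G] (hirr : IsIrreducibleFamily W)
    (hσ : IsHeisenbergMultiplier σ) (hW : IsSigmaRepresentation σ W) (μ : Measure G)
    [μ.IsAddHaarMeasure] {p : G × symplecticGroup σ} {U : H ≃ₗᵢ[ℂ] H}
    (hU : IsImplementer σ W p U) {f : G → ℂ} (hf : Continuous f) (hfc : HasCompactSupport f)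
    (ζ ξ : H) :
    ‖∫ x, f x * ⟪U ζ, W x (U ξ)⟫_ℂ ∂μ - ∫ x, f x * ⟪ζ, W x ξ⟫_ℂ ∂μ‖ ≤
      (∫ x, ‖transportedSymbol σ f p x - f x‖ ∂μ) * (‖ζ‖ * ‖ξ‖) := by
  have hb : ∀ x, ‖⟪ζ, W x ξ⟫_ℂ‖ ≤ ‖ζ‖ * ‖ξ‖ := fun x =>
    (norm_inner_le_norm _ _).trans_eq (by rw [LinearIsometryEquiv.norm_map])
  have hm := (hW.measurable_coeff ζ ξ).aestronglyMeasurable (μ := μ)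
  have h1 := integrable_transportedSymbol hσ μ hf hfc p
  have h2 : Integrable f μ := hf.integrable_of_hasCompactSupport hfc
  rw [hU.integral_eq hirr hσ hW μ, ← integral_sub (h1.mul_bdd hm (ae_of_all _ hb))
    (h2.mul_bdd hm (ae_of_all _ hb)), ← integral_mul_const]
  refine norm_integral_le_of_norm_le ((h1.sub h2).norm.mul_const _) (ae_of_all _ fun x => ?_)
  rw [← sub_mul, norm_mul]
  exact mul_le_mul_of_nonneg_left (hb x) (norm_nonneg _)

/-- The filter of implementers of automorphisms close to the identity. -/
def implementerFilter (σ : G → G → Circle) (W : G → (H ≃ₗᵢ[ℂ] H)) :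
    Filter ((G × symplecticGroup σ) × (H ≃ₗᵢ[ℂ] H)) :=
  comap Prod.fst (𝓝 (0, 1)) ⊓ 𝓟 {q | IsImplementer σ W q.1 q.2}

/-- Let A be the rank one operator v ↦ ⟪ξ,v⟫h. Then U⁻¹AU - A tends to 0 in norm, and its value at ξ
is ⟪ξ,Uξ⟫U⁻¹h - h. The filter runs over all implementers, so no choice of U enters. -/
theorem tendsto_inner_smul_symm [T2Space G] (hirr : IsIrreducibleFamily W)
    (hσ : IsHeisenbergMultiplier σ) (hW : IsSigmaRepresentation σ W) {ξ : H} (hξ : ‖ξ‖ = 1)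
    (h : H) :
    Tendsto (fun q : (G × symplecticGroup σ) × (H ≃ₗᵢ[ℂ] H) =>
      ‖⟪ξ, q.2 ξ⟫_ℂ • q.2.symm h - h‖) (implementerFilter σ W) (𝓝 0) := by
  let μ : Measure G := Measure.addHaar
  rw [Metric.tendsto_nhds]
  intro ε hε
  -- Three errors of ε/4 occur: approximating A before conjugation, approximating it after, and
  -- moving the symbol. Their sum stays strictly below ε.
  obtain ⟨f, hf, hfc, hfε⟩ := hirr.exists_approx_rankOne hσ hW μ h ξ (ε := ε / 4) (by positivity)
  have hI := (tendsto_integral_transportedSymbol hσ μ hf hfc).eventually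
    (gt_mem_nhds (show 0 < ε / 4 by positivity))
  filter_upwards [mem_inf_of_left (hI.comap Prod.fst), mem_inf_of_right (mem_principal_self _)]
    with ⟨p, U⟩ hp (hU : IsImplementer σ W p U)
  replace hp : ∫ x, ‖transportedSymbol σ f p x - f x‖ ∂μ < ε / 4 := hp
  rw [Real.dist_0_eq_abs, abs_norm]
  change ‖⟪ξ, U ξ⟫_ℂ • U.symm h - h‖ < ε
  have hbound : ∀ ζ, ‖⟪ζ, ⟪ξ, U ξ⟫_ℂ • U.symm h - h⟫_ℂ‖ ≤ 3 * (ε / 4) * ‖ζ‖ := by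
    intro ζ
    have h1 : ⟪ζ, ⟪ξ, U ξ⟫_ℂ • U.symm h - h⟫_ℂ =
        ⟪U ζ, h⟫_ℂ * ⟪ξ, U ξ⟫_ℂ - ⟪ζ, h⟫_ℂ * ⟪ξ, ξ⟫_ℂ := by
      rw [inner_sub_right, inner_smul_right, ← U.inner_map_map ζ (U.symm h), U.apply_symm_apply,
        inner_self_eq_norm_sq_to_K, hξ]
      simp [mul_comm]
    have h2 := hfε (U ζ) (U ξ)
    have h3 := hfε ζ ξ
    have h4 := hU.norm_integral_sub_le hirr hσ hW μ hf hfc ζ ξ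
    have h5 := mul_le_mul_of_nonneg_right hp.le (norm_nonneg ζ)
    rw [LinearIsometryEquiv.norm_map, LinearIsometryEquiv.norm_map, hξ, mul_one] at h2
    rw [hξ, mul_one] at h3 h4
    rw [h1]
    set A := ∫ x, f x * ⟪U ζ, W x (U ξ)⟫_ℂ ∂μ
    set B := ∫ x, f x * ⟪ζ, W x ξ⟫_ℂ ∂μ
    have h6 : ⟪U ζ, h⟫_ℂ * ⟪ξ, U ξ⟫_ℂ - ⟪ζ, h⟫_ℂ * ⟪ξ, ξ⟫_ℂ =
      -(A - ⟪U ζ, h⟫_ℂ * ⟪ξ, U ξ⟫_ℂ) + (A - B) + (B - ⟪ζ, h⟫_ℂ * ⟪ξ, ξ⟫_ℂ) := by ring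
    rw [h6]
    refine (norm_add₃_le).trans ?_
    rw [norm_neg]
    linarith
  set v := ⟪ξ, U ξ⟫_ℂ • U.symm h - h
  have h1 := hbound v
  rw [inner_self_eq_norm_sq_to_K, norm_pow, RCLike.norm_ofReal, abs_norm] at h1
  nlinarith [norm_nonneg v]

/-- The phase is chosen to make ⟪ξ,Uξ⟫ nonnegative. The preceding limit with h = ξ shows that its
modulus tends to 1, so in the limit for general h only the phase remains. -/
theorem exists_tendsto_phase_mul [T2Space G] (hirr : IsIrreducibleFamily W)
    (hσ : IsHeisenbergMultiplier σ) (hW : IsSigmaRepresentation σ W) :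
    ∃ c : (H ≃ₗᵢ[ℂ] H) → Circle,
      Tendsto (fun q : (G × symplecticGroup σ) × (H ≃ₗᵢ[ℂ] H) => phase H (c q.2) * q.2)
        (implementerFilter σ W) (𝓝 1) := by
  have := hirr.1
  obtain ⟨ξ, hξ⟩ := exists_norm_eq H zero_le_one
  let a : (H ≃ₗᵢ[ℂ] H) → ℂ := fun U => ⟪ξ, U ξ⟫_ℂ
  let c : (H ≃ₗᵢ[ℂ] H) → Circle := fun U => Circle.exp (-(a U).arg)
  have hc : ∀ U, a U = ‖a U‖ * conj (c U : ℂ) := by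
    intro U
    simp only [c]
    rw [Circle.coe_exp, ← Complex.exp_conj]
    nth_rewrite 1 [← Complex.norm_mul_exp_arg_mul_I (a U)]
    simp
  refine ⟨c, ?_⟩
  rw [nhds_induced, tendsto_comap_iff, tendsto_pi_nhds]
  intro h
  rw [tendsto_iff_norm_sub_tendsto_zero]
  have hlim := ((tendsto_inner_smul_symm hirr hσ hW hξ ξ).mul_const ‖h‖).add
    (tendsto_inner_smul_symm hirr hσ hW hξ h)
  rw [zero_mul, zero_add] at hlim
  refine squeeze_zero (fun _ => norm_nonneg _) (fun q => ?_) hlim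
  set U := q.2
  change ‖(c U : ℂ) • U h - h‖ ≤ ‖a U • U.symm ξ - ξ‖ * ‖h‖ + ‖a U • U.symm h - h‖
  have hcc : conj (c U : ℂ) * (c U : ℂ) = 1 := by
    rw [Complex.conj_mul', Circle.norm_coe]; norm_num
  have h1 : ‖(c U : ℂ) • U h - h‖ = ‖conj (c U : ℂ) • U.symm h - h‖ := by
    have h2 : conj (c U : ℂ) • U.symm ((c U : ℂ) • U h - h) = -(conj (c U : ℂ) • U.symm h - h) := by
      rw [map_sub, map_smul, U.symm_apply_apply, smul_sub, smul_smul, hcc, one_smul, neg_sub]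
    rw [← norm_neg (conj (c U : ℂ) • U.symm h - h), ← h2, norm_smul, RCLike.norm_conj,
      Circle.norm_coe, one_mul, LinearIsometryEquiv.norm_map]
  have h3 : |1 - ‖a U‖| ≤ ‖a U • U.symm ξ - ξ‖ := by
    have h4 := abs_norm_sub_norm_le (a U • U.symm ξ) ξ
    rwa [norm_smul, LinearIsometryEquiv.norm_map, hξ, mul_one, abs_sub_comm] at h4
  have h5 : conj (c U : ℂ) • U.symm h - h =
      ((1 - ‖a U‖ : ℝ) : ℂ) • conj (c U : ℂ) • U.symm h + (a U • U.symm h - h) := by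
    have h6 : a U • U.symm h = (‖a U‖ * conj (c U : ℂ)) • U.symm h := by rw [← hc U]
    rw [h6, smul_smul, ← add_sub_assoc, ← add_smul]
    push_cast
    congr 2
    ring
  rw [h1, h5]
  refine (norm_add_le _ _).trans (add_le_add_left ?_ _)
  rw [norm_smul, norm_smul, RCLike.norm_conj, Circle.norm_coe, one_mul,
    LinearIsometryEquiv.norm_map, Complex.norm_real]
  exact mul_le_mul_of_nonneg_right h3 (norm_nonneg _)

end Implementers

/-! ### The homomorphism onto the Clifford group -/

section CliffordHom

variable {G : Type u} [AddCommGroup G] [TopologicalSpace G] [IsTopologicalAddGroup G]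
  [LocallyCompactSpace G] [SecondCountableTopology G] [MeasurableSpace G] [BorelSpace G]
  {H : Type v} [NormedAddCommGroup H] [InnerProductSpace ℂ H] [CompleteSpace H]
  [TopologicalSpace.SeparableSpace H] [MeasurableSpace H] [BorelSpace H]
  {σ : G → G → Circle} {W : G → (H ≃ₗᵢ[ℂ] H)}

theorem phase_injective [Nontrivial H] : Function.Injective (phase H) := by
  intro c d h
  obtain ⟨v, hv⟩ := exists_ne (0 : H)
  have h1 : (c : ℂ) • v = (d : ℂ) • v := congrArg (fun A : H ≃ₗᵢ[ℂ] H => A v) h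
  exact Circle.ext (smul_left_injective ℂ hv h1)

theorem mk_eq_mk_iff_exists_phase {hσ : IsTwoCocycle σ} {hW : IsSigmaRepresentation σ W}
    {U V : cliffordOperations hσ hW} :
    (QuotientGroup.mk U : CliffordGroup hσ hW) = QuotientGroup.mk V ↔
      ∃ c, phase H c * (U : H ≃ₗᵢ[ℂ] H) = V := by
  rw [QuotientGroup.eq, Subgroup.mem_subgroupOf]
  constructor
  · rintro ⟨c, hc⟩
    refine ⟨c, ?_⟩
    rw [phase_mul_comm, hc]
    simp
  · rintro ⟨c, hc⟩
    refine ⟨c, ?_⟩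
    rw [Subgroup.coe_mul, ← hc, phase_mul_comm]
    simp

/-- The commutation phases of W(a) with all W(z) are unaffected by a scalar factor and determine a
by non-degeneracy. -/
theorem IsSigmaRepresentation.eq_of_eq_phase_mul [Nontrivial H] (hσ : IsHeisenbergMultiplier σ)
    (hW : IsSigmaRepresentation σ W) {a a' : G} {c : Circle} (h : phase H c * W a = W a') :
    a = a' := by
  have hb := hσ.isSelfDualPairing
  have h1 : ∀ z, commutationPairing σ a z = commutationPairing σ a' z := by
    intro z
    refine phase_injective (H := H) ?_
    have h2 := hW.comm a' z
    rw [← h, mul_assoc, hW.comm a z, ← mul_assoc (W z), ← phase_mul_comm, mul_assoc (phase H c),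
      ← mul_assoc (phase H c), phase_mul_comm H c (phase H _), mul_assoc] at h2
    exact mul_right_cancel h2
  rw [← sub_eq_zero]
  exact hb.eq_zero_of_forall fun z => by rw [hb.sub_left, h1, mul_inv_cancel]

theorem IsGaussianUnitary.symplectic_mul {S T : symplecticGroup σ} {U V : H ≃ₗᵢ[ℂ] H}
    (hU : IsGaussianUnitary W S.1 U) (hV : IsGaussianUnitary W T.1 V) :
    IsGaussianUnitary W (S * T).1 (U * V) :=
  hU.mul hV

theorem cliffordClass_mul (hσ : IsTwoCocycle σ) (hW : IsSigmaRepresentation σ W) {y z : G}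
    {S T : symplecticGroup σ} {U V : H ≃ₗᵢ[ℂ] H} (hU : IsGaussianUnitary W S.1 U)
    (hV : IsGaussianUnitary W T.1 V) :
    cliffordClass hσ hW y S U hU * cliffordClass hσ hW z T V hV =
      cliffordClass hσ hW (y + S.1 z) (S * T) (U * V) (hU.symplectic_mul hV) := by
  symm
  refine mk_eq_mk_iff_exists_phase.2 ⟨σ y (S.1 z), ?_⟩
  change phase H (σ y (S.1 z)) * (W (y + S.1 z) * (U * V)) = W y * U * (W z * V)
  rw [← mul_assoc, ← hW.mul, ← hU z]
  group

/-- Equal classes implement the same action on the Weyl system, which determines S up to phases in W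
and then y by its phases. Conversely, two gaussian unitaries for the same S differ by an operator
commuting with `W`, a phase by Schur's lemma. -/
theorem cliffordClass_eq_iff (hirr : IsIrreducibleFamily W) (hσ : IsHeisenbergMultiplier σ)
    (hW : IsSigmaRepresentation σ W) {y z : G} {S T : symplecticGroup σ} {U V : H ≃ₗᵢ[ℂ] H}
    (hU : IsGaussianUnitary W S.1 U) (hV : IsGaussianUnitary W T.1 V) :
    cliffordClass hσ.toIsTwoCocycle hW y S U hU = cliffordClass hσ.toIsTwoCocycle hW z T V hV ↔
      y = z ∧ S = T := by
  have := hirr.1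
  have hb := hσ.isSelfDualPairing
  constructor
  · intro h
    obtain ⟨c, hc⟩ := mk_eq_mk_iff_exists_phase.1 h
    replace hc : phase H c * (W y * U) = W z * V := hc
    have h1 : ∀ x, phase H (commutationPairing σ y (S.1 x)) * W (S.1 x) =
        phase H (commutationPairing σ z (T.1 x)) * W (T.1 x) := by
      intro x
      have h2 := hU.isImplementer hW y x
      have h3 := hV.isImplementer hW z x
      simp only [← hc] at h3
      rw [mul_assoc, h2, ← mul_assoc _ (phase H c), ← phase_mul_comm H c, mul_assoc (phase H c)] at h3
      exact mul_right_cancel (mul_left_cancel h3)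
    have hST : S = T := by
      refine Subtype.ext (ContinuousAddEquiv.ext fun x => ?_)
      refine hW.eq_of_eq_phase_mul hσ (c := (commutationPairing σ z (T.1 x))⁻¹ *
        commutationPairing σ y (S.1 x)) ?_
      rw [map_mul, mul_assoc, h1, ← mul_assoc, ← map_mul, inv_mul_cancel, map_one, one_mul]
    subst hST
    refine ⟨sub_eq_zero.1 (hb.eq_zero_of_forall fun x => ?_), rfl⟩
    have h2 := phase_injective (mul_right_cancel (h1 (S.1.symm x)))
    rw [ContinuousAddEquiv.apply_symm_apply] at h2
    rw [hb.sub_left, h2, mul_inv_cancel]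
  · rintro ⟨rfl, rfl⟩
    have h1 : ∀ x, U⁻¹ * V * W x = W x * (U⁻¹ * V) := by
      intro x
      calc U⁻¹ * V * W x = U⁻¹ * (V * W x * V⁻¹) * V := by group
        _ = U⁻¹ * (U * W x * U⁻¹) * V := by rw [hU x, hV x]
        _ = W x * (U⁻¹ * V) := by group
    obtain ⟨c, hc⟩ := hirr.exists_phase_of_commute h1
    refine mk_eq_mk_iff_exists_phase.2 ⟨c, ?_⟩
    change phase H c * (W y * U) = W y * V
    rw [phase_mul_comm, mul_assoc, hc]
    group

/-- A gaussian unitary associated with `S`. -/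
def gaussianUnitary (hirr : IsIrreducibleFamily W) (hσ : IsHeisenbergMultiplier σ)
    (hW : IsSigmaRepresentation σ W) (S : symplecticGroup σ) : H ≃ₗᵢ[ℂ] H :=
  (hirr.exists_isGaussianUnitary hσ hW S).choose

theorem isGaussianUnitary_gaussianUnitary (hirr : IsIrreducibleFamily W)
    (hσ : IsHeisenbergMultiplier σ) (hW : IsSigmaRepresentation σ W) (S : symplecticGroup σ) :
    IsGaussianUnitary W S.1 (gaussianUnitary hirr hσ hW S) :=
  (hirr.exists_isGaussianUnitary hσ hW S).choose_spec

/-- The homomorphism from the semidirect product onto the Clifford group. -/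
def cliffordHom (hirr : IsIrreducibleFamily W) (hσ : IsHeisenbergMultiplier σ)
    (hW : IsSigmaRepresentation σ W) :
    SymplecticSemidirect σ →* CliffordGroup hσ.toIsTwoCocycle hW :=
  MonoidHom.mk' (fun p => cliffordClass hσ.toIsTwoCocycle hW (Multiplicative.toAdd p.left) p.right _
    (isGaussianUnitary_gaussianUnitary hirr hσ hW p.right)) fun p q =>
      ((cliffordClass_eq_iff hirr hσ hW (isGaussianUnitary_gaussianUnitary hirr hσ hW (p * q).right)
        ((isGaussianUnitary_gaussianUnitary hirr hσ hW p.right).symplectic_mul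
          (isGaussianUnitary_gaussianUnitary hirr hσ hW q.right))).2 ⟨rfl, rfl⟩).trans
        (cliffordClass_mul hσ.toIsTwoCocycle hW _ _).symm

theorem cliffordHom_symplecticPair (hirr : IsIrreducibleFamily W) (hσ : IsHeisenbergMultiplier σ)
    (hW : IsSigmaRepresentation σ W) (y : G) (S : symplecticGroup σ) {V : H ≃ₗᵢ[ℂ] H}
    (hV : IsGaussianUnitary W S.1 V) :
    cliffordHom hirr hσ hW (symplecticPair y S) = cliffordClass hσ.toIsTwoCocycle hW y S V hV :=
  (cliffordClass_eq_iff hirr hσ hW (isGaussianUnitary_gaussianUnitary hirr hσ hW S) hV).2 ⟨rfl, rfl⟩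

theorem cliffordHom_bijective (hirr : IsIrreducibleFamily W) (hσ : IsHeisenbergMultiplier σ)
    (hW : IsSigmaRepresentation σ W) : Function.Bijective (cliffordHom hirr hσ hW) := by
  constructor
  · intro p q h
    obtain ⟨h1, h2⟩ := (cliffordClass_eq_iff hirr hσ hW
      (isGaussianUnitary_gaussianUnitary hirr hσ hW p.right)
      (isGaussianUnitary_gaussianUnitary hirr hσ hW q.right)).1 h
    exact SemidirectProduct.ext h1 h2
  · intro u
    induction u using QuotientGroup.induction_on with
    | H u =>
      obtain ⟨U, y, S, V, hV, rfl⟩ := u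
      exact ⟨symplecticPair y S, cliffordHom_symplecticPair hirr hσ hW y S hV⟩

theorem continuous_cliffordHom (hirr : IsIrreducibleFamily W) (hσ : IsHeisenbergMultiplier σ)
    (hW : IsSigmaRepresentation σ W) : Continuous (cliffordHom hirr hσ hW) := by
  have := hσ.isSelfDualPairing.t2Space
  refine continuous_of_continuousAt_one _ ?_
  obtain ⟨c, hc⟩ := exists_tendsto_phase_mul hirr hσ hW
  intro N hN
  rw [map_one] at hN
  have h1 : (QuotientGroup.mk : cliffordOperations hσ.toIsTwoCocycle hW →
      CliffordGroup hσ.toIsTwoCocycle hW) ⁻¹' N ∈ 𝓝 1 :=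
    QuotientGroup.continuous_mk.continuousAt.preimage_mem_nhds hN
  rw [nhds_subtype, mem_comap] at h1
  obtain ⟨M, hM, hMN⟩ := h1
  have h2 := hc hM
  rw [mem_map, implementerFilter, mem_inf_principal, mem_comap] at h2
  obtain ⟨A, hA, hAM⟩ := h2
  have h3 : Continuous fun p : SymplecticSemidirect σ => (Multiplicative.toAdd p.left, p.right) :=
    (continuous_toAdd.comp SemidirectProduct.continuous_left).prodMk
      SemidirectProduct.continuous_right
  rw [mem_map]
  filter_upwards [h3.continuousAt.preimage_mem_nhds (x := 1) hA] with p hp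
  have hV := isGaussianUnitary_gaussianUnitary hirr hσ hW p.right
  set V := gaussianUnitary hirr hσ hW p.right
  have h4 := hAM (a := ((Multiplicative.toAdd p.left, p.right), W (Multiplicative.toAdd p.left) * V))
    hp (hV.isImplementer hW _)
  -- Multiplying the chosen gaussian unitary by a phase does not change the class, but it brings the
  -- representative close to 1.
  have h5 := (hV.phase_mul (c (W (Multiplicative.toAdd p.left) * V)))
  have h6 : cliffordHom hirr hσ hW p = cliffordClass hσ.toIsTwoCocycle hW _ _ _ h5 :=
    cliffordHom_symplecticPair hirr hσ hW _ p.right h5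
  change cliffordHom hirr hσ hW p ∈ N
  rw [h6]
  refine hMN ?_
  change W _ * (phase H _ * V) ∈ M
  rw [← mul_assoc, ← phase_mul_comm, mul_assoc]
  exact h4

end CliffordHom

/-! ### Continuity of the inverse -/

section CliffordInverse

variable {G : Type u} [AddCommGroup G] [TopologicalSpace G] [IsTopologicalAddGroup G]
  [LocallyCompactSpace G] [SecondCountableTopology G] [MeasurableSpace G] [BorelSpace G]
  {H : Type v} [NormedAddCommGroup H] [InnerProductSpace ℂ H] [CompleteSpace H]
  [TopologicalSpace.SeparableSpace H] [MeasurableSpace H] [BorelSpace H]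
  {σ : G → G → Circle} {W : G → (H ≃ₗᵢ[ℂ] H)}

theorem continuous_of_continuous_phase [Nontrivial H] {X : Type*} [TopologicalSpace X]
    {f : X → Circle} (hf : Continuous fun x => phase H (f x)) : Continuous f := by
  obtain ⟨ξ, hξ⟩ := exists_norm_eq H zero_le_one
  refine continuous_induced_rng.2 ?_
  have h1 := (innerSL ℂ ξ).continuous.comp (continuous_unitary_iff.1 hf ξ)
  refine h1.congr fun x => ?_
  change ⟪ξ, (f x : ℂ) • ξ⟫_ℂ = _
  rw [inner_smul_right, inner_self_eq_norm_sq_to_K, hξ, RCLike.ofReal_one, one_pow, mul_one]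
  rfl

/-- The commutator of two classes in the Clifford group, as a unitary operator. -/
def cliffordCommutator {hσ : IsTwoCocycle σ} {hW : IsSigmaRepresentation σ W}
    (u v : CliffordGroup hσ hW) : H ≃ₗᵢ[ℂ] H :=
  u.out * v.out * (u.out : H ≃ₗᵢ[ℂ] H)⁻¹ * (v.out : H ≃ₗᵢ[ℂ] H)⁻¹

theorem phase_mul_commutator (c d : Circle) (U V : H ≃ₗᵢ[ℂ] H) :
    phase H c * U * (phase H d * V) * (phase H c * U)⁻¹ * (phase H d * V)⁻¹ =
      U * V * U⁻¹ * V⁻¹ := by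
  rw [mul_inv_rev, mul_inv_rev, ← map_inv, ← map_inv, ← phase_mul_comm, ← phase_mul_comm]
  calc phase H c * U * (phase H d * V) * (phase H c⁻¹ * U⁻¹) * (phase H d⁻¹ * V⁻¹)
      = phase H c * (U * (phase H d * V) * phase H c⁻¹) * (U⁻¹ * phase H d⁻¹) * V⁻¹ := by
        simp only [mul_assoc]
    _ = phase H c * (phase H c⁻¹ * (U * (phase H d * V))) * (phase H d⁻¹ * U⁻¹) * V⁻¹ := by
        rw [← phase_mul_comm H c⁻¹, ← phase_mul_comm H d⁻¹]
    _ = U * (phase H d * V * phase H d⁻¹) * U⁻¹ * V⁻¹ := by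
        simp only [map_inv]; group
    _ = U * V * U⁻¹ * V⁻¹ := by
        rw [← phase_mul_comm H d⁻¹]; simp only [map_inv]; group

/-- Phases are central, so the commutator does not depend on representatives: on classes it is still
an honest operator, not merely a class. -/
theorem cliffordCommutator_mk {hσ : IsTwoCocycle σ} {hW : IsSigmaRepresentation σ W}
    (U V : cliffordOperations hσ hW) :
    cliffordCommutator (QuotientGroup.mk U : CliffordGroup hσ hW) (QuotientGroup.mk V) =
      U * V * (U : H ≃ₗᵢ[ℂ] H)⁻¹ * (V : H ≃ₗᵢ[ℂ] H)⁻¹ := by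
  obtain ⟨c, hc⟩ := mk_eq_mk_iff_exists_phase.1 (QuotientGroup.out_eq' (QuotientGroup.mk U)).symm
  obtain ⟨d, hd⟩ := mk_eq_mk_iff_exists_phase.1 (QuotientGroup.out_eq' (QuotientGroup.mk V)).symm
  rw [cliffordCommutator, ← hc, ← hd, phase_mul_commutator]

theorem continuous_cliffordCommutator {hσ : IsTwoCocycle σ} {hW : IsSigmaRepresentation σ W} :
    Continuous fun p : CliffordGroup hσ hW × CliffordGroup hσ hW =>
      cliffordCommutator p.1 p.2 := by
  have h := (QuotientGroup.isOpenQuotientMap_mk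
    (N := (phases H).subgroupOf (cliffordOperations hσ hW)))
  -- The quotient map is open, so its square is again a quotient map and continuity can be tested
  -- upstairs.
  rw [(h.prodMap h).isQuotientMap.continuous_iff]
  have h1 : Continuous fun p : cliffordOperations hσ hW × cliffordOperations hσ hW =>
      p.1 * p.2 * (p.1 : H ≃ₗᵢ[ℂ] H)⁻¹ * (p.2 : H ≃ₗᵢ[ℂ] H)⁻¹ := by
    have h2 := continuous_subtype_val.comp (continuous_fst (X := cliffordOperations hσ hW)
      (Y := cliffordOperations hσ hW))
    have h3 := continuous_subtype_val.comp (continuous_snd (X := cliffordOperations hσ hW)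
      (Y := cliffordOperations hσ hW))
    exact ((h2.mul h3).mul h2.inv).mul h3.inv
  exact h1.congr fun p => (cliffordCommutator_mk p.1 p.2).symm

theorem cliffordCommutator_cliffordHom (hirr : IsIrreducibleFamily W)
    (hσ : IsHeisenbergMultiplier σ) (hW : IsSigmaRepresentation σ W) (y z : G) :
    cliffordCommutator (cliffordHom hirr hσ hW (symplecticPair y 1))
      (cliffordHom hirr hσ hW (symplecticPair z 1)) = phase H (commutationPairing σ y z) := by
  have h1 : IsGaussianUnitary W (1 : symplecticGroup σ).1 1 := fun x => by
    rw [one_mul, inv_one, mul_one]; rfl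
  rw [cliffordHom_symplecticPair hirr hσ hW y 1 h1, cliffordHom_symplecticPair hirr hσ hW z 1 h1]
  refine (cliffordCommutator_mk _ _).trans ?_
  change W y * 1 * (W z * 1) * (W y * 1)⁻¹ * (W z * 1)⁻¹ = _
  rw [mul_one, mul_one, hW.comm]
  group

/-- The isomorphism of the Clifford group with the semidirect product. -/
def cliffordEquiv (hirr : IsIrreducibleFamily W) (hσ : IsHeisenbergMultiplier σ)
    (hW : IsSigmaRepresentation σ W) :
    CliffordGroup hσ.toIsTwoCocycle hW ≃* SymplecticSemidirect σ :=
  (MulEquiv.ofBijective _ (cliffordHom_bijective hirr hσ hW)).symm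

theorem cliffordHom_cliffordEquiv (hirr : IsIrreducibleFamily W) (hσ : IsHeisenbergMultiplier σ)
    (hW : IsSigmaRepresentation σ W) (u : CliffordGroup hσ.toIsTwoCocycle hW) :
    cliffordHom hirr hσ hW (cliffordEquiv hirr hσ hW u) = u :=
  (MulEquiv.ofBijective _ (cliffordHom_bijective hirr hσ hW)).apply_symm_apply u

theorem continuous_symplecticPair : Continuous fun p : G × symplecticGroup σ =>
    symplecticPair p.1 p.2 :=
  continuous_semidirectProduct_iff.2 ⟨continuous_ofAdd.comp continuous_fst, continuous_snd⟩

theorem symplecticPair_apply_mul (p : SymplecticSemidirect σ) (x : G) :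
    symplecticPair (p.right.1 x) 1 * p = p * symplecticPair x 1 :=
  SemidirectProduct.ext (mul_comm _ _) ((one_mul _).trans (mul_one _).symm)

theorem symplecticPair_left_mul_right (p : SymplecticSemidirect σ) :
    symplecticPair (Multiplicative.toAdd p.left) 1 * symplecticPair 0 p.right = p :=
  SemidirectProduct.ext (mul_one _) (one_mul _)

/-- The commutator of the classes of W(f x) and W(z) is the scalar b(f x, z), jointly continuous in
x and z; self-duality turns this into continuity of f. -/
theorem continuous_of_continuous_cliffordHom (hirr : IsIrreducibleFamily W)
    (hσ : IsHeisenbergMultiplier σ) (hW : IsSigmaRepresentation σ W) {X : Type*}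
    [TopologicalSpace X] {f : X → G}
    (hf : Continuous fun x => cliffordHom hirr hσ hW (symplecticPair (f x) 1)) :
    Continuous f := by
  have := hirr.1
  refine hσ.isSelfDualPairing.continuous_of_continuous_pairing
    (continuous_of_continuous_phase (H := H) ?_)
  have hw : Continuous fun p : X × G => cliffordHom hirr hσ hW (symplecticPair p.2 1) :=
    (continuous_cliffordHom hirr hσ hW).comp
      (continuous_symplecticPair.comp (continuous_snd.prodMk continuous_const))
  have hf' : Continuous fun p : X × G => cliffordHom hirr hσ hW (symplecticPair (f p.1) 1) :=
    hf.comp continuous_fst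
  exact (continuous_cliffordCommutator.comp (hf'.prodMk hw)).congr fun p =>
    cliffordCommutator_cliffordHom hirr hσ hW _ _

/-- The point S(x) is read off from u[W(x)]u⁻¹ = [W(Sx)], whose left side is continuous in u and x.
-/
theorem continuous_cliffordEquiv_right_apply (hirr : IsIrreducibleFamily W)
    (hσ : IsHeisenbergMultiplier σ) (hW : IsSigmaRepresentation σ W) :
    Continuous fun p : CliffordGroup hσ.toIsTwoCocycle hW × G =>
      (cliffordEquiv hirr hσ hW p.1).right.1 p.2 := by
  refine continuous_of_continuous_cliffordHom hirr hσ hW ?_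
  have h1 : ∀ p : CliffordGroup hσ.toIsTwoCocycle hW × G,
      cliffordHom hirr hσ hW (symplecticPair ((cliffordEquiv hirr hσ hW p.1).right.1 p.2) 1) =
        p.1 * cliffordHom hirr hσ hW (symplecticPair p.2 1) * p.1⁻¹ := by
    intro p
    have h2 := congrArg (cliffordHom hirr hσ hW)
      (symplecticPair_apply_mul (cliffordEquiv hirr hσ hW p.1) p.2)
    rw [map_mul, map_mul, cliffordHom_cliffordEquiv] at h2
    exact eq_mul_inv_of_mul_eq h2
  simp_rw [h1]
  exact (continuous_fst.mul ((continuous_cliffordHom hirr hσ hW).comp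
    (continuous_symplecticPair.comp (continuous_snd.prodMk continuous_const)))).mul
      continuous_fst.inv

theorem continuous_cliffordEquiv (hirr : IsIrreducibleFamily W)
    (hσ : IsHeisenbergMultiplier σ) (hW : IsSigmaRepresentation σ W) :
    Continuous (cliffordEquiv hirr hσ hW) := by
  have h1 : Continuous fun u => (cliffordEquiv hirr hσ hW u).right := by
    refine Continuous.subtype_mk (continuous_topologicalAut_of_continuous_uncurry
      (f := fun u => (cliffordEquiv hirr hσ hW u).right.1)
      (continuous_cliffordEquiv_right_apply hirr hσ hW) ?_) _
    -- The inverse automorphism S⁻¹ is the symplectic part of u⁻¹, so the same lemma controls it.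
    have h2 := (continuous_cliffordEquiv_right_apply hirr hσ hW).comp
      ((continuous_inv.comp continuous_fst).prodMk continuous_snd)
    refine h2.congr fun p => ?_
    simp only [Function.comp_apply, map_inv]
    rfl
  refine continuous_semidirectProduct_iff.2 ⟨?_, h1⟩
  refine continuous_ofAdd.comp (f := fun u => Multiplicative.toAdd (cliffordEquiv hirr hσ hW u).left)
    (continuous_of_continuous_cliffordHom hirr hσ hW ?_)
  -- Once S depends continuously on u, so does [U_S], and dividing it out leaves the class of W(y).
  have h2 : ∀ u, cliffordHom hirr hσ hW
      (symplecticPair (Multiplicative.toAdd (cliffordEquiv hirr hσ hW u).left) 1) =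
        u * (cliffordHom hirr hσ hW (symplecticPair 0 (cliffordEquiv hirr hσ hW u).right))⁻¹ := by
    intro u
    rw [eq_mul_inv_iff_mul_eq, ← map_mul, symplecticPair_left_mul_right,
      cliffordHom_cliffordEquiv]
  simp_rw [h2]
  exact continuous_id.mul ((continuous_cliffordHom hirr hσ hW).comp
    (continuous_symplecticPair.comp (continuous_const.prodMk h1))).inv

end CliffordInverse

end

theorem mainTheorem4 {G : Type u} [AddCommGroup G] [TopologicalSpace G] [IsTopologicalAddGroup G]
    [LocallyCompactSpace G] [SecondCountableTopology G] [MeasurableSpace G] [BorelSpace G]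
    {H : Type v} [NormedAddCommGroup H] [InnerProductSpace ℂ H] [CompleteSpace H]
    [TopologicalSpace.SeparableSpace H] [MeasurableSpace H] [BorelSpace H]
    {σ : G → G → Circle} (hσ : IsHeisenbergMultiplier σ)
    {W : G → (H ≃ₗᵢ[ℂ] H)} (hW : IsSigmaRepresentation σ W) (hirr : IsIrreducibleFamily W) :
    IsTopologicalGroup (CliffordGroup hσ.toIsTwoCocycle hW) ∧
    IsTopologicalGroup (SymplecticSemidirect σ) ∧
    (∀ (y₁ y₂ : G) (S₁ S₂ : symplecticGroup σ),
      symplecticPair y₁ S₁ * symplecticPair y₂ S₂ =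
        symplecticPair (y₁ + S₁.1 y₂) (S₁ * S₂)) ∧
    ∃ e : CliffordGroup hσ.toIsTwoCocycle hW ≃ₜ* SymplecticSemidirect σ,
      ∀ (y : G) (S : symplecticGroup σ) (V : H ≃ₗᵢ[ℂ] H) (hV : IsGaussianUnitary W S.1 V),
        e (cliffordClass hσ.toIsTwoCocycle hW y S V hV) = symplecticPair y S := by
  refine ⟨inferInstance, inferInstance, fun _ _ _ _ => rfl,
    { cliffordEquiv hirr hσ hW with
      continuous_toFun := continuous_cliffordEquiv hirr hσ hW
      continuous_invFun := continuous_cliffordHom hirr hσ hW }, fun y S V hV => ?_⟩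
  exact (MulEquiv.symm_apply_eq _).2 (cliffordHom_symplecticPair hirr hσ hW y S hV).symm
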